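/- **Model.** Let $\Omega_x,\Omega_y\subseteq\mathbb R$ be Borel sets, $\rho$ and $\phi$ probability densities on $\Omega_x$ and $\Omega_y$, $\mu_y(dy)=\phi(y)\,dy$, and $\mathcal K:\Omega_x\times\Omega_y\to[0,\infty)$ a measurable kernel such that $\int_{\Omega_y}\mathcal K(x,y)\phi(y)\,dy<\infty$ for every $x\in\Omega_x$. For each $x\in\Omega_x$ let $\varrho_x$ be a probability density on $(0,\infty)$, jointly measurable in $(x,r)$, and write $\langle r^n\rangle_x=\int_0^\infty r^n\varrho_x(r)\,dr$. A trip mobility network with these data consists of locations $i=0,1,2,\dots$ such that: * (A1) the attractivenesses $x_i$ of the locations are random variables with density $\rho$, and the pairs (attractiveness, record of the trips to the location) are independent and identically distributed over the locations; * (A2) conditionally on attractiveness $x$, the trips to a location arrive with intensity $d\mathcal V_x=\mathcal K(x,y)\mu_y(dy)$ per unit time, i.e. the pairs (arrival time, productiveness of the origin) form a Poisson random measure on $[0,\infty)\times\mathbb R$ with intensity $dt\otimes\mathcal K(x,y)\mu_y(dy)$, where $\mu_y$ is regarded as a measure on $\mathbb R$ carried by $\Omega_y$; * (A3) conditionally on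 attractiveness $x$, the weights of the trips are i.i.d. with density $\varrho_x$ and independent of the arrival times and origins. The strength $\kappa$ of a location at time $t$ is the sum of the weights of all trips that have arrived there up to time $t$; its number of visits is the number of these trips. Let $p_x(d\kappa,t)$ be the law of the strength at time $t$ of a location of attractiveness $x$ (the conditional visit distribution), and let $P(d\kappa,t)=\mathbb E\big[\tfrac1n\sum_{i<n}\delta_{\kappa_i(t)}\big]$ be the overall visit distribution of the first $n\ge1$ locations. Let $\nu_x=\int_{\Omega_y}d\mathcal V_x$ be the attraction rate. **Proposition.** 1. For $x\in\Omega_x$, $\nu_x=\int_{\Omega_y}\mathcal K(x,y)\phi(y)\,dy$, and $\nu_x$ is the transition rate of the number of visits: for all $t\ge0$ and $k\in\mathbb N$, $\ \lim_{h\downarrow0}h^{-1}\,\mathbb P_x(k\text{ visits at }t,\ k+1\text{ visits at }t+h)=\nu_x\,\mathbb P_x(k\text{ visits at }t)$, where $\mathbb P_x$ is the law of the trips to a location of attractiveness $x$. 2. For $x\in\Omega_x$, the probability measures $p_x(\cdot,t)$ satisfy $p_x(\cdot,0)=\delta_0$ and the Kolmogorov–Feller master equation $$\frac{\partial}{\partial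 t}p_x(\kappa,t)=\int_0^\infty\nu_x\varrho_x(r)\,[p_x(\kappa-r,t)-p_x(\kappa,t)]\,dr,\qquad t\ge0,$$ in the sense of measures: for every Borel set $B\subseteq\mathbb R$ and $t\ge0$ (one-sided derivative at $t=0$), $\frac{d}{dt}p_x(B,t)=\int_0^\infty\nu_x\varrho_x(r)[p_x(B-r,t)-p_x(B,t)]\,dr$. They are the only family of finite measures on $\mathbb R$ that does so. Moreover $p_x(d\kappa,t)=e^{-\nu_xt}\delta_0(d\kappa)+q_x(\kappa,t)\mathbf 1_{\kappa>0}\,d\kappa$ with a measurable $q_x\ge0$ such that for almost every $\kappa>0$ and all $t\ge0$ $$\frac{\partial}{\partial t}q_x(\kappa,t)=\nu_x\Big(\int_0^\kappa\varrho_x(r)q_x(\kappa-r,t)\,dr+e^{-\nu_xt}\varrho_x(\kappa)\Big)-\nu_xq_x(\kappa,t),$$ where the integral converges. 3. If $x\in\Omega_x$, $\nu_x>0$ and $\langle r^2\rangle_x<\infty$, then as $t\to\infty$ the total variation distance between $p_x(\cdot,t)$ and the truncated normal law on $[0,\infty)$ with density $$\epsilon_t\,\frac{1}{\sqrt{2\pi\nu_x\langle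 r^2\rangle_xt}}\exp\Big(-\frac{(\kappa-\nu_x\langle r\rangle_xt)^2}{2\nu_x\langle r^2\rangle_xt}\Big),\qquad \epsilon_t=\frac{2}{1+\operatorname{erf}\Big(\frac{\nu_x\langle r\rangle_xt}{\sqrt{2\nu_x\langle r^2\rangle_xt}}\Big)},$$ tends to $0$, and $\epsilon_t\to1$. 4. For all $n\ge1$ and $t\ge0$, the overall visit distribution is the mixture $P(\cdot,t)=\int_{\Omega_x}p_x(\cdot,t)\rho(x)\,dx$. 5. Suppose that $\langle r^2\rangle_x<\infty$ for all $x\in\Omega_x$, that $\Omega_x$ is a set of unique differentiability (for instance open, or a nondegenerate interval), and that for all $\kappa\in\mathbb R$ and $t>0$ the function $z(x)=\kappa-\nu_x\langle r\rangle_xt$ is continuously differentiable on $\Omega_x$ with $z'$ nowhere zero. Then, as $t\to\infty$, $$P(\kappa,t)\sim\sum_{i}|z'(x_{0,i})|^{-1}\rho(x_{0,i}),$$ where $x_{0,i}=x_{0,i}(\kappa,t)$ are the zeros of $z$ in $\Omega_x$, in the sense that the total variation distance between $P(\cdot,t)$ and the measure whose density in $\kappa$ is the right-hand side tends to $0$.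 -/

import Mathlib

open MeasureTheory ProbabilityTheory Set Filter Topology
open scoped NNReal ENNReal

noncomputable section

namespace TripMobility

/-- The data of the visitation model: type spaces, latent-variable densities, attraction kernel
and the densities of the (positive) trip weights. -/
structure Model where
  /-- attractiveness space -/
  Ωx : Set ℝ
  /-- productiveness space -/
  Ωy : Set ℝ
  /-- attractiveness density -/
  ρ : ℝ → ℝ≥0
  /-- productiveness density -/
  φ : ℝ → ℝ≥0
  /-- attraction kernel `K x y` -/
  K : ℝ → ℝ → ℝ≥0
  /-- `weightPDF x r` is the density at `r > 0` of the weight of a trip to a destination of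
  attractiveness `x` -/
  weightPDF : ℝ → ℝ → ℝ≥0
  measurableSet_Ωx : MeasurableSet Ωx
  measurableSet_Ωy : MeasurableSet Ωy
  measurable_ρ : Measurable ρ
  measurable_φ : Measurable φ
  measurable_K : Measurable (Function.uncurry K)
  measurable_weightPDF : Measurable (Function.uncurry weightPDF)
  lintegral_ρ : ∫⁻ x in Ωx, ρ x = 1
  lintegral_φ : ∫⁻ y in Ωy, φ y = 1
  lintegral_weightPDF : ∀ x ∈ Ωx, ∫⁻ r in Ioi (0 : ℝ), weightPDF x r = 1
  lintegral_K_lt_top : ∀ x ∈ Ωx, ∫⁻ y in Ωy, (K x y : ℝ≥0∞) * φ y < ⊤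

namespace Model

variable (M : Model)

/-- Law of the attractiveness of a location. -/
def μx : Measure ℝ := (volume.restrict M.Ωx).withDensity fun x => (M.ρ x : ℝ≥0∞)

/-- Law of the productiveness of a location. -/
def μy : Measure ℝ := (volume.restrict M.Ωy).withDensity fun y => (M.φ y : ℝ≥0∞)

/-- The arrival intensity `dV_x = K(x,y) μ_y(dy)`, a measure on origin types. -/
def arrivalIntensity (x : ℝ) : Measure ℝ := M.μy.withDensity fun y => (M.K x y : ℝ≥0∞)

/-- The attraction rate `ν_x = ∫ dV_x`. -/
def rate (x : ℝ) : ℝ := (M.arrivalIntensity x).real univ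

/-- Law of the weight of a trip to a destination of attractiveness `x`. -/
def weightLaw (x : ℝ) : Measure ℝ :=
  (volume.restrict (Ioi 0)).withDensity fun r => (M.weightPDF x r : ℝ≥0∞)

/-- The moment `⟨r ^ n⟩_x` of the trip weights. -/
def weightMoment (n : ℕ) (x : ℝ) : ℝ := ∫ r in Ioi (0 : ℝ), r ^ n * M.weightPDF x r

/-- Finiteness of the second moment of the trip weights. -/
def FiniteSecondMoment (x : ℝ) : Prop :=
  IntegrableOn (fun r : ℝ => r ^ 2 * M.weightPDF x r) (Ioi 0)

/-- `z(x) = κ - ν_x ⟨r⟩_x t`. -/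
def z (κ t x : ℝ) : ℝ := κ - M.rate x * M.weightMoment 1 x * t

/-- `∑ |z'(x₀)|⁻¹ ρ(x₀)` over the zeros `x₀ ∈ Ω_x` of `z`. -/
def rootSum (κ t : ℝ) : ℝ≥0∞ :=
  ∑' x : {x : ℝ // x ∈ M.Ωx ∧ M.z κ t x = 0},
    ENNReal.ofReal (|derivWithin (M.z κ t) M.Ωx x|⁻¹ * M.ρ x)

end Model

/-- A trip: its arrival time (`⊤` if it never arrives), the productiveness of its origin, and its
weight. -/
abbrev Trip : Type := ℝ≥0∞ × ℝ × ℝ≥0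

/-- The record of all trips to one destination. The labels carry no meaning; in particular they
need not follow the order of arrival. -/
abbrev TripRecord : Type := ℕ → Trip

/-- Number of arriving trips whose pair (arrival time, origin) lies in `B`. -/
def tripCount (B : Set (ℝ × ℝ)) (τ : TripRecord) : ℕ∞ :=
  Set.encard {k | (τ k).1 ≠ ⊤ ∧ ((τ k).1.toReal, (τ k).2.1) ∈ B}

/-- Number of visits (in-degree) up to time `t`. -/
def visits (t : ℝ) (τ : TripRecord) : ℕ∞ := Set.encard {k | (τ k).1 ≤ ENNReal.ofReal t}

open Classical in
/-- Visit strength (weighted in-degree) at time `t`: the sum of the weights of all trips arrived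
up to time `t`. -/
def strength (t : ℝ) (τ : TripRecord) : ℝ :=
  (∑' k, if (τ k).1 ≤ ENNReal.ofReal t then ((τ k).2.2 : ℝ≥0∞) else 0).toReal

/-- Under `Q`, the pairs (arrival time, origin) form a Poisson random measure on
`[0, ∞) × ℝ` with intensity `dt ⊗ V(dy)`. -/
structure IsPoissonArrival (Q : Measure TripRecord) (V : Measure ℝ) : Prop where
  poisson : ∀ (B : Set (ℝ × ℝ)) (l : ℝ≥0), MeasurableSet B →
    ((volume.restrict (Ici (0 : ℝ))).prod V) B = l →
    ∀ n : ℕ, Q {τ | tripCount B τ = n} = poissonMeasure l {n}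
  indep : ∀ (m : ℕ) (B : Fin m → Set (ℝ × ℝ)), (∀ i, MeasurableSet (B i)) →
    Pairwise (Function.onFun Disjoint B) → iIndepFun (fun i => tripCount (B i)) Q

/-- Under `Q`, the weights are i.i.d. with law `W`, and independent of arrival times and
origins. -/
structure HasIIDWeights (Q : Measure TripRecord) (W : Measure ℝ) : Prop where
  law : ∀ k, Q.map (fun τ => ((τ k).2.2 : ℝ)) = W
  iIndep : iIndepFun (fun k (τ : TripRecord) => (τ k).2.2) Q
  indep_arrivals : IndepFun (fun (τ : TripRecord) k => (τ k).2.2)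
    (fun (τ : TripRecord) k => ((τ k).1, (τ k).2.1)) Q

/-- A trip mobility network on the probability space `(Ω, P)` with locations labelled by `ℕ`. -/
structure Network (M : Model) {Ω : Type*} [MeasurableSpace Ω] (P : Measure Ω) where
  /-- `classLaw x` is the law of the trip record of a destination of attractiveness `x`. -/
  classLaw : Kernel ℝ TripRecord
  isMarkov : IsMarkovKernel classLaw
  /-- trips to destinations of attractiveness `x` arrive with intensity `dt ⊗ K(x,y) μ_y(dy)` -/
  arrivals : ∀ x ∈ M.Ωx, IsPoissonArrival (classLaw x) (M.arrivalIntensity x)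
  /-- trip weights are i.i.d. with density `weightPDF x`, independent of the arrivals -/
  weights : ∀ x ∈ M.Ωx, HasIIDWeights (classLaw x) (M.weightLaw x)
  /-- attractiveness of location `i` -/
  X : ℕ → Ω → ℝ
  /-- record of the trips to location `i` -/
  trips : ℕ → Ω → TripRecord
  measurable_X : ∀ i, Measurable (X i)
  measurable_trips : ∀ i, Measurable (trips i)
  /-- locations are independent of each other -/
  iIndep : iIndepFun (fun i ω => (X i ω, trips i ω)) P
  /-- `X i` has density `ρ`, and given `X i = x` the trips have law `classLaw x` -/
  law : ∀ i, P.map (fun ω => (X i ω, trips i ω)) = M.μx.compProd classLaw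

namespace Network

variable {M : Model} {Ω : Type*} [MeasurableSpace Ω] {P : Measure Ω} (N : Network M P)

/-- Conditional visit distribution `p_x(dκ, t)`. -/
def condVisit (x t : ℝ) : Measure ℝ := (N.classLaw x).map (strength t)

/-- Overall visit distribution `P(dκ, t)` of the first `n` locations: the expectation of the
empirical measure `n⁻¹ ∑_{i < n} δ_{κ_i(t)}`. -/
def visitDistribution (n : ℕ) (t : ℝ) : Measure ℝ :=
  (n : ℝ≥0∞)⁻¹ • ∑ i ∈ Finset.range n, P.map (fun ω => strength t (N.trips i ω))

end Network

/-- The Kolmogorov–Feller master equation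
`∂ₜ p(κ,t) = ∫₀^∞ ν w(r) [p(κ - r, t) - p(κ, t)] dr`, `t ≥ 0`, for measures `p t` on `ℝ`, tested on
every Borel set: the shifted density `p(κ - r, t)` gives `B` the mass
`p t {κ | κ + r ∈ B}`. -/
def MasterEquation (ν : ℝ) (w : ℝ → ℝ≥0) (p : ℝ → Measure ℝ) : Prop :=
  ∀ B : Set ℝ, MeasurableSet B → ∀ t : ℝ, 0 ≤ t →
    HasDerivWithinAt (fun s => (p s).real B)
      (∫ r in Ioi (0 : ℝ), ν * w r * ((p t).real {κ | κ + r ∈ B} - (p t).real B)) (Ici 0) t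

/-- The error function. -/
def erf (u : ℝ) : ℝ := 2 / √Real.pi * ∫ s in (0 : ℝ)..u, Real.exp (-s ^ 2)

/-- The factor `2 / (1 + erf (m / √(2 v)))`. -/
def truncFactor (m v : ℝ) : ℝ := 2 / (1 + erf (m / √(2 * v)))

/-- The normal law with parameters `m`, `v`, truncated to `[0, ∞)`. -/
def truncNormal (m v : ℝ) : Measure ℝ :=
  (volume.restrict (Ici 0)).withDensity fun κ => ENNReal.ofReal
    (truncFactor m v * (1 / √(2 * Real.pi * v) * Real.exp (-(κ - m) ^ 2 / (2 * v))))

/-- The total variation distance of `p t` and `q t` tends to `0` as `t → ∞`. -/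
def AsympEqTV (p q : ℝ → Measure ℝ) : Prop :=
  ∀ ε : ℝ, 0 < ε → ∀ᶠ t in atTop, ∀ B : Set ℝ, MeasurableSet B →
    |(p t).real B - (q t).real B| ≤ ε

end TripMobility

end

noncomputable section

namespace TripMobility

/-!
Given its attractiveness, the strength of a location is compound Poisson with absolutely continuous
jumps. Differentiating the Poisson weights gives the master equation, and Picard iteration in total
variation gives uniqueness.

For the normal asymptotics in total variation, note that small translates of the jump law share a
common component with it, and that one further jump moves a compound Poisson law with `s` expected
jumps by only `O(s ^ (-1/2))`; so a translation by `y` costs `O((1 + |y|) / √s)`, and convolving the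
standardized law with a narrow normal law changes it little. That convolution upgrades the weak
central limit theorem to total variation.

After rescaling by `t`, the mixture over all attractivenesses is the law of the mean growth rate
`ν_x ⟨r⟩_x` perturbed by normal noise of variance `O(1 / t)`. By the area formula the law of the
growth rate has a density, whose value is the sum over the zeros of `z`, and by continuity of
translations in `L¹` the vanishing noise is negligible.
-/

/-! ### Total variation distance -/

section TotalVariation

variable {α β : Type*} [MeasurableSpace α] [MeasurableSpace β]

/-- The total variation distance `sup_B |μ B - ν B|` of finite measures, normalised so that
probability measures have distance at most `1`. -/
def tvDist (μ ν : Measure α) : ℝ≥0∞ :=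
  ⨆ (B : Set α) (_ : MeasurableSet B), edist (μ.real B) (ν.real B)

lemma edist_real_le_tvDist (μ ν : Measure α) {B : Set α} (hB : MeasurableSet B) :
    edist (μ.real B) (ν.real B) ≤ tvDist μ ν :=
  le_iSup₂ (f := fun B (_ : MeasurableSet B) => edist (μ.real B) (ν.real B)) B hB

lemma tvDist_le {μ ν : Measure α} {ε : ℝ≥0∞}
    (h : ∀ B, MeasurableSet B → edist (μ.real B) (ν.real B) ≤ ε) : tvDist μ ν ≤ ε :=
  iSup₂_le h

@[simp] lemma tvDist_self (μ : Measure α) : tvDist μ μ = 0 := by simp [tvDist]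

lemma tvDist_comm (μ ν : Measure α) : tvDist μ ν = tvDist ν μ := by
  simp only [tvDist, edist_comm]

lemma tvDist_triangle (μ ν ξ : Measure α) : tvDist μ ξ ≤ tvDist μ ν + tvDist ν ξ :=
  tvDist_le fun _ hB => (edist_triangle _ _ _).trans
    (add_le_add (edist_real_le_tvDist _ _ hB) (edist_real_le_tvDist _ _ hB))

lemma asympEqTV_iff {p q : ℝ → Measure ℝ} :
    AsympEqTV p q ↔ Tendsto (fun t => tvDist (p t) (q t)) atTop (𝓝 0) := by
  have tvDist_le_ofReal_iff {ε : ℝ} (hε : 0 < ε) (t : ℝ) : tvDist (p t) (q t) ≤ .ofReal ε ↔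
      ∀ B, MeasurableSet B → |(p t).real B - (q t).real B| ≤ ε := by
    simp only [tvDist, iSup₂_le_iff, edist_le_ofReal hε.le, Real.dist_eq]
  simp only [AsympEqTV, ENNReal.tendsto_nhds_zero]
  refine ⟨fun h ε hε => ?_, fun h ε hε => ?_⟩
  · rcases eq_or_ne ε ⊤ with rfl | hε'
    · exact .of_forall fun _ => le_top
    have hpos := ENNReal.toReal_pos hε.ne' hε'
    filter_upwards [h ε.toReal hpos] with t ht
    simpa only [ENNReal.ofReal_toReal hε'] using (tvDist_le_ofReal_iff hpos t).2 ht
  · filter_upwards [h _ (ENNReal.ofReal_pos.2 hε)] with t ht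
    exact (tvDist_le_ofReal_iff hε t).1 ht

lemma tvDist_map_le (μ ν : Measure α) {f : α → β} (hf : Measurable f) :
    tvDist (μ.map f) (ν.map f) ≤ tvDist μ ν :=
  tvDist_le fun B hB => by
    simpa only [map_measureReal_apply hf hB] using edist_real_le_tvDist μ ν (hf hB)

lemma tvDist_le_of_le_add {μ ν : Measure α} [IsProbabilityMeasure μ] [IsProbabilityMeasure ν]
    {ε : ℝ≥0∞} (h : ∀ B, MeasurableSet B → μ B ≤ ν B + ε) : tvDist μ ν ≤ ε := by
  rcases eq_or_ne ε ⊤ with rfl | hε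
  · exact le_top
  have real_le_add : ∀ B, MeasurableSet B → μ.real B ≤ ν.real B + ε.toReal := fun B hB => by
    rw [measureReal_def, measureReal_def, ← ENNReal.toReal_add (measure_ne_top _ _) hε]
    exact ENNReal.toReal_mono (by finiteness) (h B hB)
  refine tvDist_le fun B hB => ?_
  have hB' := real_le_add Bᶜ hB.compl
  rw [probReal_compl_eq_one_sub hB, probReal_compl_eq_one_sub hB] at hB'
  rw [edist_dist, Real.dist_eq]
  exact ENNReal.ofReal_le_of_le_toReal
    (abs_sub_le_iff.2 ⟨by linarith [real_le_add B hB], by linarith⟩)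

lemma tvDist_le_ofReal {μ ν : Measure α} [IsFiniteMeasure μ] [IsFiniteMeasure ν] {C : ℝ}
    (hμ : μ.real univ ≤ C) (hν : ν.real univ ≤ C) : tvDist μ ν ≤ ENNReal.ofReal C := by
  refine tvDist_le fun B _ => ?_
  rw [edist_le_ofReal (measureReal_nonneg.trans hμ), Real.dist_eq]
  exact abs_sub_le_of_nonneg_of_le measureReal_nonneg
    ((measureReal_mono (subset_univ B)).trans hμ) measureReal_nonneg
    ((measureReal_mono (subset_univ B)).trans hν)

lemma tvDist_le_one (μ ν : Measure α) [IsProbabilityMeasure μ] [IsProbabilityMeasure ν] :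
    tvDist μ ν ≤ 1 := by
  simpa using tvDist_le_ofReal (μ := μ) (ν := ν) (C := 1) probReal_univ.le probReal_univ.le

lemma integrable_real_of_bind {m : Measure α} {κ : α → Measure β} (hκ : Measurable κ)
    [IsFiniteMeasure (m.bind κ)] {B : Set β} (hB : MeasurableSet B) :
    Integrable (fun x => (κ x).real B) m :=
  integrable_toReal_of_lintegral_ne_top (Measure.measurable_measure.1 hκ B hB).aemeasurable
    (Measure.bind_apply hB hκ.aemeasurable ▸ measure_ne_top (m.bind κ) B)

lemma bind_real_apply {m : Measure α} {κ : α → Measure β} (hκ : Measurable κ)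
    [IsFiniteMeasure (m.bind κ)] {B : Set β} (hB : MeasurableSet B) :
    (m.bind κ).real B = ∫ x, (κ x).real B ∂m := by
  have hκB := Measure.measurable_measure.1 hκ B hB
  have hbind := Measure.bind_apply (m := m) hB hκ.aemeasurable
  rw [measureReal_def, hbind]
  exact (integral_toReal hκB.aemeasurable
    (ae_lt_top hκB (hbind ▸ measure_ne_top (m.bind κ) B))).symm

lemma tvDist_bind_le {m : Measure α} {κ η : α → Measure β} (hκ : Measurable κ)
    (hη : Measurable η) [IsFiniteMeasure (m.bind κ)] [IsFiniteMeasure (m.bind η)] :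
    tvDist (m.bind κ) (m.bind η) ≤ ∫⁻ x, tvDist (κ x) (η x) ∂m := by
  refine tvDist_le fun B hB => ?_
  rw [bind_real_apply hκ hB, bind_real_apply hη hB, edist_eq_enorm_sub,
    ← integral_sub (integrable_real_of_bind hκ hB) (integrable_real_of_bind hη hB)]
  refine (enorm_integral_le_lintegral_enorm _).trans (lintegral_mono fun x => ?_)
  rw [← edist_eq_enorm_sub]
  exact edist_real_le_tvDist _ _ hB

/-- No measurability is required of `E`, since `lintegral` is a lower integral. -/
lemma tendsto_lintegral_zero_of_le {ι : Type*} {m : Measure α} {l : Filter ι}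
    [l.IsCountablyGenerated] {E : ι → α → ℝ≥0∞} {bound : α → ℝ≥0∞} (hE : ∀ i x, E i x ≤ bound x)
    (hbound : ∫⁻ x, bound x ∂m ≠ ⊤) (hlim : ∀ᵐ x ∂m, Tendsto (fun i => E i x) l (𝓝 0)) :
    Tendsto (fun i => ∫⁻ x, E i x ∂m) l (𝓝 0) := by
  choose F hFm hFE hF using fun i => exists_measurable_le_lintegral_eq (μ := m) (E i)
  simp_rw [hF]
  rw [← lintegral_zero (μ := m) (α := α)]
  refine tendsto_lintegral_filter_of_dominated_convergence bound (.of_forall hFm)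
    (.of_forall fun i => .of_forall fun x => (hFE i x).trans (hE i x)) hbound ?_
  filter_upwards [hlim] with x hx
  exact tendsto_of_tendsto_of_tendsto_of_le_of_le tendsto_const_nhds hx (fun _ => zero_le)
    (fun i => hFE i x)

lemma tendsto_tvDist_withDensity {ι : Type*} {l : Filter ι} [l.IsCountablyGenerated]
    {m : Measure α} {f : ι → α → ℝ≥0∞} {g : α → ℝ≥0∞} (hf : ∀ i, Measurable (f i))
    (hg : Measurable g) [∀ i, IsProbabilityMeasure (m.withDensity (f i))]
    [IsProbabilityMeasure (m.withDensity g)]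
    (hlim : ∀ᵐ x ∂m, Tendsto (fun i => f i x) l (𝓝 (g x))) :
    Tendsto (fun i => tvDist (m.withDensity g) (m.withDensity (f i))) l (𝓝 0) := by
  have lintegral_g : ∫⁻ x, g x ∂m ≠ ⊤ := by
    simpa only [withDensity_apply _ .univ, setLIntegral_univ] using
      measure_ne_top (m.withDensity g) univ
  have tvDist_le_lintegral_sub (i : ι) :
      tvDist (m.withDensity g) (m.withDensity (f i)) ≤ ∫⁻ x, (g x - f i x) ∂m := by
    refine tvDist_le_of_le_add fun B hB => ?_
    rw [withDensity_apply _ hB, withDensity_apply _ hB]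
    calc ∫⁻ x in B, g x ∂m ≤ ∫⁻ x in B, (f i x + (g x - f i x)) ∂m :=
          lintegral_mono fun x => le_add_tsub
      _ = ∫⁻ x in B, f i x ∂m + ∫⁻ x in B, (g x - f i x) ∂m := lintegral_add_left (hf i) _
      _ ≤ _ := by gcongr; exact Measure.restrict_le_self
  refine tendsto_of_tendsto_of_tendsto_of_le_of_le tendsto_const_nhds ?_ (fun _ => zero_le)
    tvDist_le_lintegral_sub
  refine tendsto_lintegral_zero_of_le (fun i x => tsub_le_self) lintegral_g ?_
  filter_upwards [hlim, ae_lt_top hg lintegral_g] with x hx hgx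
  simpa only [tsub_self] using ENNReal.Tendsto.sub (tendsto_const_nhds (x := g x)) hx (.inl hgx.ne)

lemma tvDist_le_enorm_Lp_sub {m : Measure α} {μ ν : Measure α} {f g : Lp ℝ 1 m}
    (hf : ∀ B, MeasurableSet B → μ.real B = ∫ x in B, f x ∂m)
    (hg : ∀ B, MeasurableSet B → ν.real B = ∫ x in B, g x ∂m) : tvDist μ ν ≤ ‖f - g‖ₑ := by
  refine tvDist_le fun B hB => ?_
  rw [hf B hB, hg B hB, edist_eq_enorm_sub, ← integral_sub
    (L1.integrable_coeFn f).integrableOn (L1.integrable_coeFn g).integrableOn, Lp.enorm_def,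
    eLpNorm_one_eq_lintegral_enorm]
  calc ‖∫ x in B, (f x - g x) ∂m‖ₑ ≤ ∫⁻ x in B, ‖f x - g x‖ₑ ∂m :=
        enorm_integral_le_lintegral_enorm _
    _ ≤ ∫⁻ x, ‖f x - g x‖ₑ ∂m := setLIntegral_le_lintegral _ _
    _ = ∫⁻ x, ‖(f - g) x‖ₑ ∂m := lintegral_congr_ae <| by
        filter_upwards [Lp.coeFn_sub f g] with x hx
        rw [hx, Pi.sub_apply]

section Translation

variable {G : Type*} [AddGroup G] [TopologicalSpace G] [IsTopologicalAddGroup G]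
  [MeasurableSpace G] [BorelSpace G] {m : Measure G} [m.IsAddLeftInvariant]

lemma map_add_left_real_eq_setIntegral {μ : Measure G} {f : Lp ℝ 1 m}
    (hf : ∀ B, MeasurableSet B → μ.real B = ∫ x in B, f x ∂m) (h : G) {B : Set G}
    (hB : MeasurableSet B) :
    (μ.map (h + ·)).real B = ∫ x in B, (DomAddAct.mk (-h) +ᵥ f : Lp ℝ 1 m) x ∂m := by
  rw [map_measureReal_apply (measurable_const_add h) hB, hf _ (measurable_const_add h hB)]
  calc ∫ x in (h + ·) ⁻¹' B, f x ∂m = ∫ x in (h + ·) ⁻¹' B, f (-h + (h + x)) ∂m := by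
        simp only [neg_add_cancel_left]
    _ = ∫ x in B, f (-h + x) ∂m := (measurePreserving_add_left m h).setIntegral_preimage_emb
        (measurableEmbedding_addLeft h) (fun x => f (-h + x)) B
    _ = _ := (integral_congr_ae (ae_restrict_of_ae (DomAddAct.vadd_Lp_ae_eq (.mk (-h)) f))).symm

lemma tendsto_tvDist_map_add [R1Space G] [m.InnerRegularCompactLTTop] [IsLocallyFiniteMeasure m]
    [SigmaFinite m] {μ : Measure G} [IsFiniteMeasure μ] (hμ : μ ≪ m) :
    Tendsto (fun h : G => tvDist μ (μ.map (h + ·))) (𝓝 0) (𝓝 0) := by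
  have integrable_rnDeriv : Integrable (fun x => (μ.rnDeriv m x).toReal) m :=
    Measure.integrable_toReal_rnDeriv
  set f : Lp ℝ 1 m := integrable_rnDeriv.toL1 _
  have μ_real_eq : ∀ B, MeasurableSet B → μ.real B = ∫ x in B, f x ∂m := fun B _ => by
    rw [← Measure.setIntegral_toReal_rnDeriv hμ]
    exact (integral_congr_ae (ae_restrict_of_ae integrable_rnDeriv.coeFn_toL1)).symm
  have : Fact ((1 : ℝ≥0∞) ≠ ⊤) := ⟨ENNReal.one_ne_top⟩
  have tendsto_translate : Tendsto (fun h : G => ‖f - (DomAddAct.mk (-h) +ᵥ f : Lp ℝ 1 m)‖ₑ)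
      (𝓝 0) (𝓝 0) := by
    have hcont : Continuous fun h : G => ‖f - (DomAddAct.mk (-h) +ᵥ f : Lp ℝ 1 m)‖ₑ := by
      have : Continuous fun h : G => (DomAddAct.mk (-h) +ᵥ f : Lp ℝ 1 m) :=
        (DomAddAct.continuous_mk.comp continuous_neg).vadd continuous_const
      fun_prop
    simpa only [neg_zero, DomAddAct.mk_zero, zero_vadd, sub_self, enorm_zero] using hcont.tendsto 0
  exact tendsto_of_tendsto_of_tendsto_of_le_of_le tendsto_const_nhds tendsto_translate
    (fun _ => zero_le) fun h => tvDist_le_enorm_Lp_sub μ_real_eq fun B hB =>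
      map_add_left_real_eq_setIntegral μ_real_eq h hB

end Translation

section Convolution

variable {G : Type*} [AddMonoid G] [MeasurableSpace G] [MeasurableAdd₂ G]

lemma measurable_map_add_left (ν : Measure G) [SFinite ν] :
    Measurable fun x : G => ν.map (x + ·) := by
  refine Measure.measurable_of_measurable_coe _ fun B hB => ?_
  simp only [Measure.map_apply (measurable_const_add _) hB]
  exact measurable_measure_prodMk_left (measurable_add hB)

lemma conv_eq_bind (μ ν : Measure G) [SFinite ν] : μ ∗ ν = μ.bind fun x => ν.map (x + ·) := by
  refine Measure.ext_of_lintegral _ fun f hf => ?_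
  rw [Measure.lintegral_conv hf,
    Measure.lintegral_bind (measurable_map_add_left ν).aemeasurable hf.aemeasurable]
  exact lintegral_congr fun x => (lintegral_map hf (measurable_const_add x)).symm

lemma tvDist_conv_left_le (ξ μ ν : Measure G) [IsProbabilityMeasure ξ] [IsFiniteMeasure μ]
    [IsFiniteMeasure ν] : tvDist (ξ ∗ μ) (ξ ∗ ν) ≤ tvDist μ ν := by
  have hμ : IsFiniteMeasure (ξ.bind fun x => μ.map (x + ·)) := conv_eq_bind ξ μ ▸ inferInstance
  have hν : IsFiniteMeasure (ξ.bind fun x => ν.map (x + ·)) := conv_eq_bind ξ ν ▸ inferInstance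
  rw [conv_eq_bind, conv_eq_bind]
  calc _ ≤ ∫⁻ x, tvDist (μ.map (x + ·)) (ν.map (x + ·)) ∂ξ :=
        tvDist_bind_le (measurable_map_add_left μ) (measurable_map_add_left ν)
    _ ≤ ∫⁻ _, tvDist μ ν ∂ξ := lintegral_mono fun x => tvDist_map_le μ ν (measurable_const_add x)
    _ = _ := by rw [lintegral_const, measure_univ, mul_one]

lemma tvDist_conv_self_le (ξ μ : Measure G) [IsProbabilityMeasure ξ] [IsFiniteMeasure μ] :
    tvDist μ (ξ ∗ μ) ≤ ∫⁻ y, tvDist μ (μ.map (y + ·)) ∂ξ := by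
  have hconst : ξ.bind (fun _ => μ) = μ := by rw [Measure.bind_const, measure_univ, one_smul]
  have hfin : IsFiniteMeasure (ξ.bind fun _ => μ) := hconst.symm ▸ inferInstance
  have hμ : IsFiniteMeasure (ξ.bind fun x => μ.map (x + ·)) := conv_eq_bind ξ μ ▸ inferInstance
  rw [conv_eq_bind]
  nth_rewrite 1 [← hconst]
  exact tvDist_bind_le measurable_const (measurable_map_add_left μ)

end Convolution

end TotalVariation

/-! ### Poisson mixtures and compound Poisson laws -/

lemma integral_abs_le_sqrt_integral_sq {α : Type*} [MeasurableSpace α] {μ : Measure α}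
    [IsProbabilityMeasure μ] {f : α → ℝ} (hf : MemLp f 2 μ) :
    ∫ x, |f x| ∂μ ≤ √(∫ x, f x ^ 2 ∂μ) := by
  have hf_abs : MemLp (fun x => |f x|) 2 μ := hf.abs
  have h := variance_nonneg (fun x => |f x|) μ
  rw [variance_eq_sub hf_abs] at h
  simp only [Pi.pow_apply, sq_abs] at h
  exact Real.le_sqrt_of_sq_le (by linarith)

section Poisson

lemma integral_pow_poissonMeasure (s : ℝ≥0) (z : ℂ) :
    ∫ n, z ^ n ∂poissonMeasure s = Complex.exp (s * (z - 1)) := by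
  rw [integral_poissonMeasure]
  calc ∑' n : ℕ, (Real.exp (-s) * s ^ n / n.factorial) • z ^ n
      = ∑' n : ℕ, Complex.exp (-s) * ((s * z) ^ n / n.factorial) := by
        congr with n
        rw [Complex.real_smul]
        push_cast
        ring
    _ = Complex.exp (-s) * Complex.exp (s * z) := by
        rw [tsum_mul_left, (NormedSpace.expSeries_div_hasSum_exp (s * z : ℂ)).tsum_eq,
          Complex.exp_eq_exp_ℂ]
    _ = Complex.exp (s * (z - 1)) := by rw [← Complex.exp_add]; ring_nf

lemma withDensity_natCast_poissonMeasure (s : ℝ≥0) :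
    (poissonMeasure s).withDensity (fun n => ((n : ℝ≥0) : ℝ≥0∞)) =
      s • (poissonMeasure s).map (· + 1) := by
  refine Measure.ext_of_singleton fun n => ?_
  rw [withDensity_apply _ (measurableSet_singleton n), lintegral_singleton, Measure.smul_apply,
    Measure.map_apply (measurable_of_countable _) (measurableSet_singleton n)]
  rcases n with _ | n
  · simp [preimage]
  have preimage_succ : (· + 1) ⁻¹' {n + 1} = {n} := by ext k; simp
  rw [preimage_succ, poissonMeasure_singleton, poissonMeasure_singleton, ENNReal.smul_def,
    smul_eq_mul, ENNReal.coe_nnreal_eq, ENNReal.coe_nnreal_eq, ← ENNReal.ofReal_mul (by positivity),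
    ← ENNReal.ofReal_mul (by positivity)]
  congr 1
  push_cast [Nat.factorial_succ, NNReal.coe_natCast]
  field_simp
  rw [pow_succ']

lemma integrable_natCast_mul_poissonMeasure {s : ℝ≥0} {f : ℕ → ℝ}
    (hf : Integrable (fun n => f (n + 1)) (poissonMeasure s)) :
    Integrable (fun n => n * f n) (poissonMeasure s) := by
  have h : Integrable f ((poissonMeasure s).withDensity fun n => ((n : ℝ≥0) : ℝ≥0∞)) := by
    rw [withDensity_natCast_poissonMeasure]
    exact ((integrable_map_measure .of_discrete .of_discrete).2 hf).smul_measure_nnreal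
  exact (integrable_withDensity_iff_integrable_smul (measurable_of_countable _)).1 h

lemma integral_natCast_mul_poissonMeasure (s : ℝ≥0) (f : ℕ → ℝ) :
    ∫ n, n * f n ∂poissonMeasure s = s * ∫ n, f (n + 1) ∂poissonMeasure s := by
  calc ∫ n, n * f n ∂poissonMeasure s
      = ∫ n, f n ∂((poissonMeasure s).withDensity fun n => ((n : ℝ≥0) : ℝ≥0∞)) :=
        (integral_withDensity_eq_integral_smul (f := fun n : ℕ => (n : ℝ≥0))
          (measurable_of_countable _) f).symm
    _ = _ := by
      rw [withDensity_natCast_poissonMeasure, integral_smul_nnreal_measure,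
        integral_map .of_discrete .of_discrete, NNReal.smul_def, smul_eq_mul]

lemma integrable_natCast_poissonMeasure (s : ℝ≥0) :
    Integrable (fun n : ℕ => (n : ℝ)) (poissonMeasure s) := by
  simpa only [mul_one] using integrable_natCast_mul_poissonMeasure (s := s) (f := fun _ => 1)
    (integrable_const _)

lemma integrable_natCast_mul_self_poissonMeasure (s : ℝ≥0) :
    Integrable (fun n : ℕ => (n * n : ℝ)) (poissonMeasure s) :=
  integrable_natCast_mul_poissonMeasure <| by
    simpa only [Nat.cast_add_one, Pi.add_def] using
      (integrable_natCast_poissonMeasure s).add (integrable_const (1 : ℝ))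

lemma integral_natCast_poissonMeasure (s : ℝ≥0) :
    ∫ n : ℕ, (n : ℝ) ∂poissonMeasure s = s := by
  simpa using integral_natCast_mul_poissonMeasure s fun _ => 1

lemma memLp_natCast_sub_poissonMeasure (s : ℝ≥0) :
    MemLp (fun n : ℕ => (n : ℝ) - s) 2 (poissonMeasure s) := by
  refine MemLp.sub ?_ (memLp_const _)
  rw [memLp_two_iff_integrable_sq (.of_discrete)]
  simpa only [sq] using integrable_natCast_mul_self_poissonMeasure s

lemma integral_natCast_sub_sq_poissonMeasure (s : ℝ≥0) :
    ∫ n : ℕ, ((n : ℝ) - s) ^ 2 ∂poissonMeasure s = s := by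
  have second_moment : ∫ n : ℕ, (n * n : ℝ) ∂poissonMeasure s = s * (s + 1) := by
    rw [integral_natCast_mul_poissonMeasure]
    simp only [Nat.cast_add_one]
    rw [integral_add (integrable_natCast_poissonMeasure s) (integrable_const 1),
      integral_natCast_poissonMeasure, integral_const, probReal_univ, one_smul]
  calc ∫ n : ℕ, ((n : ℝ) - s) ^ 2 ∂poissonMeasure s
      = ∫ n : ℕ, ((n * n : ℝ) - 2 * s * n + s ^ 2) ∂poissonMeasure s := by congr with n; ring
    _ = s * (s + 1) - 2 * s * s + s ^ 2 := by
      have hn := (integrable_natCast_poissonMeasure s).const_mul (2 * s : ℝ)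
      have hnn := integrable_natCast_mul_self_poissonMeasure s
      have hsub : Integrable (fun n : ℕ => (n * n : ℝ) - 2 * s * n) (poissonMeasure s) :=
        hnn.sub hn
      rw [integral_add hsub (integrable_const _), integral_sub hnn hn, second_moment,
        integral_const_mul, integral_natCast_poissonMeasure, integral_const, probReal_univ,
        one_smul]
    _ = s := by ring

lemma integral_abs_natCast_sub_poissonMeasure_le (s : ℝ≥0) :
    ∫ n : ℕ, |(n : ℝ) - s| ∂poissonMeasure s ≤ √s := by
  simpa only [integral_natCast_sub_sq_poissonMeasure] using
    integral_abs_le_sqrt_integral_sq (memLp_natCast_sub_poissonMeasure s)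

end Poisson

lemma tvDist_bind_withDensity_le {α β : Type*} [MeasurableSpace α] [MeasurableSpace β]
    {m : Measure α} [IsFiniteMeasure m] {g : α → ℝ≥0} (hg : Measurable g)
    (hgi : Integrable (fun x => (g x : ℝ)) m) {κ : α → Measure β} (hκ : Measurable κ)
    (hκ1 : ∀ x, IsProbabilityMeasure (κ x)) :
    tvDist (m.bind κ) ((m.withDensity fun x => (g x : ℝ≥0∞)).bind κ) ≤
      ENNReal.ofReal (∫ x, |1 - (g x : ℝ)| ∂m) := by
  have isFinite_bind (m : Measure α) [IsFiniteMeasure m] : IsFiniteMeasure (m.bind κ) := by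
    refine ⟨?_⟩
    rw [Measure.bind_apply .univ hκ.aemeasurable]
    simp only [measure_univ, lintegral_const, one_mul, measure_lt_top]
  have isFinite_withDensity : IsFiniteMeasure (m.withDensity fun x => (g x : ℝ≥0∞)) :=
    isFiniteMeasure_withDensity (ne_top_of_lt <| by
      simpa only [HasFiniteIntegral, NNReal.enorm_eq] using hgi.2)
  have hbind := isFinite_bind m
  have hbind' := isFinite_bind (m.withDensity fun x => (g x : ℝ≥0∞))
  refine tvDist_le fun B hB => ?_
  have hκB : Integrable (fun x => (κ x).real B) m := integrable_real_of_bind hκ hB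
  have hgκB : Integrable (fun x => g x * (κ x).real B) m :=
    (integrable_withDensity_iff_integrable_smul hg).1 (integrable_real_of_bind hκ hB)
  rw [edist_dist, Real.dist_eq, bind_real_apply hκ hB, bind_real_apply hκ hB,
    integral_withDensity_eq_integral_smul hg]
  simp only [NNReal.smul_def, smul_eq_mul]
  rw [← integral_sub hκB hgκB]
  refine ENNReal.ofReal_le_ofReal (abs_integral_le_integral_abs.trans
    (integral_mono (hκB.sub hgκB).abs ((integrable_const _).sub hgi).abs fun x => ?_))
  calc |(κ x).real B - g x * (κ x).real B| = |1 - (g x : ℝ)| * (κ x).real B := by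
        rw [← one_sub_mul, abs_mul, abs_of_nonneg measureReal_nonneg]
    _ ≤ |1 - (g x : ℝ)| := mul_le_of_le_one_right (abs_nonneg _) measureReal_le_one

section ConvPow

variable {G : Type*} [AddMonoid G] [MeasurableSpace G]

/-- The `n`-fold convolution power of a measure, the law of the sum of `n` independent variables
with law `W`. -/
def convPow (W : Measure G) : ℕ → Measure G
  | 0 => Measure.dirac 0
  | n + 1 => W ∗ convPow W n

/-- The law of the sum of a Poisson number, of mean `s`, of independent variables with law `W`. -/
def compoundPoisson (s : ℝ≥0) (W : Measure G) : Measure G :=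
  (poissonMeasure s).bind (convPow W)

variable [MeasurableAdd₂ G]

instance (W : Measure G) [IsProbabilityMeasure W] (n : ℕ) :
    IsProbabilityMeasure (convPow W n) := by
  induction n with
  | zero => rw [convPow]; infer_instance
  | succ n ih => rw [convPow]; infer_instance

instance (s : ℝ≥0) (W : Measure G) [IsProbabilityMeasure W] :
    IsProbabilityMeasure (compoundPoisson s W) :=
  isProbabilityMeasure_bind .of_discrete (.of_forall fun _ => inferInstance)

end ConvPow

section CharFun

variable {E : Type*} [NormedAddCommGroup E] [InnerProductSpace ℝ E] [MeasurableSpace E]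
  [BorelSpace E]

lemma charFun_bind {α : Type*} [MeasurableSpace α] {m : Measure α} {κ : α → Measure E}
    (hκ : Measurable κ) [IsFiniteMeasure (m.bind κ)] (t : E) :
    charFun (m.bind κ) t = ∫ x, charFun (κ x) t ∂m := by
  obtain ⟨k, rfl⟩ : ∃ k : Kernel α E, ⇑k = κ := ⟨⟨κ, hκ⟩, rfl⟩
  have integrable_char : Integrable (BoundedContinuousFunction.innerProbChar t) (k ∘ₘ m) :=
    BoundedContinuousFunction.integrable _ _
  simp only [charFun_eq_integral_innerProbChar]
  rw [Measure.comp_eq_comp_const_apply] at integrable_char ⊢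
  rw [Kernel.integral_comp integrable_char, Kernel.const_apply]

lemma charFun_add_nnreal_smul (a b : ℝ≥0) (μ ν : Measure E) [IsFiniteMeasure μ]
    [IsFiniteMeasure ν] (t : E) :
    charFun (a • μ + b • ν) t = a * charFun μ t + b * charFun ν t := by
  simp only [charFun_eq_integral_innerProbChar]
  rw [integral_add_measure (BoundedContinuousFunction.integrable _ _)
    (BoundedContinuousFunction.integrable _ _), integral_smul_nnreal_measure,
    integral_smul_nnreal_measure, NNReal.smul_def, NNReal.smul_def, Complex.real_smul,
    Complex.real_smul]

variable [SecondCountableTopology E]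

lemma charFun_convPow (W : Measure E) [IsProbabilityMeasure W] (n : ℕ) (t : E) :
    charFun (convPow W n) t = charFun W t ^ n := by
  induction n with
  | zero => simp only [convPow, charFun_dirac, inner_zero_left, Complex.ofReal_zero, zero_mul,
      Complex.exp_zero, pow_zero]
  | succ n ih => rw [convPow, charFun_conv, ih, pow_succ']

variable (s : ℝ≥0) (W : Measure E) [IsProbabilityMeasure W]

lemma charFun_compoundPoisson (t : E) :
    charFun (compoundPoisson s W) t = Complex.exp (s * (charFun W t - 1)) := by
  have : IsProbabilityMeasure ((poissonMeasure s).bind (convPow W)) :=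
    inferInstanceAs (IsProbabilityMeasure (compoundPoisson s W))
  rw [compoundPoisson, charFun_bind .of_discrete]
  simp only [charFun_convPow, integral_pow_poissonMeasure]

variable [CompleteSpace E]

@[simp] lemma compoundPoisson_zero : compoundPoisson 0 W = Measure.dirac 0 := by
  refine Measure.ext_of_charFun (funext fun t => ?_)
  simp only [charFun_compoundPoisson, charFun_dirac, inner_zero_left, NNReal.coe_zero,
    Complex.ofReal_zero, zero_mul, Complex.exp_zero]

lemma compoundPoisson_eq_conv_of_eq_add {W : Measure E} [IsProbabilityMeasure W] {a b : ℝ≥0}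
    (hab : a + b = 1) {W₁ W₂ : Measure E}
    [IsProbabilityMeasure W₁] [IsProbabilityMeasure W₂] (hW : W = a • W₁ + b • W₂) :
    compoundPoisson s W = compoundPoisson (s * a) W₁ ∗ compoundPoisson (s * b) W₂ := by
  refine Measure.ext_of_charFun (funext fun t => ?_)
  have hab' : (a : ℂ) + b = 1 := by exact_mod_cast hab
  simp only [charFun_conv, charFun_compoundPoisson, ← Complex.exp_add]
  simp only [hW, charFun_add_nnreal_smul]
  congr 1
  push_cast
  linear_combination (s : ℂ) * hab'

lemma conv_compoundPoisson :
    W ∗ compoundPoisson s W = ((poissonMeasure s).map (· + 1)).bind (convPow W) := by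
  have : IsProbabilityMeasure ((poissonMeasure s).map (· + 1)) :=
    Measure.isProbabilityMeasure_map .of_discrete
  have : IsProbabilityMeasure (((poissonMeasure s).map (· + 1)).bind (convPow W)) :=
    isProbabilityMeasure_bind .of_discrete (.of_forall fun _ => inferInstance)
  refine Measure.ext_of_charFun (funext fun t => ?_)
  rw [charFun_conv, charFun_compoundPoisson, charFun_bind .of_discrete,
    integral_map .of_discrete .of_discrete, ← integral_pow_poissonMeasure, ← integral_const_mul]
  simp only [charFun_convPow, pow_succ']

end CharFun

/-! ### Smoothness of compound Poisson laws under translation -/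

section CommonComponent

variable {α : Type*} [MeasurableSpace α]

lemma one_sub_tvDist_le_inf (μ ν : Measure α) [IsProbabilityMeasure μ] [IsProbabilityMeasure ν] :
    1 - tvDist μ ν ≤ (μ ⊓ ν) univ := by
  rw [Measure.inf_apply .univ]
  refine le_sInf ?_
  rintro _ ⟨t, rfl⟩
  simp only [inter_univ]
  set T := toMeasurable μ t
  have hT : MeasurableSet T := measurableSet_toMeasurable _ _
  have hν : ν T ≤ μ T + tvDist μ ν := by
    rw [← ofReal_measureReal (μ := ν), ← ofReal_measureReal (μ := μ)]
    have h := edist_real_le_tvDist μ ν hT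
    rw [edist_dist, Real.dist_eq] at h
    refine le_trans ?_ (add_le_add_right h _)
    rw [← ENNReal.ofReal_add measureReal_nonneg (abs_nonneg _)]
    exact ENNReal.ofReal_le_ofReal (by linarith [neg_abs_le (μ.real T - ν.real T)])
  rw [tsub_le_iff_right]
  calc (1 : ℝ≥0∞) = ν T + ν Tᶜ := by rw [measure_add_measure_compl hT, measure_univ]
    _ ≤ μ T + tvDist μ ν + ν tᶜ := by gcongr; exact subset_toMeasurable μ t
    _ = μ t + ν tᶜ + tvDist μ ν := by rw [measure_toMeasurable]; ring

lemma exists_le_two_smul_of_tvDist_le {μ ν : Measure α} [IsProbabilityMeasure μ]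
    [IsProbabilityMeasure ν] (h : tvDist μ ν ≤ 1 / 2) :
    ∃ A : Measure α, IsProbabilityMeasure A ∧ A ≤ (2 : ℝ≥0) • μ ∧ A ≤ (2 : ℝ≥0) • ν := by
  have hmass : 2⁻¹ ≤ (μ ⊓ ν) univ := by
    refine le_trans ?_ (one_sub_tvDist_le_inf μ ν)
    simpa only [one_div, ENNReal.one_sub_inv_two] using tsub_le_tsub_left h 1
  have : IsFiniteMeasure (μ ⊓ ν) := isFiniteMeasure_of_le μ inf_le_left
  have : NeZero (μ ⊓ ν) := ⟨fun h0 => by simp [h0] at hmass⟩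
  have hinv : ((μ ⊓ ν) univ)⁻¹ ≤ (2 : ℝ≥0) := ENNReal.inv_le_iff_inv_le.2 hmass
  refine ⟨((μ ⊓ ν) univ)⁻¹ • (μ ⊓ ν), isProbabilityMeasureSMul, ?_, ?_⟩
  · exact fun B => mul_le_mul' hinv (inf_le_left (a := μ) B)
  · exact fun B => mul_le_mul' hinv (inf_le_right (a := μ) B)

lemma exists_eq_half_smul_add_half_smul {A W : Measure α} [IsProbabilityMeasure A]
    [IsProbabilityMeasure W] (h : A ≤ (2 : ℝ≥0) • W) :
    ∃ R : Measure α, IsProbabilityMeasure R ∧ W = (2⁻¹ : ℝ≥0) • A + (2⁻¹ : ℝ≥0) • R := by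
  refine ⟨(2 : ℝ≥0) • W - A, ⟨?_⟩, ?_⟩
  · rw [Measure.sub_apply .univ h, Measure.coe_nnreal_smul_apply, measure_univ, measure_univ,
      mul_one]
    exact (ENNReal.sub_eq_of_eq_add ENNReal.one_ne_top (by norm_num))
  · rw [← smul_add, add_comm, Measure.sub_add_cancel_of_le h, smul_smul,
      inv_mul_cancel₀ two_ne_zero, one_smul]

end CommonComponent

lemma withDensity_natCast_div_poissonMeasure {s : ℝ≥0} (hs : s ≠ 0) :
    (poissonMeasure s).withDensity (fun n : ℕ => ((n / s : ℝ≥0) : ℝ≥0∞)) =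
      (poissonMeasure s).map (· + 1) := by
  have h : (fun n : ℕ => ((n / s : ℝ≥0) : ℝ≥0∞)) =
      ((s⁻¹ : ℝ≥0) : ℝ≥0∞) • fun n : ℕ => ((n : ℝ≥0) : ℝ≥0∞) := by
    ext n
    rw [Pi.smul_apply, smul_eq_mul, ← ENNReal.coe_mul, div_eq_inv_mul]
  rw [h, withDensity_smul _ (measurable_of_countable _),
    withDensity_natCast_poissonMeasure]
  exact inv_smul_smul₀ hs _

lemma tvDist_map_nsmul_add_le {G : Type*} [AddMonoid G] [MeasurableSpace G] [MeasurableAdd G]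
    (μ : Measure G) (z : G) (n : ℕ) :
    tvDist μ (μ.map (n • z + ·)) ≤ n * tvDist μ (μ.map (z + ·)) := by
  induction n with
  | zero => simp
  | succ n ih =>
    have map_succ : μ.map ((n + 1) • z + ·) = (μ.map (n • z + ·)).map (z + ·) := by
      rw [Measure.map_map (by fun_prop) (by fun_prop)]
      congr with x
      rw [Function.comp_apply, succ_nsmul', add_assoc]
    rw [map_succ, Nat.cast_add_one, add_mul, one_mul, add_comm]
    exact (tvDist_triangle μ (μ.map (z + ·)) _).trans
      (add_le_add_right ((tvDist_map_le _ _ (measurable_const_add z)).trans ih) _)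

section Smoothing

variable {E : Type*} [NormedAddCommGroup E] [InnerProductSpace ℝ E] [MeasurableSpace E]
  [BorelSpace E] [SecondCountableTopology E] [CompleteSpace E]

lemma tvDist_compoundPoisson_conv_le {s : ℝ≥0} (hs : 0 < s) (A : Measure E)
    [IsProbabilityMeasure A] :
    tvDist (compoundPoisson s A) (A ∗ compoundPoisson s A) ≤ ENNReal.ofReal (1 / √s) := by
  have hs' : (0 : ℝ) < s := hs
  have integrable_density : Integrable (fun n : ℕ => ((n / s : ℝ≥0) : ℝ)) (poissonMeasure s) := by
    simpa only [NNReal.coe_div, NNReal.coe_natCast] using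
      (integrable_natCast_poissonMeasure s).div_const s
  rw [conv_compoundPoisson, ← withDensity_natCast_div_poissonMeasure hs.ne']
  refine (tvDist_bind_withDensity_le (measurable_of_countable _) integrable_density
    .of_discrete fun n => inferInstance).trans (ENNReal.ofReal_le_ofReal ?_)
  calc ∫ n : ℕ, |1 - ((n / s : ℝ≥0) : ℝ)| ∂poissonMeasure s
      = ∫ n : ℕ, |(n : ℝ) - s| / s ∂poissonMeasure s := by
        congr with n
        rw [← abs_of_pos hs', ← abs_div, abs_of_pos hs', abs_sub_comm, sub_div, div_self hs'.ne',
          NNReal.coe_div, NNReal.coe_natCast]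
    _ ≤ √s / s := by
        rw [integral_div]
        gcongr
        exact integral_abs_natCast_sub_poissonMeasure_le s
    _ = 1 / √s := by rw [Real.sqrt_div_self']

lemma tvDist_compoundPoisson_conv_le_of_le {s : ℝ≥0} (hs : 0 < s) {A W : Measure E}
    [IsProbabilityMeasure A] [IsProbabilityMeasure W] (hA : A ≤ (2 : ℝ≥0) • W) :
    tvDist (compoundPoisson s W) (A ∗ compoundPoisson s W) ≤ ENNReal.ofReal (2 / √s) := by
  obtain ⟨R, hR, hW⟩ := exists_eq_half_smul_add_half_smul hA
  have hsum : (2⁻¹ + 2⁻¹ : ℝ≥0) = 1 := by rw [← two_mul, mul_inv_cancel₀ two_ne_zero]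
  have hhalf : 0 < s * 2⁻¹ := by positivity
  rw [compoundPoisson_eq_conv_of_eq_add s hsum hW,
    Measure.conv_comm (compoundPoisson (s * 2⁻¹) A), ← Measure.conv_assoc, Measure.conv_comm A,
    Measure.conv_assoc]
  refine (tvDist_conv_left_le _ _ _).trans ((tvDist_compoundPoisson_conv_le hhalf A).trans
    (ENNReal.ofReal_le_ofReal ?_))
  refine (div_le_div_iff₀ (by positivity) (by positivity)).2 ?_
  rw [one_mul, Real.sqrt_le_left (by positivity), mul_pow, Real.sq_sqrt (by positivity)]
  push_cast
  linarith [s.coe_nonneg]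

lemma tvDist_compoundPoisson_map_add_le {s : ℝ≥0} (hs : 0 < s) {W : Measure E}
    [IsProbabilityMeasure W] {z : E} (hz : tvDist W (W.map (-z + ·)) ≤ 1 / 2) :
    tvDist (compoundPoisson s W) ((compoundPoisson s W).map (z + ·)) ≤
      ENNReal.ofReal (4 / √s) := by
  have : IsProbabilityMeasure (W.map (-z + ·)) :=
    Measure.isProbabilityMeasure_map (measurable_const_add (-z)).aemeasurable
  obtain ⟨A, hA, hAW, hAW'⟩ := exists_le_two_smul_of_tvDist_le hz
  have : IsProbabilityMeasure (A.map (z + ·)) :=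
    Measure.isProbabilityMeasure_map (measurable_const_add z).aemeasurable
  have hAz : A.map (z + ·) ≤ (2 : ℝ≥0) • W := by
    calc A.map (z + ·) ≤ ((2 : ℝ≥0) • W.map (-z + ·)).map (z + ·) :=
          Measure.map_mono hAW' (measurable_const_add z)
      _ = (2 : ℝ≥0) • W := by
          rw [Measure.map_smul, Measure.map_map (by fun_prop) (by fun_prop)]
          simp only [Function.comp_def, add_neg_cancel_left, Measure.map_id']
  have map_conv : A.map (z + ·) ∗ compoundPoisson s W =
      (A ∗ compoundPoisson s W).map (z + ·) := by
    rw [← Measure.dirac_conv, Measure.conv_assoc, Measure.dirac_conv]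
  calc tvDist (compoundPoisson s W) ((compoundPoisson s W).map (z + ·))
      ≤ tvDist (compoundPoisson s W) (A.map (z + ·) ∗ compoundPoisson s W) +
          tvDist (A.map (z + ·) ∗ compoundPoisson s W) ((compoundPoisson s W).map (z + ·)) :=
        tvDist_triangle _ _ _
    _ ≤ ENNReal.ofReal (2 / √s) + ENNReal.ofReal (2 / √s) := by
        refine add_le_add (tvDist_compoundPoisson_conv_le_of_le hs hAz) ?_
        rw [map_conv, tvDist_comm]
        exact (tvDist_map_le _ _ (measurable_const_add z)).trans
          (tvDist_compoundPoisson_conv_le_of_le hs hAW)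
    _ = ENNReal.ofReal (4 / √s) := by
        rw [← ENNReal.ofReal_add (by positivity) (by positivity), ← add_div]
        norm_num

end Smoothing

lemma exists_tvDist_compoundPoisson_map_add_le {E : Type*} [NormedAddCommGroup E]
    [InnerProductSpace ℝ E] [MeasurableSpace E] [BorelSpace E] [FiniteDimensional ℝ E]
    {W : Measure E}
    [IsProbabilityMeasure W] (hW : W ≪ volume) :
    ∃ C > 0, ∀ (y : E) (s : ℝ≥0), 0 < s →
      tvDist (compoundPoisson s W) ((compoundPoisson s W).map (y + ·)) ≤
        ENNReal.ofReal (C * (‖y‖ + 1) / √s) := by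
  obtain ⟨δ, hδ, hball⟩ := Metric.eventually_nhds_iff.1 <|
    (tendsto_tvDist_map_add hW).eventually_le_const (u := 1 / 2) (by simp)
  refine ⟨4 * (2 / δ + 1), by positivity, fun y s hs => ?_⟩
  set n := ⌊‖y‖ * (2 / δ)⌋₊ + 1 with hn
  have n_gt : ‖y‖ * (2 / δ) < n := by rw [hn, Nat.cast_add_one]; exact Nat.lt_floor_add_one _
  have n_le : (n : ℝ) ≤ ‖y‖ * (2 / δ) + 1 := by
    rw [hn, Nat.cast_add_one]
    gcongr
    exact Nat.floor_le (by positivity)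
  have n_pos : (0 : ℝ) < n := by positivity
  have step_small : dist (-((n : ℝ)⁻¹ • y)) 0 < δ := by
    rw [dist_zero_right, norm_neg, norm_smul, norm_inv, RCLike.norm_natCast, inv_mul_lt_iff₀ n_pos]
    rw [← mul_div_assoc, div_lt_iff₀ hδ] at n_gt
    linarith [norm_nonneg y]
  have y_eq : y = n • (n : ℝ)⁻¹ • y := by
    rw [← Nat.cast_smul_eq_nsmul ℝ, smul_inv_smul₀ n_pos.ne']
  calc tvDist (compoundPoisson s W) ((compoundPoisson s W).map (y + ·))
      ≤ n * tvDist (compoundPoisson s W) ((compoundPoisson s W).map ((n : ℝ)⁻¹ • y + ·)) := by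
        conv_lhs => rw [y_eq]
        exact tvDist_map_nsmul_add_le _ _ n
    _ ≤ n * ENNReal.ofReal (4 / √s) := by
        gcongr
        exact tvDist_compoundPoisson_map_add_le hs (hball step_small)
    _ = ENNReal.ofReal (4 * n / √s) := by
        rw [← ENNReal.ofReal_natCast, ← ENNReal.ofReal_mul n_pos.le]
        congr 1
        ring
    _ ≤ ENNReal.ofReal (4 * (2 / δ + 1) * (‖y‖ + 1) / √s) := by
        gcongr ENNReal.ofReal (?_ / _)
        have : 0 ≤ 2 / δ := by positivity
        nlinarith [norm_nonneg y]

/-! ### Visits and strength of a location -/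

lemma map_restrict_preimage_of_indepFun {Ω α β : Type*} [MeasurableSpace Ω] [MeasurableSpace α]
    [MeasurableSpace β] {Q : Measure Ω} {f : Ω → α} {g : Ω → β} (hfg : IndepFun g f Q)
    (hf : Measurable f) (hg : Measurable g) {A : Set α} (hA : MeasurableSet A) :
    (Q.restrict (f ⁻¹' A)).map g = Q (f ⁻¹' A) • Q.map g := by
  ext B hB
  rw [Measure.map_apply hg hB, Measure.restrict_apply' (hf hA),
    hfg.measure_inter_preimage_eq_mul _ _ hB hA, mul_comm, Measure.smul_apply,
    Measure.map_apply hg hB, smul_eq_mul]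

lemma map_sum_eq_convPow {Ω ι G : Type*} [MeasurableSpace Ω] [AddCommMonoid G] [MeasurableSpace G]
    [MeasurableAdd₂ G] {Q : Measure Ω} [IsProbabilityMeasure Q] {W : Measure G} {Y : ι → Ω → G}
    (hY : ∀ i, Measurable (Y i)) (hlaw : ∀ i, Q.map (Y i) = W) (hind : iIndepFun Y Q)
    (S : Finset ι) : Q.map (∑ i ∈ S, Y i) = convPow W S.card := by
  classical
  induction S using Finset.induction_on with
  | empty =>
    rw [Finset.sum_empty, Finset.card_empty, convPow]
    exact (Measure.map_const Q (0 : G)).trans (by rw [measure_univ, one_smul])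
  | insert i S hi ih =>
    rw [Finset.sum_insert hi, Finset.card_insert_of_notMem hi, convPow, ← ih, ← hlaw i]
    exact (hind.indepFun_finsetSum_of_notMem hY hi).symm.map_add_eq_map_conv_map (hY i)
      (by simpa only [Finset.sum_fn] using Finset.measurable_sum S fun j _ => hY j)

lemma visits_eq_tripCount {t : ℝ} (ht : 0 ≤ t) (τ : TripRecord) :
    visits t τ = tripCount (Iic t ×ˢ univ) τ := by
  unfold visits tripCount
  congr with k
  simp only [mem_prod, mem_Iic, mem_univ, and_true]
  refine ⟨fun h => ?_, fun ⟨h, hk⟩ => (ENNReal.le_ofReal_iff_toReal_le h ht).2 hk⟩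
  have hne : (τ k).1 ≠ ⊤ := ne_top_of_le_ne_top ENNReal.ofReal_ne_top h
  exact ⟨hne, (ENNReal.le_ofReal_iff_toReal_le hne ht).1 h⟩

lemma tripCount_union {A B : Set (ℝ × ℝ)} (hAB : Disjoint A B) (τ : TripRecord) :
    tripCount (A ∪ B) τ = tripCount A τ + tripCount B τ := by
  unfold tripCount
  rw [← encard_union_eq]
  · congr with k
    exact and_or_left
  · exact disjoint_left.2 fun k hA hB => disjoint_left.1 hAB hA.2 hB.2

lemma disjoint_Iic_prod_Ioc_prod (t u : ℝ) :
    Disjoint (Iic t ×ˢ (univ : Set ℝ)) (Ioc t u ×ˢ univ) :=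
  disjoint_prod.2 (.inl (Iic_disjoint_Ioc le_rfl))

lemma visits_add_eq_tripCount_add {t h : ℝ} (ht : 0 ≤ t) (hh : 0 ≤ h) (τ : TripRecord) :
    visits (t + h) τ = visits t τ + tripCount (Ioc t (t + h) ×ˢ univ) τ := by
  rw [visits_eq_tripCount ht, visits_eq_tripCount (add_nonneg ht hh),
    ← tripCount_union (disjoint_Iic_prod_Ioc_prod t _), ← union_prod,
    Iic_union_Ioc_eq_Iic (le_add_of_nonneg_right hh)]

/-- The event that exactly the trips with labels in `S` have arrived up to time `t`. -/
def arrivedEq (t : ℝ) (S : Finset ℕ) : Set TripRecord :=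
  {τ | {k | (τ k).1 ≤ ENNReal.ofReal t} = (S : Set ℕ)}

lemma mem_arrivedEq {t : ℝ} {S : Finset ℕ} {τ : TripRecord} :
    τ ∈ arrivedEq t S ↔ ∀ k, (τ k).1 ≤ ENNReal.ofReal t ↔ k ∈ S := by
  rw [arrivedEq, mem_ofPred_eq, Set.ext_iff]
  rfl

lemma measurableSet_arrived (t : ℝ) (S : Finset ℕ) :
    MeasurableSet {α : ℕ → ℝ≥0∞ × ℝ | ∀ k, (α k).1 ≤ ENNReal.ofReal t ↔ k ∈ S} := by
  rw [ofPred_forall]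
  exact .iInter fun k => (measurableSet_le (by fun_prop) measurable_const).iff (.const _)

lemma arrivedEq_eq_preimage (t : ℝ) (S : Finset ℕ) :
    arrivedEq t S = (fun (τ : TripRecord) k => ((τ k).1, (τ k).2.1)) ⁻¹'
      {α : ℕ → ℝ≥0∞ × ℝ | ∀ k, (α k).1 ≤ ENNReal.ofReal t ↔ k ∈ S} :=
  ext fun _ => mem_arrivedEq

lemma measurableSet_arrivedEq (t : ℝ) (S : Finset ℕ) : MeasurableSet (arrivedEq t S) := by
  rw [arrivedEq_eq_preimage]
  exact measurableSet_preimage (by fun_prop) (measurableSet_arrived t S)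

lemma disjoint_arrivedEq (t : ℝ) : Pairwise (Function.onFun Disjoint (arrivedEq t)) :=
  fun _ _ hST => disjoint_left.2 fun _ hS hT => hST (Finset.coe_injective (hS.symm.trans hT))

lemma iUnion_arrivedEq (t : ℝ) : ⋃ S, arrivedEq t S = {τ | visits t τ ≠ ⊤} := by
  ext τ
  rw [mem_iUnion, mem_ofPred_eq, visits, encard_ne_top_iff]
  exact ⟨fun ⟨S, hS⟩ => (show _ = _ from hS) ▸ S.finite_toSet,
    fun h => ⟨h.toFinset, h.coe_toFinset.symm⟩⟩

lemma visits_of_mem_arrivedEq {t : ℝ} {S : Finset ℕ} {τ : TripRecord} (h : τ ∈ arrivedEq t S) :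
    visits t τ = S.card := by
  rw [visits, show _ = _ from h, encard_coe_eq_coe_finsetCard]

lemma strength_of_mem_arrivedEq {t : ℝ} {S : Finset ℕ} {τ : TripRecord} (h : τ ∈ arrivedEq t S) :
    strength t τ = ∑ k ∈ S, ((τ k).2.2 : ℝ) := by
  rw [strength, tsum_eq_sum (s := S) fun k hk => if_neg fun hle => hk ((mem_arrivedEq.1 h k).1 hle),
    ENNReal.toReal_sum fun k _ => by split_ifs <;> simp]
  refine Finset.sum_congr rfl fun k hk => ?_
  rw [if_pos ((mem_arrivedEq.1 h k).2 hk), ENNReal.coe_toReal]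

lemma measurable_strength (t : ℝ) : Measurable (strength t) := by
  unfold strength
  refine (Measurable.tsum fun k => ?_).ennreal_toReal
  exact .ite (measurableSet_le (by fun_prop) measurable_const)
    (measurable_coe_nnreal_ennreal.comp (by fun_prop)) measurable_const

lemma measurable_visits (t : ℝ) : Measurable (visits t) := by
  have measurableSet_natCast (n : ℕ) : MeasurableSet {τ | visits t τ = n} := by
    have : {τ | visits t τ = n} = ⋃ S ∈ {S : Finset ℕ | S.card = n}, arrivedEq t S := by
      ext τ
      simp only [mem_ofPred_eq, mem_iUnion, exists_prop]
      refine ⟨fun h => ?_, fun ⟨S, hS, h⟩ => by rw [visits_of_mem_arrivedEq h, hS]⟩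
      obtain ⟨S, hS⟩ := mem_iUnion.1 <|
        (iUnion_arrivedEq t).ge (show visits t τ ≠ ⊤ from h ▸ ENat.natCast_ne_top n)
      exact ⟨S, by exact_mod_cast (visits_of_mem_arrivedEq hS).symm.trans h, hS⟩
    rw [this]
    exact .biUnion (to_countable _) fun S _ => measurableSet_arrivedEq t S
  refine measurable_to_countable' fun n => ?_
  induction n using ENat.recTopCoe with
  | coe n => exact measurableSet_natCast n
  | top =>
    have : visits t ⁻¹' {⊤} = (⋃ S, arrivedEq t S)ᶜ := by
      rw [iUnion_arrivedEq]
      ext τ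
      simp
    rw [this]
    exact (MeasurableSet.iUnion fun S => measurableSet_arrivedEq t S).compl

lemma measurable_toNat_visits (t : ℝ) : Measurable fun τ => (visits t τ).toNat :=
  Measurable.of_discrete.comp (measurable_visits t)

namespace IsPoissonArrival

variable {Q : Measure TripRecord} {V : Measure ℝ}

lemma indepFun_tripCount (hQ : IsPoissonArrival Q V) {A B : Set (ℝ × ℝ)} (hA : MeasurableSet A)
    (hB : MeasurableSet B) (hAB : Disjoint A B) : IndepFun (tripCount A) (tripCount B) Q := by
  have hdisj : Pairwise (Function.onFun Disjoint ![A, B]) := by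
    rw [pairwise_disjoint_on]
    simpa [Fin.forall_fin_two] using hAB
  exact (hQ.indep 2 ![A, B] (Fin.forall_fin_two.2 ⟨hA, hB⟩) hdisj).indepFun
    (i := 0) (j := 1) (by decide)

variable [IsFiniteMeasure V]

lemma measure_tripCount_prod_univ_eq (hQ : IsPoissonArrival Q V) {T : Set ℝ}
    (hT : MeasurableSet T) {l : ℝ} (hl : 0 ≤ l) (hTl : volume (T ∩ Ici 0) = ENNReal.ofReal l)
    (n : ℕ) :
    Q {τ | tripCount (T ×ˢ univ) τ = n} = poissonMeasure (V.real univ * l).toNNReal {n} := by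
  refine hQ.poisson _ _ (hT.prod .univ) ?_ n
  rw [Measure.prod_prod, Measure.restrict_apply hT, hTl, ← ofReal_measureReal (μ := V),
    ← ENNReal.ofReal_mul hl, mul_comm, ENNReal.ofReal]

lemma measure_visits_eq (hQ : IsPoissonArrival Q V) {t : ℝ} (ht : 0 ≤ t) (n : ℕ) :
    Q {τ | visits t τ = n} = poissonMeasure (V.real univ * t).toNNReal {n} := by
  simp_rw [visits_eq_tripCount ht]
  refine hQ.measure_tripCount_prod_univ_eq measurableSet_Iic ht ?_ n
  rw [inter_comm, Ici_inter_Iic, Real.volume_Icc, sub_zero]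

lemma measure_tripCount_Ioc_eq (hQ : IsPoissonArrival Q V) {t h : ℝ} (ht : 0 ≤ t) (hh : 0 ≤ h)
    (n : ℕ) :
    Q {τ | tripCount (Ioc t (t + h) ×ˢ univ) τ = n} =
      poissonMeasure (V.real univ * h).toNNReal {n} := by
  refine hQ.measure_tripCount_prod_univ_eq measurableSet_Ioc hh ?_ n
  rw [inter_eq_left.2 (show Ioc t (t + h) ⊆ Ici 0 from fun x hx => ht.trans hx.1.le),
    Real.volume_Ioc, add_sub_cancel_left]

lemma measureReal_visits_jump (hQ : IsPoissonArrival Q V) {t h : ℝ} (ht : 0 ≤ t) (hh : 0 ≤ h)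
    (k : ℕ) :
    Q.real {τ | visits t τ = k ∧ visits (t + h) τ = k + 1} =
      Q.real {τ | visits t τ = k} * (Real.exp (-(V.real univ * h)) * (V.real univ * h)) := by
  have jump_eq : {τ | visits t τ = k ∧ visits (t + h) τ = k + 1} =
      tripCount (Iic t ×ˢ univ) ⁻¹' {(k : ℕ∞)} ∩
        tripCount (Ioc t (t + h) ×ˢ univ) ⁻¹' {((1 : ℕ) : ℕ∞)} := by
    ext τ
    rw [mem_ofPred_eq, mem_inter_iff, mem_preimage, mem_preimage, mem_singleton_iff,
      mem_singleton_iff, visits_add_eq_tripCount_add ht hh, ← visits_eq_tripCount ht]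
    refine and_congr_right fun hk => ?_
    rw [hk]
    exact (ENat.addLECancellable_of_ne_top (ENat.natCast_ne_top k)).inj
  have hind := hQ.indepFun_tripCount (measurableSet_Iic.prod .univ) (measurableSet_Ioc.prod .univ)
    (disjoint_Iic_prod_Ioc_prod t (t + h))
  have new_trip : Q.real (tripCount (Ioc t (t + h) ×ˢ univ) ⁻¹' {((1 : ℕ) : ℕ∞)}) =
      Real.exp (-(V.real univ * h)) * (V.real univ * h) := by
    refine (congrArg ENNReal.toReal (hQ.measure_tripCount_Ioc_eq ht hh 1)).trans ?_
    rw [← measureReal_def, poissonMeasure_real_singleton,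
      Real.coe_toNNReal _ (mul_nonneg measureReal_nonneg hh), pow_one, Nat.factorial_one,
      Nat.cast_one, div_one]
  rw [jump_eq, measureReal_def, hind.measure_inter_preimage_eq_mul _ _ .of_discrete .of_discrete,
    ENNReal.toReal_mul, ← measureReal_def, ← measureReal_def, new_trip]
  simp_rw [visits_eq_tripCount ht]
  rfl

lemma tendsto_visits_jump (hQ : IsPoissonArrival Q V) {t : ℝ} (ht : 0 ≤ t) (k : ℕ) :
    Tendsto (fun h : ℝ => Q.real {τ | visits t τ = k ∧ visits (t + h) τ = k + 1} / h) (𝓝[>] 0)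
      (𝓝 (V.real univ * Q.real {τ | visits t τ = k})) := by
  have hlim : Tendsto (fun h : ℝ => Q.real {τ | visits t τ = k} *
      (Real.exp (-(V.real univ * h)) * V.real univ)) (𝓝[>] 0)
      (𝓝 (V.real univ * Q.real {τ | visits t τ = k})) :=
    tendsto_nhdsWithin_of_tendsto_nhds <| Continuous.tendsto' (by fun_prop) _ _ <| by
      rw [mul_zero, neg_zero, Real.exp_zero, one_mul, mul_comm]
  refine hlim.congr' ?_
  filter_upwards [self_mem_nhdsWithin] with h (hh : 0 < h)
  rw [hQ.measureReal_visits_jump ht hh.le]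
  field_simp

lemma ae_visits_ne_top (hQ : IsPoissonArrival Q V) [IsProbabilityMeasure Q] {t : ℝ} (ht : 0 ≤ t) :
    ∀ᵐ τ ∂Q, visits t τ ≠ ⊤ := by
  have finite_eq : {τ | visits t τ ≠ ⊤} = ⋃ n : ℕ, {τ | visits t τ = n} := by
    ext τ
    simp only [mem_ofPred_eq, mem_iUnion, ENat.ne_top_iff_exists, eq_comm]
  have hdisj : Pairwise (Function.onFun Disjoint fun n : ℕ => {τ | visits t τ = n}) :=
    fun m n hmn => disjoint_left.2 fun τ hm hn => hmn (Nat.cast_injective (hm.symm.trans hn))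
  have hmeas_eq (n : ℕ) : MeasurableSet {τ | visits t τ = n} :=
    measurable_visits t (measurableSet_singleton _)
  refine (prob_compl_eq_zero_iff (finite_eq ▸ MeasurableSet.iUnion hmeas_eq)).2 ?_
  rw [finite_eq, measure_iUnion hdisj hmeas_eq]
  simp_rw [hQ.measure_visits_eq ht]
  simpa only [indicator_univ, measure_univ] using
    Measure.tsum_indicator_apply_singleton (poissonMeasure (V.real univ * t).toNNReal) univ .univ

lemma map_toNat_visits (hQ : IsPoissonArrival Q V) [IsProbabilityMeasure Q] {t : ℝ} (ht : 0 ≤ t) :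
    Q.map (fun τ => (visits t τ).toNat) = poissonMeasure (V.real univ * t).toNNReal := by
  refine Measure.ext_of_singleton fun n => ?_
  rw [Measure.map_apply (measurable_toNat_visits t) (measurableSet_singleton n),
    ← hQ.measure_visits_eq ht n]
  refine measure_congr ?_
  filter_upwards [hQ.ae_visits_ne_top ht] with τ hτ
  obtain ⟨m, hm⟩ := ENat.ne_top_iff_exists.1 hτ
  have toNat_eq_iff : (visits t τ).toNat = n ↔ visits t τ = n := by simp [← hm]
  exact propext toNat_eq_iff

end IsPoissonArrival

namespace HasIIDWeights

variable {Q : Measure TripRecord} [IsProbabilityMeasure Q] {W : Measure ℝ}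

lemma map_strength_restrict_arrivedEq (hQ : HasIIDWeights Q W) (t : ℝ) (S : Finset ℕ) :
    (Q.restrict (arrivedEq t S)).map (strength t) = Q (arrivedEq t S) • convPow W S.card := by
  have measurable_weight (k : ℕ) : Measurable fun τ : TripRecord => ((τ k).2.2 : ℝ) := by
    fun_prop
  have iIndep_weight : iIndepFun (fun k (τ : TripRecord) => ((τ k).2.2 : ℝ)) Q :=
    hQ.iIndep.comp (fun _ => NNReal.toReal) fun _ => by fun_prop
  have sum_indep : IndepFun (∑ k ∈ S, fun τ : TripRecord => ((τ k).2.2 : ℝ))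
      (fun (τ : TripRecord) k => ((τ k).1, (τ k).2.1)) Q := by
    have := hQ.indep_arrivals.comp (φ := fun w : ℕ → ℝ≥0 => ∑ k ∈ S, (w k : ℝ)) (ψ := id)
      (by fun_prop) measurable_id
    rw [Function.id_comp] at this
    convert this using 1
    ext τ
    rw [Finset.sum_apply, Function.comp_apply]
  have strength_eq : strength t =ᵐ[Q.restrict (arrivedEq t S)]
      ∑ k ∈ S, fun τ : TripRecord => ((τ k).2.2 : ℝ) := by
    filter_upwards [ae_restrict_mem (measurableSet_arrivedEq t S)] with τ hτ
    rw [strength_of_mem_arrivedEq hτ, Finset.sum_apply]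
  rw [Measure.map_congr strength_eq, arrivedEq_eq_preimage,
    map_restrict_preimage_of_indepFun sum_indep (by fun_prop) (by fun_prop)
      (measurableSet_arrived t S), map_sum_eq_convPow measurable_weight hQ.law iIndep_weight]

lemma map_strength (hQ : HasIIDWeights Q W) {t : ℝ} (hfin : ∀ᵐ τ ∂Q, visits t τ ≠ ⊤) :
    Q.map (strength t) = (Q.map fun τ => (visits t τ).toNat).bind (convPow W) := by
  have sum_restrict : Q = Measure.sum fun S => Q.restrict (arrivedEq t S) := by
    rw [← Measure.restrict_iUnion (disjoint_arrivedEq t) (measurableSet_arrivedEq t),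
      iUnion_arrivedEq, Measure.restrict_eq_self_of_ae_mem (s := {τ | visits t τ ≠ ⊤}) hfin]
  have map_visits_restrict (S : Finset ℕ) :
      (Q.restrict (arrivedEq t S)).map (fun τ => (visits t τ).toNat) =
        Q (arrivedEq t S) • Measure.dirac S.card := by
    have visits_eq : (fun τ => (visits t τ).toNat) =ᵐ[Q.restrict (arrivedEq t S)]
        fun _ => S.card := by
      filter_upwards [ae_restrict_mem (measurableSet_arrivedEq t S)] with τ hτ
      rw [visits_of_mem_arrivedEq hτ, ENat.toNat_natCast]
    rw [Measure.map_congr visits_eq, Measure.map_const, Measure.restrict_apply_univ]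
  rw [sum_restrict, Measure.map_sum (measurable_strength t).aemeasurable,
    Measure.map_sum (measurable_toNat_visits t).aemeasurable, Measure.bind_sum _ _ .of_discrete]
  simp_rw [map_visits_restrict, Measure.bind_smul, Measure.dirac_bind .of_discrete,
    hQ.map_strength_restrict_arrivedEq]

end HasIIDWeights

theorem map_strength_eq_compoundPoisson {Q : Measure TripRecord} [IsProbabilityMeasure Q]
    {V W : Measure ℝ} [IsFiniteMeasure V] (hP : IsPoissonArrival Q V) (hQ : HasIIDWeights Q W)
    {t : ℝ} (ht : 0 ≤ t) :
    Q.map (strength t) = compoundPoisson (V.real univ * t).toNNReal W := by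
  rw [hQ.map_strength (hP.ae_visits_ne_top ht),
    hP.map_toNat_visits ht, compoundPoisson]

/-! ### The central limit theorem in total variation for compound Poisson laws -/

section ContinuousDensity

variable {G : Type*} [AddGroup G] [MeasurableSpace G] [MeasurableAdd₂ G] [MeasurableSub₂ G]
  {m : Measure G} [SFinite m] [m.IsAddRightInvariant]

lemma withDensity_conv {g : G → ℝ≥0∞} (hg : Measurable g) (μ : Measure G) [SFinite μ] :
    m.withDensity g ∗ μ = m.withDensity fun x => ∫⁻ y, g (x - y) ∂μ := by
  refine Measure.ext_of_lintegral _ fun f hf => ?_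
  have hgμ : Measurable fun x => ∫⁻ y, g (x - y) ∂μ :=
    Measurable.lintegral_prod_right (f := fun x y => g (x - y)) (by fun_prop)
  have translate (y : G) : ∫⁻ x, g x * f (x + y) ∂m = ∫⁻ x, g (x - y) * f x ∂m := by
    simpa only [add_sub_cancel_right] using
      lintegral_add_right_eq_self (μ := m) (fun x => g (x - y) * f x) y
  calc ∫⁻ z, f z ∂(m.withDensity g ∗ μ)
      = ∫⁻ x, g x * ∫⁻ y, f (x + y) ∂μ ∂m := by
        rw [Measure.lintegral_conv hf, lintegral_withDensity_eq_lintegral_mul _ hg (by fun_prop)]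
        rfl
    _ = ∫⁻ x, ∫⁻ y, g x * f (x + y) ∂μ ∂m :=
        lintegral_congr fun x => (lintegral_const_mul _ (by fun_prop)).symm
    _ = ∫⁻ y, ∫⁻ x, g (x - y) * f x ∂m ∂μ := by
        rw [lintegral_lintegral_swap (by fun_prop)]
        exact lintegral_congr translate
    _ = ∫⁻ x, (∫⁻ y, g (x - y) ∂μ) * f x ∂m := by
        rw [lintegral_lintegral_swap (by fun_prop)]
        exact lintegral_congr fun x => lintegral_mul_const _ (by fun_prop)
    _ = ∫⁻ z, f z ∂(m.withDensity fun x => ∫⁻ y, g (x - y) ∂μ) :=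
        (lintegral_withDensity_eq_lintegral_mul _ hgμ hf).symm

lemma tendsto_tvDist_withDensity_conv [TopologicalSpace G] [IsTopologicalAddGroup G]
    [OpensMeasurableSpace G] {ι : Type*} {l : Filter ι} [l.IsCountablyGenerated]
    {μ : ι → ProbabilityMeasure G} {μ₀ : ProbabilityMeasure G} (hμ : Tendsto μ l (𝓝 μ₀))
    (g : BoundedContinuousFunction G ℝ≥0)
    [IsProbabilityMeasure (m.withDensity fun x => (g x : ℝ≥0∞))] :
    Tendsto (fun i => tvDist ((m.withDensity fun x => (g x : ℝ≥0∞)) ∗ (μ₀ : Measure G))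
      ((m.withDensity fun x => (g x : ℝ≥0∞)) ∗ (μ i : Measure G))) l (𝓝 0) := by
  have hg : Measurable fun x => (g x : ℝ≥0∞) := by fun_prop
  have measurable_smoothed (ξ : ProbabilityMeasure G) :
      Measurable fun x => ∫⁻ y, (g (x - y) : ℝ≥0∞) ∂(ξ : Measure G) :=
    Measurable.lintegral_prod_right (f := fun x y => (g (x - y) : ℝ≥0∞)) (by fun_prop)
  have isProbability_smoothed (ξ : ProbabilityMeasure G) : IsProbabilityMeasure
      (m.withDensity fun x => ∫⁻ y, (g (x - y) : ℝ≥0∞) ∂(ξ : Measure G)) :=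
    withDensity_conv (m := m) hg (ξ : Measure G) ▸ inferInstance
  simp only [withDensity_conv hg]
  refine tendsto_tvDist_withDensity (fun i => measurable_smoothed (μ i)) (measurable_smoothed μ₀)
    (.of_forall fun x => ?_)
  exact ProbabilityMeasure.tendsto_iff_forall_lintegral_tendsto.1 hμ
    (g.compContinuous ⟨fun y => x - y, by fun_prop⟩)

end ContinuousDensity

section Gaussian

lemma gaussianReal_map_sqrt_mul (m : ℝ) (v s : ℝ≥0) :
    (gaussianReal m v).map (√s * ·) = gaussianReal (√s * m) (s * v) := by
  rw [gaussianReal_map_const_mul]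
  congr 2
  exact NNReal.coe_injective (Real.sq_sqrt s.coe_nonneg)

lemma integral_abs_gaussianReal_le (v : ℝ≥0) : ∫ x, |x| ∂gaussianReal 0 v ≤ √v := by
  have h := integral_abs_le_sqrt_integral_sq (memLp_id_gaussianReal (μ := 0) (v := v) 2)
  have hvar := variance_of_integral_eq_zero aemeasurable_id
    (show ∫ x, id x ∂gaussianReal 0 v = 0 from integral_id_gaussianReal)
  rw [variance_id_gaussianReal] at hvar
  exact hvar ▸ h

/-- The density of the centred normal law as a bounded continuous function. -/
def gaussianDensity (v : ℝ≥0) : BoundedContinuousFunction ℝ ℝ≥0 :=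
  (BoundedContinuousFunction.ofNormedAddCommGroup (gaussianPDFReal 0 v)
    (by unfold gaussianPDFReal; fun_prop) (√(2 * Real.pi * v))⁻¹ fun x => by
      rw [Real.norm_of_nonneg (gaussianPDFReal_nonneg _ _ _), gaussianPDFReal]
      refine mul_le_of_le_one_right (by positivity) (Real.exp_le_one_iff.2 ?_)
      rw [neg_div]
      exact neg_nonpos.2 (by positivity)).nnrealPart

lemma gaussianReal_eq_withDensity_gaussianDensity {v : ℝ≥0} (hv : v ≠ 0) :
    gaussianReal 0 v = volume.withDensity fun x => (gaussianDensity v x : ℝ≥0∞) :=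
  gaussianReal_of_var_ne_zero 0 hv

lemma tendsto_tvDist_gaussianReal_conv {ι : Type*} {l : Filter ι} [l.IsCountablyGenerated]
    {μ : ι → ProbabilityMeasure ℝ} {μ₀ : ProbabilityMeasure ℝ} (hμ : Tendsto μ l (𝓝 μ₀))
    {v : ℝ≥0} (hv : v ≠ 0) :
    Tendsto (fun i => tvDist (gaussianReal 0 v ∗ (μ₀ : Measure ℝ))
      (gaussianReal 0 v ∗ (μ i : Measure ℝ))) l (𝓝 0) := by
  have hdensity := gaussianReal_eq_withDensity_gaussianDensity hv
  have : IsProbabilityMeasure (volume.withDensity fun x => (gaussianDensity v x : ℝ≥0∞)) :=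
    hdensity ▸ inferInstance
  rw [hdensity]
  exact tendsto_tvDist_withDensity_conv hμ _

lemma tendsto_tvDist_gaussianReal_var {ι : Type*} {l : Filter ι} [l.IsCountablyGenerated]
    {v : ι → ℝ≥0} {v₀ : ℝ≥0} (hv₀ : v₀ ≠ 0) (hv : Tendsto v l (𝓝 v₀)) (m : ℝ) :
    Tendsto (fun i => tvDist (gaussianReal m v₀) (gaussianReal m (v i))) l (𝓝 0) := by
  wlog hne : ∀ i, v i ≠ 0 generalizing v
  · have ne_zero : ∀ᶠ i in l, v i ≠ 0 := hv.eventually_ne hv₀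
    classical
    refine (this (v := fun i => if v i = 0 then v₀ else v i) (hv.congr' ?_) ?_).congr' ?_
    · filter_upwards [ne_zero] with i hi using (if_neg hi).symm
    · intro i
      split_ifs with hi
      exacts [hv₀, hi]
    · filter_upwards [ne_zero] with i hi
      rw [if_neg hi]
  have isProbability {u : ℝ≥0} (hu : u ≠ 0) :
      IsProbabilityMeasure (volume.withDensity (gaussianPDF m u)) :=
    gaussianReal_of_var_ne_zero m hu ▸ inferInstance
  have := isProbability hv₀
  have (i : ι) := isProbability (hne i)
  simp only [gaussianReal_of_var_ne_zero m hv₀, gaussianReal_of_var_ne_zero m (hne _)]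
  refine tendsto_tvDist_withDensity (fun i => measurable_gaussianPDF _ _)
    (measurable_gaussianPDF _ _) (.of_forall fun x => ENNReal.tendsto_ofReal ?_)
  have hcont : ContinuousAt (fun u : ℝ => (√(2 * Real.pi * u))⁻¹ *
      Real.exp (-(x - m) ^ 2 / (2 * u))) v₀ := by
    have : (0 : ℝ) < v₀ := by positivity
    have : √(2 * Real.pi * v₀) ≠ 0 := (Real.sqrt_pos.2 (by positivity)).ne'
    fun_prop (disch := first | assumption | positivity)
  exact hcont.tendsto.comp (NNReal.tendsto_coe.2 hv)

end Gaussian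

lemma tendsto_smul_comp_inv_sqrt_mul {F : Type*} [NormedAddCommGroup F] [NormedSpace ℝ F]
    {R : ℝ → F} (hR : R =o[𝓝 0] fun u : ℝ => u ^ 2) (ξ : ℝ) :
    Tendsto (fun s : ℝ≥0 => (s : ℝ) • R ((√s)⁻¹ * ξ)) atTop (𝓝 0) := by
  have argument_tendsto : Tendsto (fun s : ℝ≥0 => (√(s : ℝ))⁻¹ * ξ) atTop (𝓝 0) := by
    simpa using (tendsto_inv_atTop_zero.comp
      (Real.tendsto_sqrt_atTop.comp (NNReal.tendsto_coe_atTop.2 tendsto_id))).mul_const ξ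
  have remainder : (fun s : ℝ≥0 => (s : ℝ) • R ((√s)⁻¹ * ξ)) =o[atTop]
      fun s : ℝ≥0 => (s : ℝ) • ((√(s : ℝ))⁻¹ * ξ) ^ 2 :=
    (Asymptotics.isBigO_refl _ _).smul_isLittleO (hR.comp_tendsto argument_tendsto)
  have scale : (fun s : ℝ≥0 => (s : ℝ) • ((√(s : ℝ))⁻¹ * ξ) ^ 2) =ᶠ[atTop] fun _ => ξ ^ 2 := by
    filter_upwards [eventually_gt_atTop 0] with s hs
    rw [smul_eq_mul, mul_pow, inv_pow, Real.sq_sqrt s.coe_nonneg,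
      mul_inv_cancel_left₀ (NNReal.coe_ne_zero.2 hs.ne')]
  exact (Asymptotics.isLittleO_one_iff ℝ).1 ((remainder.trans_eventuallyEq scale).trans_isBigO
    (Asymptotics.isBigO_const_const _ one_ne_zero _))

section Standardized

variable (W : Measure ℝ) [IsProbabilityMeasure W]

lemma isLittleO_charFun_sub_taylor_two (hW : MemLp id 2 W) :
    (fun u : ℝ => charFun W u - (1 + (∫ x, x ∂W : ℝ) * u * Complex.I -
      (∫ x, x ^ 2 ∂W : ℝ) * u ^ 2 / 2)) =o[𝓝 0] fun u : ℝ => u ^ 2 := by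
  have htaylor (u : ℝ) : taylorWithinEval (charFun W) 2 univ 0 u =
      1 + (∫ x, x ∂W : ℝ) * u * Complex.I - (∫ x, x ^ 2 ∂W : ℝ) * u ^ 2 / 2 := by
    have h := taylorWithinEval_charFun_two_zero (X := id) (P := W) aemeasurable_id
      (by rwa [Measure.map_id]) u
    rwa [Measure.map_id] at h
  have h := taylor_isLittleO_univ (x₀ := 0) (contDiff_charFun (n := 2) (by exact_mod_cast hW))
  simp only [sub_zero] at h
  exact h.congr_left fun u => by rw [htaylor]

/-- The law of `(Y - s m) / √s`, where `Y` is compound Poisson with jump law `W` of mean `m`. -/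
def standardizedCompoundPoisson (s : ℝ≥0) : Measure ℝ :=
  (compoundPoisson s W).map fun x => (√s)⁻¹ * (x + -(s * ∫ y, y ∂W))

instance (s : ℝ≥0) : IsProbabilityMeasure (standardizedCompoundPoisson W s) :=
  Measure.isProbabilityMeasure_map (by fun_prop)

lemma charFun_standardizedCompoundPoisson (s : ℝ≥0) (ξ : ℝ) :
    charFun (standardizedCompoundPoisson W s) ξ =
      Complex.exp (s * (charFun W ((√s)⁻¹ * ξ) - 1 -
        (∫ x, x ∂W : ℝ) * ((√s)⁻¹ * ξ : ℝ) * Complex.I)) := by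
  rw [standardizedCompoundPoisson, charFun_map_mul_comp (by fun_prop), charFun_map_add_const,
    charFun_compoundPoisson, ← Complex.exp_add]
  congr 1
  simp only [RCLike.inner_apply, conj_trivial]
  push_cast
  ring

variable {W}

lemma tendsto_charFun_standardizedCompoundPoisson (hW : MemLp id 2 W) {v : ℝ≥0}
    (hv : (v : ℝ) = ∫ x, x ^ 2 ∂W) (ξ : ℝ) :
    Tendsto (fun s => charFun (standardizedCompoundPoisson W s) ξ) atTop
      (𝓝 (charFun (gaussianReal 0 v) ξ)) := by
  have hremainder := tendsto_smul_comp_inv_sqrt_mul (isLittleO_charFun_sub_taylor_two W hW) ξ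
  have hlim := (Complex.continuous_exp.tendsto _).comp
    (hremainder.sub_const ((v : ℂ) * ξ ^ 2 / 2))
  have hgauss : charFun (gaussianReal 0 v) ξ = Complex.exp (0 - (v : ℂ) * ξ ^ 2 / 2) := by
    simp [charFun_gaussianReal]
  rw [hgauss]
  refine hlim.congr' ?_
  filter_upwards [eventually_gt_atTop 0] with s hs
  have scale : (s : ℂ) * (((√s)⁻¹ * ξ : ℝ) : ℂ) ^ 2 = ξ ^ 2 := by
    have : (s : ℝ) * ((√s)⁻¹ * ξ) ^ 2 = ξ ^ 2 := by
      rw [mul_pow, inv_pow, Real.sq_sqrt s.coe_nonneg,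
        mul_inv_cancel_left₀ (NNReal.coe_ne_zero.2 hs.ne')]
    exact_mod_cast this
  rw [charFun_standardizedCompoundPoisson, Function.comp_apply, ← hv, Complex.real_smul]
  congr 1
  linear_combination (v : ℂ) / 2 * scale

lemma tendsto_standardizedCompoundPoisson (hW : MemLp id 2 W) {v : ℝ≥0}
    (hv : (v : ℝ) = ∫ x, x ^ 2 ∂W) {s : ℕ → ℝ≥0} (hs : Tendsto s atTop atTop) :
    Tendsto (β := ProbabilityMeasure ℝ)
      (fun n => ⟨standardizedCompoundPoisson W (s n), inferInstance⟩) atTop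
      (𝓝 ⟨gaussianReal 0 v, inferInstance⟩) :=
  ProbabilityMeasure.tendsto_of_tendsto_charFun fun ξ =>
    (tendsto_charFun_standardizedCompoundPoisson hW hv ξ).comp hs

lemma exists_tvDist_standardizedCompoundPoisson_map_add_le (hW : W ≪ volume) :
    ∃ C > 0, ∀ (y : ℝ) (s : ℝ≥0), 0 < s → tvDist (standardizedCompoundPoisson W s)
      ((standardizedCompoundPoisson W s).map (y + ·)) ≤ ENNReal.ofReal (C * (|y| + (√s)⁻¹)) := by
  obtain ⟨C, hC, hle⟩ := exists_tvDist_compoundPoisson_map_add_le hW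
  refine ⟨C, hC, fun y s hs => ?_⟩
  have sqrt_pos : 0 < √(s : ℝ) := Real.sqrt_pos.2 hs
  have translate : (standardizedCompoundPoisson W s).map (y + ·) =
      ((compoundPoisson s W).map (√s * y + ·)).map
        fun x => (√s)⁻¹ * (x + -(s * ∫ y, y ∂W)) := by
    rw [standardizedCompoundPoisson, Measure.map_map (by fun_prop) (by fun_prop),
      Measure.map_map (by fun_prop) (by fun_prop)]
    congr 1 with x
    simp only [Function.comp_apply]
    field_simp
    ring
  calc tvDist (standardizedCompoundPoisson W s) ((standardizedCompoundPoisson W s).map (y + ·))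
      ≤ tvDist (compoundPoisson s W) ((compoundPoisson s W).map (√s * y + ·)) := by
        rw [translate]
        exact tvDist_map_le _ _ (by fun_prop)
    _ ≤ ENNReal.ofReal (C * (‖√s * y‖ + 1) / √s) := hle _ s hs
    _ = ENNReal.ofReal (C * (|y| + (√s)⁻¹)) := by
        rw [norm_mul, Real.norm_of_nonneg sqrt_pos.le, Real.norm_eq_abs]
        congr 1
        field_simp

lemma exists_tvDist_gaussianReal_conv_standardizedCompoundPoisson_le (hW : W ≪ volume) :
    ∃ C > 0, ∀ s δ : ℝ≥0, 0 < s → tvDist (standardizedCompoundPoisson W s)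
      (gaussianReal 0 δ ∗ standardizedCompoundPoisson W s) ≤
        ENNReal.ofReal (C * (√δ + (√s)⁻¹)) := by
  obtain ⟨C, hC, hle⟩ := exists_tvDist_standardizedCompoundPoisson_map_add_le hW
  refine ⟨C, hC, fun s δ hs => ?_⟩
  have integrable_abs : Integrable (fun y : ℝ => |y|) (gaussianReal 0 δ) :=
    ((memLp_id_gaussianReal 1).integrable le_rfl).abs
  calc tvDist (standardizedCompoundPoisson W s) (gaussianReal 0 δ ∗ standardizedCompoundPoisson W s)
      ≤ ∫⁻ y, ENNReal.ofReal (C * (|y| + (√s)⁻¹)) ∂gaussianReal 0 δ :=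
        (tvDist_conv_self_le _ _).trans (lintegral_mono fun y => hle y s hs)
    _ = ENNReal.ofReal (C * (∫ y, |y| ∂gaussianReal 0 δ + (√s)⁻¹)) := by
        rw [← ofReal_integral_eq_lintegral_ofReal (by fun_prop)
            (.of_forall fun y => by positivity), integral_const_mul,
          integral_add integrable_abs (integrable_const _), integral_const, probReal_univ, one_smul]
    _ ≤ ENNReal.ofReal (C * (√δ + (√s)⁻¹)) := by
        gcongr
        exact integral_abs_gaussianReal_le δ

lemma tendsto_tvDist_standardizedCompoundPoisson (hac : W ≪ volume) (hW : MemLp id 2 W) {v : ℝ≥0}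
    (hv : (v : ℝ) = ∫ x, x ^ 2 ∂W) (hv0 : v ≠ 0) :
    Tendsto (fun s => tvDist (standardizedCompoundPoisson W s) (gaussianReal 0 v)) atTop (𝓝 0) := by
  obtain ⟨C, hC, hsmooth⟩ := exists_tvDist_gaussianReal_conv_standardizedCompoundPoisson_le hac
  refine tendsto_of_seq_tendsto fun s hs => ENNReal.tendsto_nhds_zero.2 fun ε hε => ?_
  have gaussian_error : Tendsto (fun δ : ℝ≥0 => ENNReal.ofReal (C * √δ) +
      tvDist (gaussianReal 0 v) (gaussianReal 0 (δ + v))) (𝓝[>] 0) (𝓝 0) := by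
    have hsqrt : Continuous fun δ : ℝ≥0 => ENNReal.ofReal (C * √δ) :=
      ENNReal.continuous_ofReal.comp (by fun_prop)
    have hadd : Continuous fun δ : ℝ≥0 => δ + v := by fun_prop
    simpa using ((hsqrt.tendsto 0).mono_left nhdsWithin_le_nhds).add
      (tendsto_tvDist_gaussianReal_var hv0
        (by simpa using (hadd.tendsto 0).mono_left nhdsWithin_le_nhds) 0)
  obtain ⟨δ, hδ, δ_pos⟩ := ((gaussian_error.eventually_le_const (ENNReal.half_pos hε.ne')).and
    self_mem_nhdsWithin).exists
  have poisson_error : Tendsto (fun n => ENNReal.ofReal (C * (√(s n : ℝ))⁻¹) +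
      tvDist (gaussianReal 0 δ ∗ gaussianReal 0 v)
        (gaussianReal 0 δ ∗ standardizedCompoundPoisson W (s n))) atTop (𝓝 0) := by
    have hinv : Tendsto (fun n => (√(s n : ℝ))⁻¹) atTop (𝓝 0) := tendsto_inv_atTop_zero.comp
      (Real.tendsto_sqrt_atTop.comp (NNReal.tendsto_coe_atTop.2 hs))
    simpa using (ENNReal.tendsto_ofReal (hinv.const_mul C)).add
      (tendsto_tvDist_gaussianReal_conv (tendsto_standardizedCompoundPoisson hW hv hs)
        (ne_of_gt δ_pos))
  filter_upwards [poisson_error.eventually_le_const (ENNReal.half_pos hε.ne'),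
    hs.eventually_gt_atTop 0] with n hn hsn
  have smoothed := hsmooth (s n) δ hsn
  rw [mul_add, ENNReal.ofReal_add (by positivity) (by positivity)] at smoothed
  rw [tvDist_comm (_ ∗ _), gaussianReal_conv_gaussianReal, add_zero] at hn
  calc tvDist (standardizedCompoundPoisson W (s n)) (gaussianReal 0 v)
      ≤ _ + (_ + _) := (tvDist_triangle _ _ _).trans (add_le_add smoothed
        ((tvDist_triangle _ (gaussianReal 0 (δ + v)) _).trans_eq
          (congrArg _ (tvDist_comm _ _))))
    _ = _ + _ := by ring
    _ ≤ ε / 2 + ε / 2 := add_le_add hδ hn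
    _ = ε := ENNReal.add_halves ε

theorem tendsto_tvDist_compoundPoisson_gaussianReal (hac : W ≪ volume) (hW : MemLp id 2 W)
    {v : ℝ≥0} (hv : (v : ℝ) = ∫ x, x ^ 2 ∂W) (hv0 : v ≠ 0) :
    Tendsto (fun s : ℝ≥0 => tvDist (compoundPoisson s W)
      (gaussianReal (s * ∫ x, x ∂W) (s * v))) atTop (𝓝 0) := by
  refine tendsto_of_tendsto_of_tendsto_of_le_of_le' tendsto_const_nhds
    (tendsto_tvDist_standardizedCompoundPoisson hac hW hv hv0) (.of_forall fun _ => zero_le) ?_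
  filter_upwards [eventually_gt_atTop 0] with s hs
  have sqrt_ne_zero : √(s : ℝ) ≠ 0 := (Real.sqrt_pos.2 hs).ne'
  have unscale : (standardizedCompoundPoisson W s).map (fun x => √s * x + s * ∫ y, y ∂W) =
      compoundPoisson s W := by
    rw [standardizedCompoundPoisson, Measure.map_map (by fun_prop) (by fun_prop)]
    convert Measure.map_id using 2 with x
    ext x
    simp [sqrt_ne_zero]
  have unscale_gaussian : (gaussianReal 0 v).map (fun x => √s * x + s * ∫ y, y ∂W) =
      gaussianReal (s * ∫ x, x ∂W) (s * v) := by
    rw [← Function.comp_def (· + s * ∫ y, y ∂W) (√s * ·),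
      ← Measure.map_map (by fun_prop) (by fun_prop), gaussianReal_map_sqrt_mul,
      gaussianReal_map_add_const, mul_zero, zero_add]
  rw [← unscale_gaussian]
  nth_rw 1 [← unscale]
  exact tvDist_map_le _ _ (by fun_prop)

end Standardized

/-! ### The master equation -/

section PoissonDerivative

lemma hasDerivAt_pow_succ_div_factorial (n : ℕ) (s : ℝ) :
    HasDerivAt (fun s : ℝ => s ^ (n + 1) / (n + 1).factorial) (s ^ n / n.factorial) s := by
  refine ((hasDerivAt_pow (n + 1) s).div_const _).congr_deriv ?_
  rw [Nat.factorial_succ, Nat.add_sub_cancel]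
  push_cast
  field_simp

variable {a : ℕ → ℝ}

lemma summable_pow_div_factorial_succ
    (ha : ∀ s : ℝ≥0, Summable fun n : ℕ => (s : ℝ) ^ n / n.factorial * |a n|) (s : ℝ≥0) :
    Summable fun n : ℕ => (s : ℝ) ^ n / n.factorial * |a (n + 1)| := by
  refine Summable.of_nonneg_of_le (fun n => by positivity) (fun n => ?_)
    ((summable_nat_add_iff 1).2 (ha (2 * (s + 1))))
  gcongr ?_ * _
  refine (div_le_div_iff₀ (by positivity) (by positivity)).2 ?_
  have hpow : (s : ℝ) ^ n ≤ (s + 1) ^ (n + 1) :=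
    (pow_le_pow_left₀ s.2 (le_add_of_nonneg_right zero_le_one) n).trans
      (pow_le_pow_right₀ (le_add_of_nonneg_left s.2) n.le_succ)
  have htwo : (n + 1 : ℝ) ≤ 2 ^ (n + 1) := by
    exact_mod_cast (Nat.lt_two_pow_self (n := n + 1)).le
  calc (s : ℝ) ^ n * (n + 1).factorial = (n + 1) * (s : ℝ) ^ n * n.factorial := by
        push_cast [Nat.factorial_succ]
        ring
    _ ≤ 2 ^ (n + 1) * (s + 1) ^ (n + 1) * n.factorial := by gcongr
    _ = _ := by
        push_cast
        rw [mul_pow]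

lemma hasDerivAt_tsum_pow_div_factorial
    (ha : ∀ s : ℝ≥0, Summable fun n : ℕ => (s : ℝ) ^ n / n.factorial * |a n|) (s : ℝ) :
    HasDerivAt (fun s : ℝ => ∑' n : ℕ, s ^ n / n.factorial * a n)
      (∑' n : ℕ, s ^ n / n.factorial * a (n + 1)) s := by
  have summable_term (s : ℝ) : Summable fun n : ℕ => s ^ n / n.factorial * a n := by
    refine Summable.of_norm ((ha ‖s‖₊).congr fun n => ?_)
    rw [norm_mul, norm_div, norm_pow, Real.norm_natCast, Real.norm_eq_abs (a n), coe_nnnorm]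
  have eq_add_tsum : (fun s : ℝ => ∑' n : ℕ, s ^ n / n.factorial * a n) =
      fun s => a 0 + ∑' n : ℕ, s ^ (n + 1) / (n + 1).factorial * a (n + 1) := by
    ext s
    simp only [(summable_term s).tsum_eq_zero_add, pow_zero, Nat.factorial_zero, Nat.cast_one,
      div_one, one_mul]
  rw [eq_add_tsum]
  refine (hasDerivAt_tsum_of_isPreconnected (y₀ := 0)
    (summable_pow_div_factorial_succ ha (‖s‖₊ + 1)) Metric.isOpen_ball
    (convex_ball (0 : ℝ) (‖s‖ + 1)).isPreconnected
    (fun n y _ => (hasDerivAt_pow_succ_div_factorial n y).mul_const _) (fun n y hy => ?_)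
    (by simp [add_pos_of_nonneg_of_pos]) (summable_zero.congr fun n => by simp)
    (by simp)).const_add _
  have hy' : ‖y‖ ≤ ‖s‖ + 1 := by simpa using (Metric.mem_ball.1 hy).le
  rw [norm_mul, norm_div, norm_pow, Real.norm_natCast, Real.norm_eq_abs (a _)]
  push_cast [coe_nnnorm]
  gcongr

lemma summable_of_integrable_poissonMeasure {s : ℝ≥0} (ha : Integrable a (poissonMeasure s)) :
    Summable fun n : ℕ => (s : ℝ) ^ n / n.factorial * |a n| := by
  refine ((integrable_poissonMeasure_iff.1 ha).mul_left (Real.exp s)).congr fun n => ?_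
  rw [Real.norm_eq_abs, ← mul_assoc, mul_div_assoc, ← mul_assoc, ← Real.exp_add, add_neg_cancel,
    Real.exp_zero, one_mul]

lemma integrable_succ_poissonMeasure (ha : ∀ s, Integrable a (poissonMeasure s)) (s : ℝ≥0) :
    Integrable (fun n => a (n + 1)) (poissonMeasure s) := by
  refine integrable_poissonMeasure_iff.2 <| ((summable_pow_div_factorial_succ
    (fun s => summable_of_integrable_poissonMeasure (ha s)) s).mul_left (Real.exp (-s))).congr
    fun n => ?_
  rw [Real.norm_eq_abs, ← mul_assoc, mul_div_assoc]

lemma hasDerivWithinAt_integral_poissonMeasure (ha : ∀ s, Integrable a (poissonMeasure s))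
    {ν t : ℝ} (hν : 0 ≤ ν) (ht : 0 ≤ t) :
    HasDerivWithinAt (fun t => ∫ n, a n ∂poissonMeasure (ν * t).toNNReal)
      (ν * (∫ n, a (n + 1) ∂poissonMeasure (ν * t).toNNReal -
        ∫ n, a n ∂poissonMeasure (ν * t).toNNReal)) (Ici 0) t := by
  have integral_eq (b : ℕ → ℝ) {t : ℝ} (ht : 0 ≤ t) :
      ∫ n, b n ∂poissonMeasure (ν * t).toNNReal =
        Real.exp (-(ν * t)) * ∑' n : ℕ, (ν * t) ^ n / n.factorial * b n := by
    rw [integral_poissonMeasure, Real.coe_toNNReal _ (mul_nonneg hν ht), ← tsum_mul_left]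
    exact tsum_congr fun n => by rw [smul_eq_mul]; ring
  have hlin : HasDerivAt (fun t : ℝ => ν * t) ν t := by simpa using (hasDerivAt_id t).const_mul ν
  have hseries := (hasDerivAt_tsum_pow_div_factorial
    (fun s => summable_of_integrable_poissonMeasure (ha s)) (ν * t)).comp t hlin
  have hderiv := (hlin.fun_neg.exp.mul hseries).hasDerivWithinAt (s := Ici 0)
  refine (hderiv.congr (fun t ht => integral_eq a ht) (integral_eq a ht)).congr_deriv ?_
  rw [integral_eq a ht, integral_eq (fun n => a (n + 1)) ht, Function.comp_apply]
  ring

end PoissonDerivative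

/-- The law on `(0, ∞)` with density `w`, which is the law of a jump in `MasterEquation`. -/
def jumpLaw (w : ℝ → ℝ≥0) : Measure ℝ :=
  (volume.restrict (Ioi 0)).withDensity fun r => (w r : ℝ≥0∞)

section MasterEquation

variable {w : ℝ → ℝ≥0} {ν t : ℝ}

lemma jumpLaw_absolutelyContinuous (w : ℝ → ℝ≥0) : jumpLaw w ≪ volume :=
  (withDensity_absolutelyContinuous _ _).trans Measure.restrict_le_self.absolutelyContinuous

lemma integral_masterEquation (hw : Measurable w) [IsProbabilityMeasure (jumpLaw w)] (ν : ℝ)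
    (p : Measure ℝ) [IsFiniteMeasure p] {B : Set ℝ} (hB : MeasurableSet B) :
    ∫ r in Ioi (0 : ℝ), ν * w r * (p.real {κ | κ + r ∈ B} - p.real B) =
      ν * ((jumpLaw w ∗ p).real B - p.real B) := by
  have hfin : IsFiniteMeasure ((jumpLaw w).bind fun r => p.map (r + ·)) :=
    conv_eq_bind (jumpLaw w) p ▸ inferInstance
  have shift (r : ℝ) : p.real {κ | κ + r ∈ B} = (p.map (r + ·)).real B := by
    rw [map_measureReal_apply (measurable_const_add r) hB]
    simp only [preimage, add_comm]
  calc ∫ r in Ioi (0 : ℝ), ν * w r * (p.real {κ | κ + r ∈ B} - p.real B)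
      = ν * ∫ r in Ioi (0 : ℝ), w r • ((p.map (r + ·)).real B - p.real B) := by
        simp only [shift, mul_assoc, integral_const_mul, NNReal.smul_def, smul_eq_mul]
    _ = ν * ∫ r, ((p.map (r + ·)).real B - p.real B) ∂jumpLaw w := by
        rw [jumpLaw, integral_withDensity_eq_integral_smul hw]
    _ = ν * ((jumpLaw w ∗ p).real B - p.real B) := by
        rw [integral_sub (integrable_real_of_bind (measurable_map_add_left p) hB)
          (integrable_const _), ← bind_real_apply (measurable_map_add_left p) hB, ← conv_eq_bind,
          integral_const, probReal_univ, one_smul]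

theorem masterEquation_compoundPoisson (hw : Measurable w) [IsProbabilityMeasure (jumpLaw w)]
    (hν : 0 ≤ ν) :
    MasterEquation ν w fun t => compoundPoisson (ν * t).toNNReal (jumpLaw w) := by
  intro B hB t ht
  have real_eq (s : ℝ≥0) : (compoundPoisson s (jumpLaw w)).real B =
      ∫ n, (convPow (jumpLaw w) n).real B ∂poissonMeasure s := by
    have : IsFiniteMeasure ((poissonMeasure s).bind (convPow (jumpLaw w))) :=
      inferInstanceAs (IsFiniteMeasure (compoundPoisson s (jumpLaw w)))
    rw [compoundPoisson, bind_real_apply .of_discrete hB]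
  have real_conv_eq (s : ℝ≥0) : (jumpLaw w ∗ compoundPoisson s (jumpLaw w)).real B =
      ∫ n, (convPow (jumpLaw w) (n + 1)).real B ∂poissonMeasure s := by
    have : IsFiniteMeasure (((poissonMeasure s).map (· + 1)).bind (convPow (jumpLaw w))) :=
      conv_compoundPoisson s (jumpLaw w) ▸ inferInstance
    rw [conv_compoundPoisson, bind_real_apply .of_discrete hB,
      integral_map .of_discrete .of_discrete]
  rw [integral_masterEquation hw ν _ hB]
  simp only [real_eq, real_conv_eq]
  refine hasDerivWithinAt_integral_poissonMeasure (fun s => ?_) hν ht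
  exact Integrable.of_bound .of_discrete 1 (.of_forall fun n => by
    simpa only [Real.norm_of_nonneg measureReal_nonneg] using measureReal_le_one)

lemma MasterEquation.measureReal_univ {p : ℝ → Measure ℝ} (h : MasterEquation ν w p)
    (ht : 0 ≤ t) : (p t).real univ = (p 0).real univ := by
  have hd (s : ℝ) (hs : 0 ≤ s) : HasDerivWithinAt (fun s => (p s).real univ) 0 (Ici 0) s := by
    simpa using h univ .univ s hs
  exact constant_of_has_deriv_right_zero (a := 0) (b := t) (f := fun s => (p s).real univ)
    (fun s hs => (hd s hs.1).continuousWithinAt.mono Icc_subset_Ici_self)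
    (fun s hs => (hd s hs.1).mono (Ici_subset_Ici.2 hs.1)) t ⟨ht, le_rfl⟩

lemma norm_le_pow_succ_div_factorial_of_hasDerivWithinAt {f f' : ℝ → ℝ} {a C : ℝ} {n : ℕ}
    (hf : ∀ s, 0 ≤ s → HasDerivWithinAt f (f' s) (Ici 0) s) (hf0 : f 0 = 0)
    (hf' : ∀ s, 0 ≤ s → ‖f' s‖ ≤ a * (C * ((a * s) ^ n / n.factorial))) (ht : 0 ≤ t) :
    ‖f t‖ ≤ C * ((a * t) ^ (n + 1) / (n + 1).factorial) := by
  have hlin (s : ℝ) : HasDerivAt (fun s : ℝ => a * s) a s := by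
    simpa using (hasDerivAt_id s).const_mul a
  have hbound (s : ℝ) : HasDerivAt (fun s => C * ((a * s) ^ (n + 1) / (n + 1).factorial))
      (a * (C * ((a * s) ^ n / n.factorial))) s := by
    refine (((hasDerivAt_pow_succ_div_factorial n (a * s)).comp s (hlin s)).const_mul
      C).congr_deriv ?_
    ring
  exact image_norm_le_of_norm_deriv_right_le_deriv_boundary (a := 0) (b := t)
    (fun s hs => (hf s hs.1).continuousWithinAt.mono Icc_subset_Ici_self)
    (fun s hs => (hf s hs.1).mono (Ici_subset_Ici.2 hs.1)) (by simp [hf0]) hbound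
    (fun s hs => hf' s hs.1) ⟨ht, le_rfl⟩

/-- Picard iteration: each use of the equation gains a factor `2 ν t / n`, since convolution with
the jump law does not increase the total variation distance. -/
lemma MasterEquation.tvDist_le (hw : Measurable w) [IsProbabilityMeasure (jumpLaw w)]
    (hν : 0 ≤ ν) {p q : ℝ → Measure ℝ} (hpf : ∀ t, 0 ≤ t → IsFiniteMeasure (p t))
    (hqf : ∀ t, 0 ≤ t → IsFiniteMeasure (q t)) (h0 : p 0 = q 0) (hp : MasterEquation ν w p)
    (hq : MasterEquation ν w q) (n : ℕ) (ht : 0 ≤ t) :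
    tvDist (p t) (q t) ≤
      ENNReal.ofReal ((p 0).real univ * ((2 * ν * t) ^ n / n.factorial)) := by
  induction n generalizing t with
  | zero =>
    have hpt := hpf t ht
    have hqt := hqf t ht
    rw [pow_zero, Nat.factorial_zero, Nat.cast_one, div_one, mul_one]
    exact tvDist_le_ofReal (hp.measureReal_univ ht).le (h0 ▸ (hq.measureReal_univ ht).le)
  | succ n ih =>
    refine TripMobility.tvDist_le fun B hB => ?_
    have hderiv (s : ℝ) (hs : 0 ≤ s) :
        HasDerivWithinAt (fun s => (p s).real B - (q s).real B)
          (ν * ((jumpLaw w ∗ p s).real B - (jumpLaw w ∗ q s).real B -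
            ((p s).real B - (q s).real B))) (Ici 0) s := by
      have hps := hpf s hs
      have hqs := hqf s hs
      refine ((hp B hB s hs).sub (hq B hB s hs)).congr_deriv ?_
      rw [integral_masterEquation hw ν _ hB, integral_masterEquation hw ν _ hB]
      ring
    rw [edist_le_ofReal (by positivity), dist_eq_norm]
    refine norm_le_pow_succ_div_factorial_of_hasDerivWithinAt hderiv (by simp [h0])
      (fun s hs => ?_) ht
    have hps := hpf s hs
    have hqs := hqf s hs
    set c := (p 0).real univ * ((2 * ν * s) ^ n / n.factorial)
    have hc : 0 ≤ c := by positivity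
    have norm_sub_le_of_tvDist_le {μ η : Measure ℝ} (h : tvDist μ η ≤ .ofReal c) :
        ‖μ.real B - η.real B‖ ≤ c := by
      rw [← dist_eq_norm, ← edist_le_ofReal hc]
      exact (edist_real_le_tvDist μ η hB).trans h
    rw [norm_mul, Real.norm_of_nonneg hν, mul_comm 2 ν, mul_assoc, two_mul]
    gcongr
    refine (norm_sub_le _ _).trans (add_le_add ?_ (norm_sub_le_of_tvDist_le (ih hs)))
    exact norm_sub_le_of_tvDist_le ((tvDist_conv_left_le _ _ _).trans (ih hs))

theorem MasterEquation.unique (hw : Measurable w) [IsProbabilityMeasure (jumpLaw w)]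
    (hν : 0 ≤ ν) {p q : ℝ → Measure ℝ} (hpf : ∀ t, 0 ≤ t → IsFiniteMeasure (p t))
    (hqf : ∀ t, 0 ≤ t → IsFiniteMeasure (q t)) (h0 : p 0 = q 0) (hp : MasterEquation ν w p)
    (hq : MasterEquation ν w q) (ht : 0 ≤ t) : p t = q t := by
  have hpt := hpf t ht
  have hqt := hqf t ht
  have bound_tendsto : Tendsto (fun n : ℕ => ENNReal.ofReal
      ((p 0).real univ * ((2 * ν * t) ^ n / n.factorial))) atTop (𝓝 0) := by
    simpa using ENNReal.tendsto_ofReal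
      ((FloorSemiring.tendsto_pow_div_factorial_atTop (2 * ν * t)).const_mul ((p 0).real univ))
  have tvDist_eq_zero : tvDist (p t) (q t) = 0 := le_antisymm
    (ge_of_tendsto' bound_tendsto fun n => hp.tvDist_le hw hν hpf hqf h0 hq n ht) bot_le
  ext B hB
  refine (measureReal_eq_measureReal_iff).1 <| edist_le_zero.1 <|
    tvDist_eq_zero ▸ edist_real_le_tvDist (p t) (q t) hB

end MasterEquation

/-! ### Densities of compound Poisson laws -/

lemma poissonMeasure_le_smul {s T : ℝ≥0} (h : s ≤ T) :
    poissonMeasure s ≤ ENNReal.ofReal (Real.exp T) • poissonMeasure T := by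
  refine Measure.le_iff.2 fun B hB => ?_
  rw [poissonMeasure, poissonMeasure, Measure.smul_apply, Measure.sum_apply _ hB,
    Measure.sum_apply _ hB, smul_eq_mul, ← ENNReal.tsum_mul_left]
  refine ENNReal.tsum_le_tsum fun n => ?_
  rw [Measure.smul_apply, Measure.smul_apply, smul_eq_mul, smul_eq_mul, ← mul_assoc,
    ← ENNReal.ofReal_mul (Real.exp_nonneg _)]
  gcongr ENNReal.ofReal ?_ * _
  calc Real.exp (-s) * (s : ℝ) ^ n / n.factorial ≤ 1 * (T : ℝ) ^ n / n.factorial := by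
        gcongr
        exact Real.exp_le_one_iff.2 (neg_nonpos.2 s.2)
    _ = Real.exp T * (Real.exp (-T) * (T : ℝ) ^ n / n.factorial) := by
        rw [← mul_div_assoc, ← mul_assoc, ← Real.exp_add, add_neg_cancel, Real.exp_zero]

section Density

variable {G : Type*} [AddCommGroup G] [MeasurableSpace G]

/-- The density with respect to `m` of the law of the sum of `n` independent variables with density
`f`. For `n = 0` that law is the Dirac mass at `0`, which is left out: the value is `0`. -/
def convDensity (m : Measure G) (f : G → ℝ≥0∞) : ℕ → G → ℝ≥0∞
  | 0 => 0
  | 1 => f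
  | n + 2 => fun x => ∫⁻ y, f y * convDensity m f (n + 1) (x - y) ∂m

/-- The density with respect to `m` of the compound Poisson law of `m.withDensity f` next to its
atom at `0`. -/
def compoundPoissonDensity (m : Measure G) (f : G → ℝ≥0∞) (s : ℝ≥0) (x : G) : ℝ≥0∞ :=
  ∫⁻ n, convDensity m f n x ∂poissonMeasure s

variable {m : Measure G} {f : G → ℝ≥0∞}

lemma convDensity_succ (n : ℕ) (x : G) :
    convDensity m f (n + 1) x =
      ∫⁻ y, f y * convDensity m f n (x - y) ∂m + Set.indicator {0} (fun _ => f x) n := by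
  rcases n with _ | n <;> simp [convDensity]

lemma convDensity_ne_top {x : G} (hx : ∀ s, compoundPoissonDensity m f s x ≠ ⊤) (n : ℕ) :
    convDensity m f n x ≠ ⊤ := by
  have hae := ae_iff_of_countable.1 (ae_lt_top (measurable_of_countable _) (hx 1)) n
  refine (hae fun h => ?_).ne
  rw [poissonMeasure_singleton, ENNReal.ofReal_eq_zero] at h
  exact h.not_gt (by positivity)

lemma lintegral_convDensity_succ_ne_top {x : G} (hx : ∀ s, compoundPoissonDensity m f s x ≠ ⊤)
    (s : ℝ≥0) : ∫⁻ n, convDensity m f (n + 1) x ∂poissonMeasure s ≠ ⊤ := by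
  have hInt := integrable_succ_poissonMeasure (fun s => integrable_toReal_of_lintegral_ne_top
    (measurable_of_countable (convDensity m f · x)).aemeasurable (hx s)) s
  simpa only [ENNReal.ofReal_toReal (convDensity_ne_top hx _)] using hInt.lintegral_lt_top.ne

variable [MeasurableAdd₂ G] [MeasurableNeg G] [SFinite m]

lemma measurable_convDensity (hf : Measurable f) (n : ℕ) : Measurable (convDensity m f n) := by
  induction n with
  | zero => exact measurable_const
  | succ n ih =>
    have hconv : Measurable fun x => ∫⁻ y, f y * convDensity m f n (x - y) ∂m :=
      Measurable.lintegral_prod_right (f := fun x y => f y * convDensity m f n (x - y))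
        (by fun_prop)
    have hsucc := hconv.add (g := fun x => Set.indicator {0} (fun _ => f x) n)
      (by by_cases hn : n = 0 <;> simp [hn, hf])
    simpa only [← convDensity_succ, Pi.add_def] using hsucc

lemma measurable_uncurry_convDensity (hf : Measurable f) :
    Measurable (Function.uncurry (convDensity m f)) :=
  measurable_from_prod_countable_right fun n => measurable_convDensity hf n

lemma measurable_uncurry_compoundPoissonDensity (hf : Measurable f) :
    Measurable (Function.uncurry (compoundPoissonDensity m f)) := by
  have hconv := measurable_convDensity (m := m) hf
  unfold compoundPoissonDensity Function.uncurry
  simp only [lintegral_countable', poissonMeasure_singleton]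
  fun_prop

lemma lintegral_convDensity_succ (hf : Measurable f) (s : ℝ≥0) (x : G) :
    ∫⁻ n, convDensity m f (n + 1) x ∂poissonMeasure s =
      ∫⁻ y, f y * compoundPoissonDensity m f s (x - y) ∂m +
        ENNReal.ofReal (Real.exp (-s)) * f x := by
  have hconv := measurable_uncurry_convDensity (m := m) hf
  have hswap : ∫⁻ n, ∫⁻ y, f y * convDensity m f n (x - y) ∂m ∂poissonMeasure s =
      ∫⁻ y, f y * compoundPoissonDensity m f s (x - y) ∂m := by
    rw [lintegral_lintegral_swap]
    · simp only [compoundPoissonDensity, lintegral_const_mul _ (measurable_of_countable _)]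
    · exact ((hf.comp measurable_snd).mul (hconv.comp
        (measurable_fst.prodMk (measurable_snd.const_sub x)))).aemeasurable
  simp only [convDensity_succ]
  rw [lintegral_add_right _ (measurable_of_countable _), hswap,
    lintegral_indicator_const (measurableSet_singleton 0), poissonMeasure_singleton]
  simp [mul_comm]

lemma lintegral_mul_compoundPoissonDensity_ne_top (hf : Measurable f) {x : G}
    (hx : ∀ s, compoundPoissonDensity m f s x ≠ ⊤) (s : ℝ≥0) :
    ∫⁻ y, f y * compoundPoissonDensity m f s (x - y) ∂m ≠ ⊤ := by
  have h := lintegral_convDensity_succ_ne_top hx s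
  rw [lintegral_convDensity_succ hf] at h
  exact ne_top_of_le_ne_top h le_self_add

lemma hasDerivWithinAt_compoundPoissonDensity (hf : Measurable f) {x : G}
    (hx : ∀ s, compoundPoissonDensity m f s x ≠ ⊤) (hfx : f x ≠ ⊤) {ν t : ℝ} (hν : 0 ≤ ν)
    (ht : 0 ≤ t) :
    HasDerivWithinAt (fun t => (compoundPoissonDensity m f (ν * t).toNNReal x).toReal)
      (ν * ((∫⁻ y, f y * compoundPoissonDensity m f (ν * t).toNNReal (x - y) ∂m).toReal +
        Real.exp (-(ν * t)) * (f x).toReal -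
        (compoundPoissonDensity m f (ν * t).toNNReal x).toReal)) (Ici 0) t := by
  have integral_toReal_poissonMeasure {g : ℕ → ℝ≥0∞} (hg : ∀ n, g n ≠ ⊤) (s : ℝ≥0) :
      ∫ n, (g n).toReal ∂poissonMeasure s = (∫⁻ n, g n ∂poissonMeasure s).toReal :=
    integral_toReal .of_discrete (.of_forall fun n => (hg n).lt_top)
  have hderiv := hasDerivWithinAt_integral_poissonMeasure
    (fun s => integrable_toReal_of_lintegral_ne_top
      (measurable_of_countable (convDensity m f · x)).aemeasurable (hx s)) hν ht
  simp only [integral_toReal_poissonMeasure (convDensity_ne_top hx),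
    integral_toReal_poissonMeasure fun n => convDensity_ne_top hx (n + 1),
    lintegral_convDensity_succ hf] at hderiv
  rwa [ENNReal.toReal_add (lintegral_mul_compoundPoissonDensity_ne_top hf hx _)
    (ENNReal.mul_ne_top ENNReal.ofReal_ne_top hfx), ENNReal.toReal_mul,
    ENNReal.toReal_ofReal (Real.exp_nonneg _), Real.coe_toNNReal _ (mul_nonneg hν ht)] at hderiv

variable [m.IsAddRightInvariant]

lemma convPow_succ_withDensity (hf : Measurable f) (n : ℕ) :
    convPow (m.withDensity f) (n + 1) = m.withDensity (convDensity m f (n + 1)) := by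
  induction n with
  | zero => rw [convPow, convPow, Measure.conv_dirac_zero, convDensity]
  | succ n ih =>
    have hconv := measurable_convDensity (m := m) hf (n + 1)
    rw [convPow, ih, Measure.conv_comm, withDensity_conv hconv]
    congr 1
    ext x
    rw [lintegral_withDensity_eq_lintegral_mul _ hf (by fun_prop)]
    rfl

lemma compoundPoisson_withDensity (hf : Measurable f) (s : ℝ≥0) :
    compoundPoisson s (m.withDensity f) =
      ENNReal.ofReal (Real.exp (-s)) • Measure.dirac 0 +
        m.withDensity (compoundPoissonDensity m f s) := by
  ext B hB
  have convPow_apply (n : ℕ) : convPow (m.withDensity f) n B =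
      Set.indicator {0} (fun _ => Measure.dirac 0 B) n + ∫⁻ x in B, convDensity m f n x ∂m := by
    rcases n with _ | n
    · simp [convPow, convDensity]
    · rw [convPow_succ_withDensity hf, withDensity_apply _ hB]
      simp
  rw [compoundPoisson, Measure.bind_apply hB .of_discrete, Measure.add_apply, Measure.smul_apply,
    withDensity_apply _ hB, smul_eq_mul]
  simp only [convPow_apply, compoundPoissonDensity]
  rw [lintegral_add_left (measurable_of_countable _),
    lintegral_indicator_const (measurableSet_singleton 0), poissonMeasure_singleton,
    lintegral_lintegral_swap (measurable_uncurry_convDensity hf).aemeasurable]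
  simp [mul_comm]

lemma ae_compoundPoissonDensity_ne_top (hf : Measurable f)
    [IsProbabilityMeasure (m.withDensity f)] :
    ∀ᵐ x ∂m, ∀ s, compoundPoissonDensity m f s x ≠ ⊤ := by
  have ae_natCast (T : ℕ) : ∀ᵐ x ∂m, compoundPoissonDensity m f T x < ⊤ := by
    have hmeas := (measurable_uncurry_compoundPoissonDensity (m := m) hf).comp
      (measurable_prodMk_left (x := (T : ℝ≥0)))
    refine ae_lt_top hmeas (ne_top_of_le_ne_top ENNReal.one_ne_top ?_)
    calc ∫⁻ x, compoundPoissonDensity m f T x ∂m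
        = m.withDensity (compoundPoissonDensity m f T) univ := by
          rw [withDensity_apply _ .univ, Measure.restrict_univ]
      _ ≤ compoundPoisson T (m.withDensity f) univ := by
          rw [compoundPoisson_withDensity hf]
          exact le_add_self
      _ = 1 := measure_univ
  filter_upwards [ae_all_iff.2 ae_natCast] with x hx s
  obtain ⟨T, hT⟩ := exists_nat_ge s
  refine ne_top_of_le_ne_top ?_ (lintegral_mono' (poissonMeasure_le_smul hT) le_rfl)
  rw [lintegral_smul_measure]
  exact ENNReal.mul_ne_top ENNReal.ofReal_ne_top (hx T).ne

end Density

section JumpDensity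

variable {w : ℝ → ℝ≥0}

/-- The density of `jumpLaw w` on the whole line. -/
def jumpDensity (w : ℝ → ℝ≥0) : ℝ → ℝ≥0∞ :=
  (Ioi 0).indicator fun r => (w r : ℝ≥0∞)

lemma jumpDensity_of_pos {r : ℝ} (hr : 0 < r) : jumpDensity w r = w r :=
  indicator_of_mem (mem_Ioi.2 hr) _

lemma jumpDensity_of_nonpos {r : ℝ} (hr : r ≤ 0) : jumpDensity w r = 0 :=
  indicator_of_notMem (notMem_Ioi.2 hr) _

lemma measurable_jumpDensity (hw : Measurable w) : Measurable (jumpDensity w) :=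
  hw.coe_nnreal_ennreal.indicator measurableSet_Ioi

lemma withDensity_jumpDensity (w : ℝ → ℝ≥0) : volume.withDensity (jumpDensity w) = jumpLaw w :=
  withDensity_indicator measurableSet_Ioi _

lemma convDensity_jumpDensity_of_nonpos (n : ℕ) {κ : ℝ} (hκ : κ ≤ 0) :
    convDensity volume (jumpDensity w) n κ = 0 := by
  induction n generalizing κ with
  | zero => rfl
  | succ n ih =>
    have integrand_eq_zero (r : ℝ) :
        jumpDensity w r * convDensity volume (jumpDensity w) n (κ - r) = 0 := by
      rcases le_or_gt r 0 with hr | hr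
      · rw [jumpDensity_of_nonpos hr, zero_mul]
      · rw [ih (by linarith), mul_zero]
    simp only [convDensity_succ, integrand_eq_zero, jumpDensity_of_nonpos hκ, lintegral_zero,
      indicator_zero, add_zero]

lemma compoundPoissonDensity_jumpDensity_of_nonpos (s : ℝ≥0) {κ : ℝ} (hκ : κ ≤ 0) :
    compoundPoissonDensity volume (jumpDensity w) s κ = 0 := by
  simp only [compoundPoissonDensity, convDensity_jumpDensity_of_nonpos _ hκ, lintegral_zero]

lemma toReal_jumpDensity_mul_compoundPoissonDensity (s : ℝ≥0) (κ : ℝ) :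
    (fun r => (jumpDensity w r * compoundPoissonDensity volume (jumpDensity w) s (κ - r)).toReal) =
      (Ioc 0 κ).indicator fun r =>
        w r * (compoundPoissonDensity volume (jumpDensity w) s (κ - r)).toReal := by
  ext r
  rw [ENNReal.toReal_mul]
  by_cases hr : r ∈ Ioc 0 κ
  · rw [indicator_of_mem hr, jumpDensity_of_pos hr.1, ENNReal.coe_toReal]
  rw [indicator_of_notMem hr]
  rcases le_or_gt r 0 with hr0 | hr0
  · rw [jumpDensity_of_nonpos hr0, ENNReal.toReal_zero, zero_mul]
  · have hκr : κ - r ≤ 0 := sub_nonpos.2 (not_le.1 fun h => hr ⟨hr0, h⟩).le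
    rw [compoundPoissonDensity_jumpDensity_of_nonpos s hκr, ENNReal.toReal_zero, mul_zero]

lemma intervalIntegrable_mul_compoundPoissonDensity (hw : Measurable w) {s : ℝ≥0} {κ : ℝ}
    (hκ : 0 ≤ κ) (hfin : ∫⁻ r, jumpDensity w r *
      compoundPoissonDensity volume (jumpDensity w) s (κ - r) ≠ ⊤) :
    IntervalIntegrable (fun r => (w r : ℝ) *
        (compoundPoissonDensity volume (jumpDensity w) s (κ - r)).toReal) volume 0 κ ∧
      ∫ r in (0 : ℝ)..κ, (w r : ℝ) *
          (compoundPoissonDensity volume (jumpDensity w) s (κ - r)).toReal =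
        (∫⁻ r, jumpDensity w r *
          compoundPoissonDensity volume (jumpDensity w) s (κ - r)).toReal := by
  have hmeas : Measurable fun r => jumpDensity w r *
      compoundPoissonDensity volume (jumpDensity w) s (κ - r) :=
    (measurable_jumpDensity hw).mul ((measurable_uncurry_compoundPoissonDensity
      (measurable_jumpDensity hw)).of_uncurry_left.comp (measurable_id.const_sub κ))
  have hInt := integrable_toReal_of_lintegral_ne_top hmeas.aemeasurable hfin
  rw [toReal_jumpDensity_mul_compoundPoissonDensity,
    integrable_indicator_iff measurableSet_Ioc] at hInt
  refine ⟨(intervalIntegrable_iff_integrableOn_Ioc_of_le hκ).2 hInt, ?_⟩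
  rw [intervalIntegral.integral_of_le hκ, ← integral_indicator measurableSet_Ioc,
    ← toReal_jumpDensity_mul_compoundPoissonDensity,
    integral_toReal hmeas.aemeasurable (ae_lt_top hmeas hfin)]

theorem exists_density_compoundPoisson (hw : Measurable w) [IsProbabilityMeasure (jumpLaw w)]
    {ν : ℝ} (hν : 0 ≤ ν) :
    ∃ q : ℝ → ℝ → ℝ, Measurable (Function.uncurry q) ∧ (∀ κ t, 0 ≤ q κ t) ∧
      (∀ t, 0 ≤ t → compoundPoisson (ν * t).toNNReal (jumpLaw w) =
        ENNReal.ofReal (Real.exp (-(ν * t))) • Measure.dirac 0 +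
          (volume.restrict (Ioi 0)).withDensity (fun κ => ENNReal.ofReal (q κ t))) ∧
      ∀ᵐ κ ∂(volume.restrict (Ioi (0 : ℝ))), ∀ t, 0 ≤ t →
        IntervalIntegrable (fun r => w r * q (κ - r) t) volume 0 κ ∧
        HasDerivWithinAt (fun s => q κ s)
          (ν * ((∫ r in (0 : ℝ)..κ, w r * q (κ - r) t) + w κ * Real.exp (-(ν * t))) -
            ν * q κ t) (Ici 0) t := by
  have hf := measurable_jumpDensity hw
  have hprob : IsProbabilityMeasure (volume.withDensity (jumpDensity w)) :=
    (withDensity_jumpDensity w).symm ▸ inferInstance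
  have hfin := ae_compoundPoissonDensity_ne_top (m := volume) hf
  refine ⟨fun κ t => (compoundPoissonDensity volume (jumpDensity w) (ν * t).toNNReal κ).toReal,
    ?_, fun κ t => ENNReal.toReal_nonneg, fun t ht => ?_, ?_⟩
  · exact ((measurable_uncurry_compoundPoissonDensity hf).comp
      ((measurable_snd.const_mul ν).real_toNNReal.prodMk measurable_fst)).ennreal_toReal
  · rw [← withDensity_jumpDensity, compoundPoisson_withDensity hf,
      Real.coe_toNNReal _ (mul_nonneg hν ht), ← withDensity_indicator measurableSet_Ioi]
    congr 1
    refine withDensity_congr_ae ?_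
    filter_upwards [hfin] with κ hκ
    rcases le_or_gt κ 0 with hκ0 | hκ0
    · rw [compoundPoissonDensity_jumpDensity_of_nonpos _ hκ0,
        indicator_of_notMem (notMem_Ioi.2 hκ0)]
    · rw [indicator_of_mem (mem_Ioi.2 hκ0), ENNReal.ofReal_toReal (hκ _)]
  · filter_upwards [ae_restrict_mem measurableSet_Ioi, ae_restrict_of_ae hfin] with κ hκ0 hκ t ht
    have hfκ := jumpDensity_of_pos (w := w) hκ0
    obtain ⟨hInt, hInt_eq⟩ := intervalIntegrable_mul_compoundPoissonDensity hw (mem_Ioi.1 hκ0).le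
      (lintegral_mul_compoundPoissonDensity_ne_top hf hκ (ν * t).toNNReal)
    refine ⟨hInt, (hasDerivWithinAt_compoundPoissonDensity hf hκ (by simp [hfκ]) hν
      ht).congr_deriv ?_⟩
    rw [hInt_eq, hfκ, ENNReal.coe_toReal]
    ring

end JumpDensity

/-! ### Truncated normal laws -/

lemma tendsto_erf_atTop : Tendsto erf atTop (𝓝 1) := by
  have hInt : IntegrableOn (fun s : ℝ => Real.exp (-s ^ 2)) (Ioi 0) := by
    simpa using (integrable_exp_neg_mul_sq one_pos).integrableOn (s := Ioi (0 : ℝ))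
  have hgauss : 2 / √Real.pi * ∫ s in Ioi (0 : ℝ), Real.exp (-s ^ 2) = 1 := by
    rw [show ∫ s in Ioi (0 : ℝ), Real.exp (-s ^ 2) = √Real.pi / 2 by
      simpa using integral_gaussian_Ioi 1]
    field_simp
  exact hgauss ▸ (intervalIntegral_tendsto_integral_Ioi 0 hInt tendsto_id).const_mul (2 / √Real.pi)

lemma tendsto_mul_div_sqrt_atTop {a b : ℝ} (ha : 0 < a) (hb : 0 < b) :
    Tendsto (fun t : ℝ => a * t / √(b * t)) atTop atTop := by
  refine (Real.tendsto_sqrt_atTop.const_mul_atTop (div_pos ha (Real.sqrt_pos.2 hb))).congr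
    fun t => ?_
  rw [Real.sqrt_mul hb.le, ← div_mul_div_comm, Real.div_sqrt]

lemma tendsto_truncFactor {a b : ℝ} (ha : 0 < a) (hb : 0 < b) :
    Tendsto (fun t : ℝ => truncFactor (a * t) (b * t)) atTop (𝓝 1) := by
  have herf : Tendsto (fun t : ℝ => erf (a * t / √(2 * (b * t)))) atTop (𝓝 1) := by
    refine tendsto_erf_atTop.comp ?_
    simpa only [mul_assoc] using tendsto_mul_div_sqrt_atTop ha (mul_pos two_pos hb)
  have hlim : (2 / (1 + 1) : ℝ) = 1 := by norm_num
  exact hlim ▸ tendsto_const_nhds.div (herf.const_add 1) (by norm_num)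

lemma gaussianReal_real_Iic (m : ℝ) {v : ℝ≥0} (hv : v ≠ 0) (x : ℝ) :
    (gaussianReal m v).real (Iic x) = cdf (gaussianReal 0 1) ((x - m) / √v) := by
  have hv' : 0 < √(v : ℝ) := Real.sqrt_pos.2 (NNReal.coe_pos.2 (pos_iff_ne_zero.2 hv))
  have hmap : gaussianReal m v = (gaussianReal 0 1).map fun y => m + √v * y := by
    have hscale := gaussianReal_map_sqrt_mul 0 1 v
    rw [mul_zero, mul_one] at hscale
    have hshift := gaussianReal_map_const_add (μ := 0) (v := v) m
    rw [zero_add, ← hscale, Measure.map_map (by fun_prop) (by fun_prop)] at hshift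
    exact hshift.symm
  rw [hmap, map_measureReal_apply (by fun_prop) measurableSet_Iic, cdf_eq_real]
  congr 1
  ext y
  rw [mem_preimage, mem_Iic, mem_Iic, le_div_iff₀' hv', le_sub_iff_add_le']

lemma tendsto_gaussianReal_Iic_zero {a b : ℝ} (ha : 0 < a) (hb : 0 < b) :
    Tendsto (fun t : ℝ => (gaussianReal (a * t) (b * t).toNNReal).real (Iic 0)) atTop (𝓝 0) := by
  refine ((tendsto_cdf_atBot (gaussianReal 0 1)).comp
    (tendsto_neg_atTop_atBot.comp (tendsto_mul_div_sqrt_atTop ha hb))).congr' ?_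
  filter_upwards [eventually_gt_atTop 0] with t ht
  have hbt : 0 < b * t := mul_pos hb ht
  rw [gaussianReal_real_Iic _ (Real.toNNReal_pos.2 hbt).ne', Real.coe_toNNReal _ hbt.le, zero_sub,
    neg_div]
  rfl

lemma truncNormal_eq_smul_restrict {m v : ℝ} (hv : 0 < v) (hf : 0 ≤ truncFactor m v) :
    truncNormal m v = ENNReal.ofReal (truncFactor m v) •
      (gaussianReal m v.toNNReal).restrict (Ici 0) := by
  rw [truncNormal, gaussianReal_of_var_ne_zero m (Real.toNNReal_pos.2 hv).ne',
    restrict_withDensity measurableSet_Ici, ← withDensity_smul _ (measurable_gaussianPDF _ _)]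
  congr 1
  ext κ
  rw [ENNReal.ofReal_mul hf, Pi.smul_apply, smul_eq_mul, gaussianPDF, gaussianPDFReal,
    Real.coe_toNNReal _ hv.le, one_div]

lemma tvDist_smul_restrict_le {α : Type*} [MeasurableSpace α] (μ : Measure α)
    [IsProbabilityMeasure μ] {S : Set α} (hS : MeasurableSet S) {c : ℝ} (hc : 0 ≤ c) :
    tvDist μ (ENNReal.ofReal c • μ.restrict S) ≤ ENNReal.ofReal (μ.real Sᶜ + |c - 1|) := by
  refine tvDist_le fun B hB => edist_le_ofReal (by positivity) |>.2 ?_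
  have hsplit : μ.real B - c * μ.real (B ∩ S) = μ.real (B \ S) - (c - 1) * μ.real (B ∩ S) := by
    rw [← measureReal_inter_add_sdiff (s := B) hS]
    ring
  rw [measureReal_ennreal_smul_apply, ENNReal.toReal_ofReal hc, measureReal_restrict_apply hB,
    Real.dist_eq, hsplit]
  calc |μ.real (B \ S) - (c - 1) * μ.real (B ∩ S)|
      ≤ |μ.real (B \ S)| + |(c - 1) * μ.real (B ∩ S)| := abs_sub _ _
    _ = μ.real (B \ S) + |c - 1| * μ.real (B ∩ S) := by
        rw [abs_mul, abs_of_nonneg measureReal_nonneg, abs_of_nonneg measureReal_nonneg]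
    _ ≤ μ.real Sᶜ + |c - 1| := add_le_add (measureReal_mono fun x hx => hx.2)
        (mul_le_of_le_one_right (abs_nonneg _) measureReal_le_one)

lemma tendsto_tvDist_gaussianReal_truncNormal {a b : ℝ} (ha : 0 < a) (hb : 0 < b) :
    Tendsto (fun t : ℝ => tvDist (gaussianReal (a * t) (b * t).toNNReal)
      (truncNormal (a * t) (b * t))) atTop (𝓝 0) := by
  have hf := tendsto_truncFactor ha hb
  have hbound : Tendsto (fun t : ℝ => ENNReal.ofReal
      ((gaussianReal (a * t) (b * t).toNNReal).real (Iic 0) +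
        |truncFactor (a * t) (b * t) - 1|)) atTop (𝓝 0) := by
    simpa using ENNReal.tendsto_ofReal
      ((tendsto_gaussianReal_Iic_zero ha hb).add (hf.sub_const 1).abs)
  refine tendsto_of_tendsto_of_tendsto_of_le_of_le' tendsto_const_nhds hbound
    (.of_forall fun _ => zero_le) ?_
  filter_upwards [eventually_gt_atTop 0, hf.eventually_const_le zero_lt_one] with t ht hft
  rw [truncNormal_eq_smul_restrict (mul_pos hb ht) hft]
  refine (tvDist_smul_restrict_le _ measurableSet_Ici hft).trans ?_
  gcongr
  · exact measure_ne_top _ _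
  · rw [compl_Ici]
    exact Iio_subset_Iic_self

/-! ### Mixtures of narrow normal laws -/

section Mixture

variable {X : Type*} [MeasurableSpace X] {μ : Measure X}

lemma tvDist_finsetSum_le {ι : Type*} (s : Finset ι) (μ ν : ι → Measure X)
    [∀ i, IsFiniteMeasure (μ i)] [∀ i, IsFiniteMeasure (ν i)] :
    tvDist (∑ i ∈ s, μ i) (∑ i ∈ s, ν i) ≤ ∑ i ∈ s, tvDist (μ i) (ν i) := by
  refine tvDist_le fun B hB => ?_
  simp only [measureReal_def, Measure.finsetSum_apply]
  rw [ENNReal.toReal_sum fun i _ => measure_ne_top (μ i) B,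
    ENNReal.toReal_sum fun i _ => measure_ne_top (ν i) B, edist_eq_enorm_sub,
    ← Finset.sum_sub_distrib]
  refine (enorm_sum_le _ _).trans (Finset.sum_le_sum fun i _ => ?_)
  rw [← edist_eq_enorm_sub]
  exact edist_real_le_tvDist _ _ hB

lemma sum_restrict_preimage_simpleFunc {β : Type*} (μ : Measure X) (u : SimpleFunc X β) :
    ∑ c ∈ u.range, μ.restrict (u ⁻¹' {c}) = μ := by
  ext A hA
  simp only [Measure.finsetSum_apply, Measure.restrict_apply' (u.measurableSet_fiber _)]
  rw [← measure_biUnion_finset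
    (fun c _ d _ hcd => ((disjoint_singleton.2 hcd).preimage u).mono inter_subset_right
      inter_subset_right)
    fun c _ => hA.inter (u.measurableSet_fiber c)]
  congr 1
  ext x
  simp

lemma bind_finsetSum {Y ι : Type*} [MeasurableSpace Y] (s : Finset ι) (μ : ι → Measure X)
    {κ : X → Measure Y} (hκ : Measurable κ) :
    (∑ i ∈ s, μ i).bind κ = ∑ i ∈ s, (μ i).bind κ := by
  ext B hB
  simp only [Measure.finsetSum_apply, Measure.bind_apply hB hκ.aemeasurable,
    lintegral_finsetSum_measure]

lemma isFiniteMeasure_bind {Y : Type*} [MeasurableSpace Y] [IsFiniteMeasure μ]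
    {κ : X → Measure Y} (hκ : Measurable κ) [∀ x, IsProbabilityMeasure (κ x)] :
    IsFiniteMeasure (μ.bind κ) :=
  ⟨by simp [Measure.bind_apply .univ hκ.aemeasurable]⟩

lemma gaussianReal_conv_map_eq_bind [SFinite μ] {G : X → ℝ} (hG : Measurable G) (v : ℝ≥0) :
    gaussianReal 0 v ∗ μ.map G = μ.bind fun x => gaussianReal (G x) v := by
  have hmeas := measurable_map_add_left (gaussianReal 0 v)
  rw [Measure.conv_comm, conv_eq_bind]
  ext B hB
  rw [Measure.bind_apply hB hmeas.aemeasurable,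
    lintegral_map (Measure.measurable_measure.1 hmeas B hB) hG,
    Measure.bind_apply hB (by fun_prop)]
  simp only [gaussianReal_map_const_add, zero_add]

lemma tendsto_tvDist_gaussianReal_conv_self {ν : Measure ℝ} [IsFiniteMeasure ν]
    (hν : ν ≪ volume) :
    Tendsto (fun v : ℝ≥0 => tvDist ν (gaussianReal 0 v ∗ ν)) (𝓝 0) (𝓝 0) := by
  have tvDist_le (v : ℝ≥0) : tvDist ν (gaussianReal 0 v ∗ ν) ≤
      ∫⁻ z, tvDist ν (ν.map (√v * z + ·)) ∂gaussianReal 0 1 := by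
    calc _ ≤ ∫⁻ y, tvDist ν (ν.map (y + ·)) ∂(gaussianReal 0 1).map (√v * ·) := by
          rw [gaussianReal_map_sqrt_mul, mul_zero, mul_one]
          exact tvDist_conv_self_le _ ν
      _ ≤ _ := lintegral_map_le _ _
  refine tendsto_of_tendsto_of_tendsto_of_le_of_le tendsto_const_nhds
    (tendsto_lintegral_zero_of_le (bound := fun _ => ENNReal.ofReal (ν.real univ))
      (fun v z => tvDist_le_ofReal le_rfl ?_) (by simp) (.of_forall fun z => ?_))
    (fun _ => zero_le) tvDist_le
  · rw [map_measureReal_apply (by fun_prop) .univ, preimage_univ]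
  · have : Continuous fun v : ℝ≥0 => √v * z := by fun_prop
    exact (tendsto_tvDist_map_add hν).comp (by simpa using this.tendsto 0)

variable [IsFiniteMeasure μ] {G : X → ℝ}

lemma tendsto_tvDist_bind_gaussianReal_simpleFunc (hG : Measurable G) (hac : μ.map G ≪ volume)
    (u : SimpleFunc X ℝ≥0) :
    Tendsto (fun ε : ℝ≥0 => tvDist (μ.map G) (μ.bind fun x => gaussianReal (G x) (ε * u x)))
      (𝓝 0) (𝓝 0) := by
  let piece (c : ℝ≥0) : Measure X := μ.restrict (u ⁻¹' {c})
  have map_eq_sum : μ.map G = ∑ c ∈ u.range, (piece c).map G := by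
    conv_lhs => rw [← sum_restrict_preimage_simpleFunc μ u]
    simp only [← Measure.bind_dirac_eq_map _ hG]
    exact bind_finsetSum _ _ (Measure.measurable_dirac.comp hG)
  have bind_eq_sum (ε : ℝ≥0) : (μ.bind fun x => gaussianReal (G x) (ε * u x)) =
      ∑ c ∈ u.range, gaussianReal 0 (ε * c) ∗ (piece c).map G := by
    conv_lhs => rw [← sum_restrict_preimage_simpleFunc μ u]
    rw [bind_finsetSum _ _ (by fun_prop)]
    refine Finset.sum_congr rfl fun c _ => ?_
    rw [gaussianReal_conv_map_eq_bind hG]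
    refine Measure.bind_congr_right ?_
    filter_upwards [ae_restrict_mem (u.measurableSet_fiber c)] with x hx
    rw [show u x = c from hx]
  have piece_ac (c : ℝ≥0) : (piece c).map G ≪ volume :=
    (Measure.absolutelyContinuous_of_le (Measure.map_mono Measure.restrict_le_self hG)).trans hac
  have sum_tendsto : Tendsto (fun ε : ℝ≥0 => ∑ c ∈ u.range,
      tvDist ((piece c).map G) (gaussianReal 0 (ε * c) ∗ (piece c).map G)) (𝓝 0) (𝓝 0) := by
    have hmul (c : ℝ≥0) : Tendsto (· * c) (𝓝 0) (𝓝 0) := by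
      simpa only [zero_mul] using (continuous_mul_const c).tendsto 0
    simpa only [Finset.sum_const_zero, Function.comp_apply] using
      tendsto_finsetSum u.range fun c _ =>
        (tendsto_tvDist_gaussianReal_conv_self (piece_ac c)).comp (hmul c)
  refine tendsto_of_tendsto_of_tendsto_of_le_of_le tendsto_const_nhds sum_tendsto
    (fun _ => zero_le) fun ε => ?_
  simp only [map_eq_sum, bind_eq_sum]
  exact tvDist_finsetSum_le _ _ _

lemma tendsto_tvDist_bind_gaussianReal (hG : Measurable G) (hac : μ.map G ≪ volume)
    {v : X → ℝ≥0} (hv : Measurable v) (hv0 : ∀ᵐ x ∂μ, v x ≠ 0) :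
    Tendsto (fun ε : ℝ≥0 => tvDist (μ.map G) (μ.bind fun x => gaussianReal (G x) (ε * v x)))
      (𝓝 0) (𝓝 0) := by
  let u : ℕ → SimpleFunc X ℝ≥0 := hv.stronglyMeasurable.approx
  have approx_error : Tendsto (fun n => ∫⁻ x, tvDist (gaussianReal 0 (v x))
      (gaussianReal 0 (u n x)) ∂μ) atTop (𝓝 0) :=
    tendsto_lintegral_zero_of_le (bound := 1) (fun n x => tvDist_le_one _ _) (by simp)
      (hv0.mono fun x hx => tendsto_tvDist_gaussianReal_var hx
        (hv.stronglyMeasurable.tendsto_approx x) 0)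
  have tvDist_gaussianReal_le (ε : ℝ≥0) (m : ℝ) (a b : ℝ≥0) :
      tvDist (gaussianReal m (ε * a)) (gaussianReal m (ε * b)) ≤
        tvDist (gaussianReal 0 a) (gaussianReal 0 b) := by
    have rescale (c : ℝ≥0) : gaussianReal m (ε * c) =
        ((gaussianReal 0 c).map (√ε * ·)).map (m + ·) := by
      rw [gaussianReal_map_sqrt_mul, gaussianReal_map_const_add, mul_zero, zero_add]
    rw [rescale, rescale]
    exact (tvDist_map_le _ _ (measurable_const_add m)).trans
      (tvDist_map_le _ _ (measurable_const_mul _))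
  refine ENNReal.tendsto_nhds_zero.2 fun δ hδ => ?_
  obtain ⟨n, hn⟩ := (approx_error.eventually_le_const (ENNReal.half_pos hδ.ne')).exists
  filter_upwards [(tendsto_tvDist_bind_gaussianReal_simpleFunc hG hac (u n)).eventually_le_const
    (ENNReal.half_pos hδ.ne')] with ε hε
  have hv_meas : Measurable fun x => gaussianReal (G x) (ε * v x) := by fun_prop
  have hu_meas : Measurable fun x => gaussianReal (G x) (ε * u n x) := by fun_prop
  calc tvDist (μ.map G) (μ.bind fun x => gaussianReal (G x) (ε * v x))
      ≤ _ + tvDist (μ.bind fun x => gaussianReal (G x) (ε * v x))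
          (μ.bind fun x => gaussianReal (G x) (ε * u n x)) :=
        (tvDist_triangle _ _ _).trans_eq (congrArg _ (tvDist_comm _ _))
    _ ≤ δ / 2 + δ / 2 := by
        refine add_le_add hε (le_trans ?_ hn)
        have := isFiniteMeasure_bind (μ := μ) hv_meas
        have := isFiniteMeasure_bind (μ := μ) hu_meas
        exact (tvDist_bind_le hv_meas hu_meas).trans
          (lintegral_mono fun x => tvDist_gaussianReal_le _ _ _ _)
    _ = δ := ENNReal.add_halves δ

theorem tendsto_tvDist_bind_map {κ : ℝ → X → Measure ℝ} (hκ : ∀ t, Measurable (κ t))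
    [∀ t x, IsProbabilityMeasure (κ t x)] (hG : Measurable G) (hac : μ.map G ≪ volume)
    {v : X → ℝ≥0} (hv : Measurable v) (hv0 : ∀ᵐ x ∂μ, v x ≠ 0)
    (hlim : ∀ᵐ x ∂μ, Tendsto (fun t : ℝ => tvDist (κ t x)
      (gaussianReal (t * G x) (t.toNNReal * v x))) atTop (𝓝 0)) :
    Tendsto (fun t : ℝ => tvDist (μ.bind (κ t)) (μ.map fun x => t * G x)) atTop (𝓝 0) := by
  have inv_tendsto : Tendsto (fun t : ℝ => t.toNNReal⁻¹) atTop (𝓝 0) :=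
    tendsto_inv_atTop_zero.comp Real.tendsto_toNNReal_atTop
  have clt_error := tendsto_lintegral_zero_of_le (bound := 1) (fun t x => tvDist_le_one
    (κ t x) (gaussianReal (t * G x) (t.toNNReal * v x))) (by simp) hlim
  have noise_error := (tendsto_tvDist_bind_gaussianReal hG hac hv hv0).comp inv_tendsto
  refine tendsto_of_tendsto_of_tendsto_of_le_of_le' tendsto_const_nhds
    (by simpa only [add_zero] using clt_error.add noise_error) (.of_forall fun _ => zero_le) ?_
  filter_upwards [eventually_gt_atTop 0] with t ht
  have hgauss : Measurable fun x => gaussianReal (t * G x) (t.toNNReal * v x) := by fun_prop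
  have rescale_map : (μ.map fun x => t * G x) = (μ.map G).map (t * ·) :=
    (Measure.map_map (measurable_const_mul t) hG).symm
  have rescale_bind : (μ.bind fun x => gaussianReal (t * G x) (t.toNNReal * v x)) =
      (μ.bind fun x => gaussianReal (G x) (t.toNNReal⁻¹ * v x)).map (t * ·) := by
    ext B hB
    rw [Measure.map_apply (measurable_const_mul t) hB, Measure.bind_apply hB (by fun_prop),
      Measure.bind_apply (measurable_const_mul t hB) (by fun_prop)]
    refine lintegral_congr fun x => ?_
    rw [← Measure.map_apply (measurable_const_mul t) hB, gaussianReal_map_const_mul]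
    congr 2
    ext
    push_cast
    rw [Real.coe_toNNReal t ht.le]
    field_simp
  calc tvDist (μ.bind (κ t)) (μ.map fun x => t * G x)
      ≤ tvDist (μ.bind (κ t)) _ + tvDist _ _ := tvDist_triangle _
        (μ.bind fun x => gaussianReal (t * G x) (t.toNNReal * v x)) _
    _ ≤ _ := by
        have := isFiniteMeasure_bind (μ := μ) (hκ t)
        have := isFiniteMeasure_bind (μ := μ) hgauss
        refine add_le_add (tvDist_bind_le (hκ t) hgauss) ?_
        rw [rescale_map, rescale_bind, tvDist_comm]
        exact tvDist_map_le _ _ (measurable_const_mul t)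

end Mixture

/-! ### The area formula -/

section AreaFormula

lemma tsum_fiber_of_injOn {X Y : Type*} {s : Set X} {f : X → Y} (hf : InjOn f s) (w : X → ℝ≥0∞)
    {x : X} (hx : x ∈ s) : ∑' z : ↥(s ∩ f ⁻¹' {f x}), w z = w x := by
  have fiber_eq : s ∩ f ⁻¹' {f x} = {x} :=
    Subset.antisymm (fun z hz => hf hz.1 hx hz.2) (singleton_subset_iff.2 ⟨hx, rfl⟩)
  rw [fiber_eq, tsum_singleton]

lemma tsum_fiber_of_notMem {X Y : Type*} {s : Set X} {f : X → Y} (w : X → ℝ≥0∞) {y : Y}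
    (hy : y ∉ f '' s) : ∑' z : ↥(s ∩ f ⁻¹' {y}), w z = 0 := by
  have : IsEmpty ↥(s ∩ f ⁻¹' {y}) := ⟨fun z => hy ⟨z, z.2⟩⟩
  exact tsum_empty

lemma measurable_tsum_fiber_of_measurableEmbedding {X Y : Type*} [MeasurableSpace X]
    [MeasurableSpace Y] {s : Set X} {f : X → Y} (hf : MeasurableEmbedding (s.domRestrict f))
    {w : X → ℝ≥0∞} (hw : Measurable w) :
    Measurable fun y => ∑' x : ↥(s ∩ f ⁻¹' {y}), w x := by
  convert hf.measurable_extend (hw.comp measurable_subtype_coe) measurable_zero using 1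
  ext y
  by_cases hy : y ∈ f '' s
  · obtain ⟨x, hx, rfl⟩ := hy
    rw [tsum_fiber_of_injOn (injOn_iff_injective.2 hf.injective) w hx]
    exact (hf.injective.extend_apply (w ∘ Subtype.val) 0 (⟨x, hx⟩ : s)).symm
  · rw [tsum_fiber_of_notMem w hy, Function.extend_apply' _ _ _
      (by rintro ⟨⟨x, hx⟩, rfl⟩; exact hy ⟨x, hx, rfl⟩)]
    rfl

lemma tsum_fiber_iUnion {ι X Y : Type*} {s : ι → Set X} (hs : Pairwise (Function.onFun Disjoint s))
    (f : X → Y) (w : X → ℝ≥0∞) (y : Y) :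
    ∑' x : ↥((⋃ i, s i) ∩ f ⁻¹' {y}), w x = ∑' i, ∑' x : ↥(s i ∩ f ⁻¹' {y}), w x := by
  rw [iUnion_inter]
  exact ENNReal.tsum_biUnion fun i _ j _ hij =>
    (hs hij).mono inter_subset_left inter_subset_left

variable {E : Type*} [NormedAddCommGroup E] [NormedSpace ℝ E] [FiniteDimensional ℝ E]
  {s : Set E} {f : E → E} {f' : E → E →L[ℝ] E} {w : E → ℝ≥0∞}

lemma exists_approximatesLinearOn_injOn (A : E →L[ℝ] E) :
    ∃ δ : ℝ≥0, δ ≠ 0 ∧ (A.det ≠ 0 → ∀ (f : E → E) (s : Set E),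
      ApproximatesLinearOn f A s δ → InjOn f s) := by
  by_cases hA : A.det = 0
  · exact ⟨1, one_ne_zero, fun h => absurd hA h⟩
  let B := A.toContinuousLinearEquivOfDetNeZero hA
  rcases B.subsingleton_or_nnnorm_symm_pos with hE | hB
  · exact ⟨1, one_ne_zero, fun _ _ _ _ => injOn_of_injective (Function.injective_of_subsingleton _)⟩
  · have hδ : 0 < ‖(B.symm : E →L[ℝ] E)‖₊⁻¹ / 2 := half_pos (inv_pos.2 hB)
    exact ⟨_, hδ.ne', fun _ f s (hf : ApproximatesLinearOn f (B : E →L[ℝ] E) s _) =>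
      hf.injOn (.inr (half_lt_self (inv_pos.2 hB)))⟩

lemma exists_partition_injOn (hf' : ∀ x ∈ s, HasFDerivWithinAt f (f' x) s x)
    (hdet : ∀ x ∈ s, (f' x).det ≠ 0) [MeasurableSpace E] [BorelSpace E] :
    ∃ t : ℕ → Set E, Pairwise (Function.onFun Disjoint t) ∧ (∀ n, MeasurableSet (t n)) ∧
      (s ⊆ ⋃ n, t n) ∧ ∀ n, InjOn f (s ∩ t n) := by
  choose δ hδ hinj using exists_approximatesLinearOn_injOn (E := E)
  obtain ⟨t, A, hdisj, hmeas, hcover, happrox, hA⟩ :=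
    exists_partition_approximatesLinearOn_of_hasFDerivWithinAt f s f' hf' δ hδ
  refine ⟨t, hdisj, hmeas, hcover, fun n x hx => ?_⟩
  obtain ⟨y, hy, hAy⟩ := hA ⟨x, hx.1⟩ n
  exact hinj (A n) (hAy ▸ hdet y hy) f _ (happrox n) hx

variable [MeasurableSpace E] [BorelSpace E] {μ : Measure E} [μ.IsAddHaarMeasure]

lemma aemeasurable_tsum_fiber_of_injOn (hs : MeasurableSet s)
    (hf' : ∀ x ∈ s, HasFDerivWithinAt f (f' x) s x) (hinj : InjOn f s)
    (hw : AEMeasurable w (μ.restrict s)) :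
    AEMeasurable (fun y => ∑' x : ↥(s ∩ f ⁻¹' {y}), w x) μ := by
  let N := {x ∈ s | w x ≠ hw.mk w x}
  have image_null : μ (f '' N) = 0 := by
    refine addHaar_image_eq_zero_of_differentiableOn_of_addHaar_eq_zero μ
      (fun x hx => ((hf' x hx.1).mono inter_subset_left).differentiableWithinAt) ?_
    have := (ae_restrict_iff' hs).1 hw.ae_eq_mk
    simpa [N, ae_iff] using this
  refine ⟨_, measurable_tsum_fiber_of_measurableEmbedding
    (measurableEmbedding_of_fderivWithin hs hf' hinj) hw.measurable_mk, ?_⟩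
  filter_upwards [measure_eq_zero_iff_ae_notMem.1 image_null] with y hy
  exact tsum_congr fun x => by_contra fun hne => hy ⟨x, ⟨x.2.1, hne⟩, x.2.2⟩

lemma lintegral_tsum_fiber_of_injOn (hs : MeasurableSet s)
    (hf' : ∀ x ∈ s, HasFDerivWithinAt f (f' x) s x) (hinj : InjOn f s) :
    ∫⁻ y, ∑' x : ↥(s ∩ f ⁻¹' {y}), w x ∂μ =
      ∫⁻ x in s, ENNReal.ofReal |(f' x).det| * w x ∂μ := by
  calc ∫⁻ y, ∑' x : ↥(s ∩ f ⁻¹' {y}), w x ∂μ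
      = ∫⁻ y in f '' s, ∑' x : ↥(s ∩ f ⁻¹' {y}), w x ∂μ := by
        rw [← lintegral_indicator (measurable_image_of_fderivWithin hs hf' hinj)]
        rw [indicator_eq_self.2 fun y hy => by_contra fun h => hy (tsum_fiber_of_notMem w h)]
    _ = ∫⁻ x in s, ENNReal.ofReal |(f' x).det| * ∑' z : ↥(s ∩ f ⁻¹' {f x}), w z ∂μ :=
        lintegral_image_eq_lintegral_abs_det_fderiv_mul μ hs hf' hinj _
    _ = _ := setLIntegral_congr_fun hs fun x hx => by rw [tsum_fiber_of_injOn hinj w hx]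

theorem lintegral_tsum_fiber (hs : MeasurableSet s)
    (hf' : ∀ x ∈ s, HasFDerivWithinAt f (f' x) s x) (hdet : ∀ x ∈ s, (f' x).det ≠ 0)
    (hw : AEMeasurable w (μ.restrict s)) :
    ∫⁻ y, ∑' x : ↥(s ∩ f ⁻¹' {y}), w x ∂μ =
      ∫⁻ x in s, ENNReal.ofReal |(f' x).det| * w x ∂μ := by
  obtain ⟨t, hdisj, hmeas, hcover, hinj⟩ := exists_partition_injOn hf' hdet
  have pieces_meas (n : ℕ) : MeasurableSet (s ∩ t n) := hs.inter (hmeas n)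
  have pieces_disj : Pairwise (Function.onFun Disjoint fun n => s ∩ t n) := fun i j hij =>
    (hdisj hij).mono inter_subset_right inter_subset_right
  have pieces_deriv (n : ℕ) : ∀ x ∈ s ∩ t n, HasFDerivWithinAt f (f' x) (s ∩ t n) x :=
    fun x hx => (hf' x hx.1).mono inter_subset_left
  have iUnion_pieces : ⋃ n, s ∩ t n = s := by rw [← inter_iUnion, inter_eq_left.2 hcover]
  have tsum_fiber_eq (y : E) : ∑' x : ↥(s ∩ f ⁻¹' {y}), w x =
      ∑' n, ∑' x : ↥(s ∩ t n ∩ f ⁻¹' {y}), w x := by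
    rw [← tsum_fiber_iUnion pieces_disj, iUnion_pieces]
  simp_rw [tsum_fiber_eq]
  rw [lintegral_tsum fun n => aemeasurable_tsum_fiber_of_injOn (pieces_meas n) (pieces_deriv n)
    (hinj n) (hw.mono_set inter_subset_left)]
  conv_rhs => rw [← iUnion_pieces, lintegral_iUnion pieces_meas pieces_disj]
  exact tsum_congr fun n => lintegral_tsum_fiber_of_injOn (pieces_meas n) (pieces_deriv n) (hinj n)

theorem map_withDensity_eq_withDensity_tsum_fiber (hs : MeasurableSet s) (hf : Measurable f)
    (hf' : ∀ x ∈ s, HasFDerivWithinAt f (f' x) s x) (hdet : ∀ x ∈ s, (f' x).det ≠ 0)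
    {ρ : E → ℝ≥0∞} (hρ : AEMeasurable ρ (μ.restrict s)) :
    ((μ.restrict s).withDensity ρ).map f =
      μ.withDensity fun y => ∑' x : ↥(s ∩ f ⁻¹' {y}), (ENNReal.ofReal |(f' x).det|)⁻¹ * ρ x := by
  ext B hB
  let w : E → ℝ≥0∞ := fun x => (ENNReal.ofReal |(f' x).det|)⁻¹ * ρ x
  have hw : AEMeasurable ((f ⁻¹' B).indicator w) (μ.restrict s) := by
    have := aemeasurable_ofReal_abs_det_fderivWithin μ hs hf'
    exact (this.inv.mul hρ).indicator (hf hB)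
  calc ((μ.restrict s).withDensity ρ).map f B
      = ∫⁻ x in s, (f ⁻¹' B).indicator ρ x ∂μ := by
        rw [Measure.map_apply hf hB, withDensity_apply _ (hf hB), lintegral_indicator (hf hB)]
    _ = ∫⁻ x in s, ENNReal.ofReal |(f' x).det| * (f ⁻¹' B).indicator w x ∂μ := by
        refine setLIntegral_congr_fun hs fun x hx => ?_
        by_cases hxB : x ∈ f ⁻¹' B
        · simp only [indicator_of_mem hxB, w]
          rw [← mul_assoc, ENNReal.mul_inv_cancel
            (ENNReal.ofReal_pos.2 (abs_pos.2 (hdet x hx))).ne' ENNReal.ofReal_ne_top, one_mul]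
        · simp only [indicator_of_notMem hxB, mul_zero]
    _ = ∫⁻ y, ∑' x : ↥(s ∩ f ⁻¹' {y}), (f ⁻¹' B).indicator w x ∂μ :=
        (lintegral_tsum_fiber hs hf' hdet hw).symm
    _ = ∫⁻ y, B.indicator (fun y => ∑' x : ↥(s ∩ f ⁻¹' {y}), w x) y ∂μ := by
        refine lintegral_congr fun y => ?_
        have fiber_mem (x : ↥(s ∩ f ⁻¹' {y})) : (x : E) ∈ f ⁻¹' B ↔ y ∈ B := by
          rw [mem_preimage, show f x = y from x.2.2]
        by_cases hy : y ∈ B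
        · rw [indicator_of_mem hy]
          exact tsum_congr fun x => indicator_of_mem ((fiber_mem x).2 hy) w
        · rw [indicator_of_notMem hy]
          exact ENNReal.tsum_eq_zero.2 fun x => indicator_of_notMem (mt (fiber_mem x).1 hy) w
    _ = _ := by rw [lintegral_indicator hB, withDensity_apply _ hB]

end AreaFormula

/-! ### Visit distributions of a trip mobility network -/

namespace Model

variable (M : Model)

instance isProbabilityMeasure_μx : IsProbabilityMeasure M.μx :=
  ⟨by rw [μx, withDensity_apply _ .univ, Measure.restrict_univ, M.lintegral_ρ]⟩

lemma ae_mem_Ωx : ∀ᵐ x ∂M.μx, x ∈ M.Ωx :=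
  (withDensity_absolutelyContinuous _ _).ae_le (ae_restrict_mem M.measurableSet_Ωx)

lemma lintegral_μx {f : ℝ → ℝ≥0∞} (hf : Measurable f) :
    ∫⁻ x, f x ∂M.μx = ∫⁻ x in M.Ωx, f x * M.ρ x := by
  rw [μx, lintegral_withDensity_eq_lintegral_mul _ M.measurable_ρ.coe_nnreal_ennreal hf]
  exact lintegral_congr fun x => mul_comm _ _

lemma measurable_K_right (x : ℝ) : Measurable (M.K x) :=
  M.measurable_K.comp measurable_prodMk_left

lemma measurable_weightPDF_right (x : ℝ) : Measurable (M.weightPDF x) :=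
  M.measurable_weightPDF.comp measurable_prodMk_left

lemma arrivalIntensity_univ (x : ℝ) :
    M.arrivalIntensity x univ = ∫⁻ y in M.Ωy, (M.K x y : ℝ≥0∞) * M.φ y := by
  rw [arrivalIntensity, withDensity_apply _ .univ, Measure.restrict_univ, μy,
    lintegral_withDensity_eq_lintegral_mul _ M.measurable_φ.coe_nnreal_ennreal
      (M.measurable_K_right x).coe_nnreal_ennreal]
  exact lintegral_congr fun y => mul_comm (M.φ y : ℝ≥0∞) _

lemma isFiniteMeasure_arrivalIntensity {x : ℝ} (hx : x ∈ M.Ωx) :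
    IsFiniteMeasure (M.arrivalIntensity x) :=
  ⟨by rw [arrivalIntensity_univ]; exact M.lintegral_K_lt_top x hx⟩

lemma rate_nonneg (x : ℝ) : 0 ≤ M.rate x := measureReal_nonneg

lemma rate_eq_toReal_lintegral (x : ℝ) :
    M.rate x = (∫⁻ y in M.Ωy, (M.K x y : ℝ≥0∞) * M.φ y).toReal := by
  rw [rate, measureReal_def, arrivalIntensity_univ]

lemma rate_eq (x : ℝ) : M.rate x = ∫ y in M.Ωy, (M.K x y : ℝ) * M.φ y := by
  simp_rw [rate_eq_toReal_lintegral, ← ENNReal.coe_mul, ← NNReal.coe_mul]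
  have hKφ := ((M.measurable_K_right x).mul M.measurable_φ).coe_nnreal_ennreal
  exact (integral_toReal hKφ.aemeasurable (.of_forall fun _ => ENNReal.coe_lt_top)).symm

lemma measurable_rate : Measurable M.rate := by
  rw [funext M.rate_eq_toReal_lintegral]
  exact (Measurable.lintegral_prod_right (M.measurable_K.coe_nnreal_ennreal.mul
    (M.measurable_φ.comp measurable_snd).coe_nnreal_ennreal)).ennreal_toReal

lemma measurable_weightMoment (n : ℕ) : Measurable (M.weightMoment n) :=
  (StronglyMeasurable.integral_prod_right ((measurable_snd.pow_const n).mul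
    M.measurable_weightPDF.coe_nnreal_real).stronglyMeasurable).measurable

lemma isProbabilityMeasure_weightLaw {x : ℝ} (hx : x ∈ M.Ωx) :
    IsProbabilityMeasure (M.weightLaw x) :=
  ⟨by rw [weightLaw, withDensity_apply _ .univ, Measure.restrict_univ, M.lintegral_weightPDF x hx]⟩

lemma weightLaw_absolutelyContinuous (x : ℝ) : M.weightLaw x ≪ volume :=
  jumpLaw_absolutelyContinuous (M.weightPDF x)

lemma weightMoment_eq_integral (n : ℕ) (x : ℝ) :
    M.weightMoment n x = ∫ r, r ^ n ∂M.weightLaw x := by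
  rw [weightLaw, integral_withDensity_eq_integral_smul (M.measurable_weightPDF_right x)]
  exact integral_congr_ae (.of_forall fun r => mul_comm _ _)

lemma finiteSecondMoment_iff_memLp {x : ℝ} :
    M.FiniteSecondMoment x ↔ MemLp id 2 (M.weightLaw x) := by
  rw [memLp_two_iff_integrable_sq aestronglyMeasurable_id, weightLaw,
    integrable_withDensity_iff_integrable_smul (M.measurable_weightPDF_right x)]
  exact integrable_congr (.of_forall fun r => mul_comm _ _)

lemma weightMoment_pos {x : ℝ} (hx : x ∈ M.Ωx) {n : ℕ}
    (hn : Integrable (fun r : ℝ => r ^ n) (M.weightLaw x)) : 0 < M.weightMoment n x := by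
  have := M.isProbabilityMeasure_weightLaw hx
  have weight_pos : ∀ᵐ r ∂M.weightLaw x, 0 < r :=
    (withDensity_absolutelyContinuous _ _).ae_le (ae_restrict_mem measurableSet_Ioi)
  have support_ae : (Function.support fun r : ℝ => r ^ n) =ᵐ[M.weightLaw x] univ :=
    eventuallyEq_univ.2 (weight_pos.mono fun r hr => (pow_pos hr n).ne')
  rw [weightMoment_eq_integral, integral_pos_iff_support_of_nonneg_ae
    (weight_pos.mono fun r hr => (pow_pos hr n).le) hn, measure_congr support_ae, measure_univ]
  exact one_pos

lemma weightMoment_one_pos {x : ℝ} (hx : x ∈ M.Ωx) (h2 : M.FiniteSecondMoment x) :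
    0 < M.weightMoment 1 x := by
  have := M.isProbabilityMeasure_weightLaw hx
  refine M.weightMoment_pos hx ?_
  simp only [pow_one]
  exact (M.finiteSecondMoment_iff_memLp.1 h2).integrable one_le_two

lemma weightMoment_two_pos {x : ℝ} (hx : x ∈ M.Ωx) (h2 : M.FiniteSecondMoment x) :
    0 < M.weightMoment 2 x :=
  M.weightMoment_pos hx (M.finiteSecondMoment_iff_memLp.1 h2).integrable_sq

/-- The mean growth rate `ν_x ⟨r⟩_x` of the strength of a location of attractiveness `x`. -/
def growthRate (x : ℝ) : ℝ := M.rate x * M.weightMoment 1 x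

lemma measurable_growthRate : Measurable M.growthRate :=
  M.measurable_rate.mul (M.measurable_weightMoment 1)

lemma derivWithin_z (κ t x : ℝ) :
    derivWithin (M.z κ t) M.Ωx x = -(t * derivWithin M.growthRate M.Ωx x) := by
  have z_eq : M.z κ t = fun x => κ - t * M.growthRate x := by
    ext x
    rw [z, growthRate, mul_comm t]
  rw [z_eq, derivWithin_const_sub, derivWithin_const_mul_field]

lemma rootSum_eq_tsum_fiber (κ t : ℝ) :
    M.rootSum κ t = ∑' x : ↥(M.Ωx ∩ (fun x => t * M.growthRate x) ⁻¹' {κ}),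
      ENNReal.ofReal (|t * derivWithin M.growthRate M.Ωx x|⁻¹ * M.ρ x) := by
  have zeros_eq : {x | x ∈ M.Ωx ∧ M.z κ t x = 0} =
      M.Ωx ∩ (fun x => t * M.growthRate x) ⁻¹' {κ} := by
    ext x
    simp only [mem_ofPred_eq, mem_inter_iff, mem_preimage, mem_singleton_iff, z, growthRate,
      sub_eq_zero, mul_comm t, eq_comm (a := κ)]
  rw [← zeros_eq, rootSum]
  simp_rw [derivWithin_z, abs_neg]
  rfl

theorem withDensity_rootSum {t : ℝ} (ht : t ≠ 0)
    (hg : ∀ x ∈ M.Ωx, derivWithin M.growthRate M.Ωx x ≠ 0) :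
    volume.withDensity (fun κ => M.rootSum κ t) = M.μx.map fun x => t * M.growthRate x := by
  let g' : ℝ → ℝ := fun x => t * derivWithin M.growthRate M.Ωx x
  have hasDerivWithinAt (x : ℝ) (hx : x ∈ M.Ωx) :
      HasDerivWithinAt (fun x => t * M.growthRate x) (g' x) M.Ωx x :=
    (differentiableWithinAt_of_derivWithin_ne_zero (hg x hx)).hasDerivWithinAt.const_mul t
  have g'_ne_zero (x : ℝ) (hx : x ∈ M.Ωx) : g' x ≠ 0 := mul_ne_zero ht (hg x hx)
  rw [μx, map_withDensity_eq_withDensity_tsum_fiber M.measurableSet_Ωx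
    (M.measurable_growthRate.const_mul t) (fun x hx => (hasDerivWithinAt x hx).hasFDerivWithinAt)
    (fun x hx => by simpa using g'_ne_zero x hx) M.measurable_ρ.coe_nnreal_ennreal.aemeasurable]
  congr 1
  ext κ
  rw [rootSum_eq_tsum_fiber]
  refine tsum_congr fun x => ?_
  have abs_pos : 0 < |g' x| := abs_pos.2 (g'_ne_zero x x.2.1)
  rw [ENNReal.ofReal_mul (by positivity), ENNReal.ofReal_coe_nnreal,
    ENNReal.ofReal_inv_of_pos abs_pos]
  simp [g']

end Model

namespace Network

variable {M : Model} {Ω : Type*} [MeasurableSpace Ω] {P : Measure Ω} (N : Network M P)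

lemma isProbabilityMeasure_condVisit (x t : ℝ) : IsProbabilityMeasure (N.condVisit x t) := by
  have := N.isMarkov
  exact Measure.isProbabilityMeasure_map (measurable_strength t).aemeasurable

lemma measurable_condVisit (t : ℝ) : Measurable fun x => N.condVisit x t :=
  (Measure.measurable_map _ (measurable_strength t)).comp N.classLaw.measurable

lemma condVisit_eq_compoundPoisson {x t : ℝ} (hx : x ∈ M.Ωx) (ht : 0 ≤ t) :
    N.condVisit x t = compoundPoisson (M.rate x * t).toNNReal (M.weightLaw x) := by
  have := N.isMarkov
  have := M.isFiniteMeasure_arrivalIntensity hx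
  have := M.isProbabilityMeasure_weightLaw hx
  exact map_strength_eq_compoundPoisson (N.arrivals x hx) (N.weights x hx) ht

lemma condVisit_zero {x : ℝ} (hx : x ∈ M.Ωx) : N.condVisit x 0 = Measure.dirac 0 := by
  have := M.isProbabilityMeasure_weightLaw hx
  rw [N.condVisit_eq_compoundPoisson hx le_rfl, mul_zero, Real.toNNReal_zero, compoundPoisson_zero]

theorem tendsto_visits_jump {x t : ℝ} (hx : x ∈ M.Ωx) (ht : 0 ≤ t) (k : ℕ) :
    Tendsto (fun h : ℝ => (N.classLaw x).real {τ | visits t τ = k ∧ visits (t + h) τ = k + 1} / h)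
      (𝓝[>] 0) (𝓝 (M.rate x * (N.classLaw x).real {τ | visits t τ = k})) := by
  have := N.isMarkov
  have := M.isFiniteMeasure_arrivalIntensity hx
  exact (N.arrivals x hx).tendsto_visits_jump ht k

theorem masterEquation_condVisit {x : ℝ} (hx : x ∈ M.Ωx) :
    MasterEquation (M.rate x) (M.weightPDF x) (N.condVisit x) := by
  have : IsProbabilityMeasure (jumpLaw (M.weightPDF x)) := M.isProbabilityMeasure_weightLaw hx
  have condVisit_eq (t : ℝ) (ht : 0 ≤ t) : N.condVisit x t =
      compoundPoisson (M.rate x * t).toNNReal (jumpLaw (M.weightPDF x)) :=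
    N.condVisit_eq_compoundPoisson hx ht
  intro B hB t ht
  rw [condVisit_eq t ht]
  exact (masterEquation_compoundPoisson (M.measurable_weightPDF_right x) (M.rate_nonneg x)
    B hB t ht).congr (fun s hs => by rw [condVisit_eq s hs]) (by rw [condVisit_eq t ht])

theorem eq_condVisit_of_masterEquation {x : ℝ} (hx : x ∈ M.Ωx) {p : ℝ → Measure ℝ}
    (hpf : ∀ t, 0 ≤ t → IsFiniteMeasure (p t)) (h0 : p 0 = Measure.dirac 0)
    (hp : MasterEquation (M.rate x) (M.weightPDF x) p) {t : ℝ} (ht : 0 ≤ t) :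
    p t = N.condVisit x t := by
  have : IsProbabilityMeasure (jumpLaw (M.weightPDF x)) := M.isProbabilityMeasure_weightLaw hx
  have := N.isProbabilityMeasure_condVisit x
  exact MasterEquation.unique (M.measurable_weightPDF_right x) (M.rate_nonneg x) hpf
    (fun _ _ => inferInstance) (h0.trans (N.condVisit_zero hx).symm) hp
    (N.masterEquation_condVisit hx) ht

theorem exists_density_condVisit {x : ℝ} (hx : x ∈ M.Ωx) :
    ∃ q : ℝ → ℝ → ℝ, Measurable (Function.uncurry q) ∧ (∀ κ t, 0 ≤ q κ t) ∧
      (∀ t, 0 ≤ t → N.condVisit x t =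
        ENNReal.ofReal (Real.exp (-(M.rate x * t))) • Measure.dirac 0 +
          (volume.restrict (Ioi 0)).withDensity (fun κ => ENNReal.ofReal (q κ t))) ∧
      ∀ᵐ κ ∂(volume.restrict (Ioi (0 : ℝ))), ∀ t, 0 ≤ t →
        IntervalIntegrable (fun r => M.weightPDF x r * q (κ - r) t) volume 0 κ ∧
        HasDerivWithinAt (fun s => q κ s)
          (M.rate x * ((∫ r in (0 : ℝ)..κ, M.weightPDF x r * q (κ - r) t) +
            M.weightPDF x κ * Real.exp (-(M.rate x * t))) - M.rate x * q κ t) (Ici 0) t := by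
  have : IsProbabilityMeasure (jumpLaw (M.weightPDF x)) := M.isProbabilityMeasure_weightLaw hx
  obtain ⟨q, hq_meas, hq_nonneg, hq_density, hq_deriv⟩ :=
    exists_density_compoundPoisson (M.measurable_weightPDF_right x) (M.rate_nonneg x)
  exact ⟨q, hq_meas, hq_nonneg, fun t ht =>
    (N.condVisit_eq_compoundPoisson hx ht).trans (hq_density t ht), hq_deriv⟩

theorem tendsto_tvDist_condVisit_gaussianReal {x : ℝ} (hx : x ∈ M.Ωx) (hν : 0 < M.rate x)
    (h2 : M.FiniteSecondMoment x) :
    Tendsto (fun t : ℝ => tvDist (N.condVisit x t) (gaussianReal (t * M.growthRate x)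
      (t.toNNReal * (M.rate x * M.weightMoment 2 x).toNNReal))) atTop (𝓝 0) := by
  have := M.isProbabilityMeasure_weightLaw hx
  have second_moment_pos := M.weightMoment_two_pos hx h2
  have mean_eq : ∫ r, r ∂M.weightLaw x = M.weightMoment 1 x := by
    simp only [M.weightMoment_eq_integral, pow_one]
  have clt := tendsto_tvDist_compoundPoisson_gaussianReal (M.weightLaw_absolutelyContinuous x)
    (M.finiteSecondMoment_iff_memLp.1 h2) (v := (M.weightMoment 2 x).toNNReal)
    (by rw [Real.coe_toNNReal _ second_moment_pos.le, M.weightMoment_eq_integral])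
    (Real.toNNReal_pos.2 second_moment_pos).ne'
  have intensity_tendsto : Tendsto (fun t : ℝ => (M.rate x * t).toNNReal) atTop atTop :=
    tendsto_real_toNNReal_atTop.comp (tendsto_id.const_mul_atTop hν)
  refine (clt.comp intensity_tendsto).congr' ?_
  filter_upwards [eventually_ge_atTop 0] with t ht
  rw [Function.comp_apply, N.condVisit_eq_compoundPoisson hx ht, mean_eq,
    Real.coe_toNNReal _ (by positivity), Real.toNNReal_mul hν.le, Real.toNNReal_mul hν.le,
    Model.growthRate]
  congr 2 <;> ring

theorem asympEqTV_condVisit_truncNormal {x : ℝ} (hx : x ∈ M.Ωx) (hν : 0 < M.rate x)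
    (h2 : M.FiniteSecondMoment x) :
    AsympEqTV (N.condVisit x) fun t => truncNormal
      (M.rate x * M.weightMoment 1 x * t) (M.rate x * M.weightMoment 2 x * t) := by
  have mean_pos := mul_pos hν (M.weightMoment_one_pos hx h2)
  have variance_pos := mul_pos hν (M.weightMoment_two_pos hx h2)
  have sum_tendsto := (N.tendsto_tvDist_condVisit_gaussianReal hx hν h2).add
    (tendsto_tvDist_gaussianReal_truncNormal mean_pos variance_pos)
  rw [add_zero] at sum_tendsto
  refine asympEqTV_iff.2 (tendsto_of_tendsto_of_tendsto_of_le_of_le tendsto_const_nhds sum_tendsto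
    (fun _ => zero_le) fun t => ?_)
  simp only [Model.growthRate, mul_comm t, mul_comm t.toNNReal, ← Real.toNNReal_mul variance_pos.le]
  exact tvDist_triangle _ _ _

lemma map_strength_trips (i : ℕ) (t : ℝ) :
    P.map (fun ω => strength t (N.trips i ω)) = M.μx.bind fun x => N.condVisit x t := by
  have := N.isMarkov
  have hs := measurable_strength t
  have trips_law : P.map (N.trips i) = M.μx.bind N.classLaw := by
    rw [← Measure.snd_compProd, ← N.law i, Measure.snd_map_prodMk (N.measurable_X i)]
  calc P.map (fun ω => strength t (N.trips i ω)) = (P.map (N.trips i)).map (strength t) :=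
        (Measure.map_map hs (N.measurable_trips i)).symm
    _ = (M.μx.bind N.classLaw).map (strength t) := by rw [trips_law]
    _ = M.μx.bind fun x => N.condVisit x t := by
        rw [Measure.bind, Measure.bind, ← Measure.join_map_map hs,
          Measure.map_map (Measure.measurable_map _ hs) N.classLaw.measurable]
        rfl

lemma visitDistribution_eq_bind {n : ℕ} (hn : 0 < n) (t : ℝ) :
    N.visitDistribution n t = M.μx.bind fun x => N.condVisit x t := by
  rw [visitDistribution, Finset.sum_congr rfl fun i _ => N.map_strength_trips i t, Finset.sum_const,
    Finset.card_range, ← Nat.cast_smul_eq_nsmul ℝ≥0∞, smul_smul,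
    ENNReal.inv_mul_cancel (Nat.cast_ne_zero.2 hn.ne') (ENNReal.natCast_ne_top n), one_smul]

theorem visitDistribution_apply {n : ℕ} (hn : 0 < n) (t : ℝ) {B : Set ℝ} (hB : MeasurableSet B) :
    N.visitDistribution n t B = ∫⁻ x in M.Ωx, N.condVisit x t B * M.ρ x := by
  rw [N.visitDistribution_eq_bind hn, Measure.bind_apply hB (N.measurable_condVisit t).aemeasurable]
  exact M.lintegral_μx ((Measure.measurable_coe hB).comp (N.measurable_condVisit t))

theorem asympEqTV_visitDistribution (h2 : ∀ x ∈ M.Ωx, M.FiniteSecondMoment x)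
    (hg : ∀ x ∈ M.Ωx, derivWithin M.growthRate M.Ωx x ≠ 0) {n : ℕ} (hn : 0 < n) :
    AsympEqTV (N.visitDistribution n) fun t => volume.withDensity fun κ => M.rootSum κ t := by
  have growthRate_ac : M.μx.map M.growthRate ≪ volume := by
    have := M.withDensity_rootSum one_ne_zero hg
    simp only [one_mul] at this
    exact this ▸ withDensity_absolutelyContinuous _ _
  have rate_pos : ∀ᵐ x ∂M.μx, 0 < M.rate x := by
    have growthRate_ne_zero : ∀ᵐ x ∂M.μx, M.growthRate x ≠ 0 :=
      ae_of_ae_map M.measurable_growthRate.aemeasurable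
        (growthRate_ac.ae_le (measure_eq_zero_iff_ae_notMem.1 (measure_singleton 0)))
    filter_upwards [growthRate_ne_zero] with x hx
    exact (M.rate_nonneg x).lt_of_ne' (left_ne_zero_of_mul hx)
  have variance_ne_zero : ∀ᵐ x ∂M.μx, (M.rate x * M.weightMoment 2 x).toNNReal ≠ 0 := by
    filter_upwards [M.ae_mem_Ωx, rate_pos] with x hx hν
    exact (Real.toNNReal_pos.2 (mul_pos hν (M.weightMoment_two_pos hx (h2 x hx)))).ne'
  have := N.isProbabilityMeasure_condVisit
  have mixture_tendsto := tendsto_tvDist_bind_map (κ := fun t x => N.condVisit x t)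
    N.measurable_condVisit M.measurable_growthRate growthRate_ac
    (M.measurable_rate.mul (M.measurable_weightMoment 2)).real_toNNReal variance_ne_zero (by
      filter_upwards [M.ae_mem_Ωx, rate_pos] with x hx hν
      exact N.tendsto_tvDist_condVisit_gaussianReal hx hν (h2 x hx))
  refine asympEqTV_iff.2 (mixture_tendsto.congr' ?_)
  filter_upwards [eventually_gt_atTop 0] with t ht
  rw [N.visitDistribution_eq_bind hn, M.withDensity_rootSum ht.ne' hg]

end Network

end TripMobility

end

theorem proposition1_general (M : TripMobility.Model) {Ω : Type*} [MeasurableSpace Ω]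
    (P : Measure Ω) (N : TripMobility.Network M P) :
    (∀ x ∈ M.Ωx, M.rate x = ∫ y in M.Ωy, (M.K x y : ℝ) * M.φ y ∧
      ∀ (k : ℕ) (t : ℝ), 0 ≤ t → Tendsto
        (fun h : ℝ => (N.classLaw x).real
          {τ | TripMobility.visits t τ = k ∧ TripMobility.visits (t + h) τ = k + 1} / h)
        (𝓝[>] 0)
        (𝓝 (M.rate x * (N.classLaw x).real {τ | TripMobility.visits t τ = k}))) ∧
    (∀ x ∈ M.Ωx,
      (∀ t : ℝ, IsProbabilityMeasure (N.condVisit x t)) ∧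
      N.condVisit x 0 = Measure.dirac 0 ∧
      TripMobility.MasterEquation (M.rate x) (M.weightPDF x) (N.condVisit x) ∧
      (∀ p : ℝ → Measure ℝ, (∀ t, 0 ≤ t → IsFiniteMeasure (p t)) → p 0 = Measure.dirac 0 →
        TripMobility.MasterEquation (M.rate x) (M.weightPDF x) p →
        ∀ t, 0 ≤ t → p t = N.condVisit x t)) ∧
    (∀ x ∈ M.Ωx, ∃ q : ℝ → ℝ → ℝ, Measurable (Function.uncurry q) ∧ (∀ κ t, 0 ≤ q κ t) ∧
      (∀ t, 0 ≤ t → N.condVisit x t =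
        ENNReal.ofReal (Real.exp (-(M.rate x * t))) • Measure.dirac 0 +
          (volume.restrict (Ioi 0)).withDensity (fun κ => ENNReal.ofReal (q κ t))) ∧
      ∀ᵐ κ ∂(volume.restrict (Ioi (0 : ℝ))), ∀ t, 0 ≤ t →
        IntervalIntegrable (fun r => M.weightPDF x r * q (κ - r) t) volume 0 κ ∧
        HasDerivWithinAt (fun s => q κ s)
          (M.rate x * ((∫ r in (0 : ℝ)..κ, M.weightPDF x r * q (κ - r) t) +
            M.weightPDF x κ * Real.exp (-(M.rate x * t))) - M.rate x * q κ t) (Ici 0) t) ∧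
    (∀ x ∈ M.Ωx, 0 < M.rate x → M.FiniteSecondMoment x →
      TripMobility.AsympEqTV (N.condVisit x)
        (fun t => TripMobility.truncNormal
          (M.rate x * M.weightMoment 1 x * t) (M.rate x * M.weightMoment 2 x * t)) ∧
      Tendsto (fun t => TripMobility.truncFactor
          (M.rate x * M.weightMoment 1 x * t) (M.rate x * M.weightMoment 2 x * t))
        atTop (𝓝 1)) ∧
    (∀ n : ℕ, 0 < n → ∀ t : ℝ, 0 ≤ t → ∀ B : Set ℝ, MeasurableSet B →
      N.visitDistribution n t B = ∫⁻ x in M.Ωx, N.condVisit x t B * M.ρ x) ∧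
    ((∀ x ∈ M.Ωx, M.FiniteSecondMoment x) →
      (∀ κ t : ℝ, 0 < t → ∀ x ∈ M.Ωx, derivWithin (M.z κ t) M.Ωx x ≠ 0) →
      ∀ n : ℕ, 0 < n → TripMobility.AsympEqTV (N.visitDistribution n)
        (fun t => volume.withDensity (fun κ => M.rootSum κ t))) := by
  refine ⟨fun x hx => ⟨M.rate_eq x, fun k t ht => N.tendsto_visits_jump hx ht k⟩,
    fun x hx => ⟨N.isProbabilityMeasure_condVisit x, N.condVisit_zero hx,
      N.masterEquation_condVisit hx,
      fun p hp_fin hp_zero hp t ht => N.eq_condVisit_of_masterEquation hx hp_fin hp_zero hp ht⟩,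
    fun x hx => N.exists_density_condVisit hx,
    fun x hx hν h2 => ⟨N.asympEqTV_condVisit_truncNormal hx hν h2, TripMobility.tendsto_truncFactor
      (mul_pos hν (M.weightMoment_one_pos hx h2)) (mul_pos hν (M.weightMoment_two_pos hx h2))⟩,
    fun n hn t _ B hB => N.visitDistribution_apply hn t hB,
    fun h2 hz n hn => N.asympEqTV_visitDistribution h2 (fun x hx hg => ?_) hn⟩
  exact hz 0 1 one_pos x hx (by simp [M.derivWithin_z, hg])

theorem proposition1 (M : TripMobility.Model) {Ω : Type*} [MeasurableSpace Ω]
    (P : Measure Ω) [IsProbabilityMeasure P] (N : TripMobility.Network M P) :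
    -- the attraction rate, and its meaning as a transition rate of the number of visits
    (∀ x ∈ M.Ωx, M.rate x = ∫ y in M.Ωy, (M.K x y : ℝ) * M.φ y ∧
      ∀ (k : ℕ) (t : ℝ), 0 ≤ t → Tendsto
        (fun h : ℝ => (N.classLaw x).real
          {τ | TripMobility.visits t τ = k ∧ TripMobility.visits (t + h) τ = k + 1} / h)
        (𝓝[>] 0)
        (𝓝 (M.rate x * (N.classLaw x).real {τ | TripMobility.visits t τ = k}))) ∧
    -- the master equation with initial condition, which determines the visit distribution
    (∀ x ∈ M.Ωx,
      (∀ t : ℝ, IsProbabilityMeasure (N.condVisit x t)) ∧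
      N.condVisit x 0 = Measure.dirac 0 ∧
      TripMobility.MasterEquation (M.rate x) (M.weightPDF x) (N.condVisit x) ∧
      (∀ p : ℝ → Measure ℝ, (∀ t, 0 ≤ t → IsFiniteMeasure (p t)) → p 0 = Measure.dirac 0 →
        TripMobility.MasterEquation (M.rate x) (M.weightPDF x) p →
        ∀ t, 0 ≤ t → p t = N.condVisit x t)) ∧
    -- the master equation pointwise, for the density next to the atom at `0`
    (∀ x ∈ M.Ωx, ∃ q : ℝ → ℝ → ℝ, Measurable (Function.uncurry q) ∧ (∀ κ t, 0 ≤ q κ t) ∧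
      (∀ t, 0 ≤ t → N.condVisit x t =
        ENNReal.ofReal (Real.exp (-(M.rate x * t))) • Measure.dirac 0 +
          (volume.restrict (Ioi 0)).withDensity (fun κ => ENNReal.ofReal (q κ t))) ∧
      ∀ᵐ κ ∂(volume.restrict (Ioi (0 : ℝ))), ∀ t, 0 ≤ t →
        IntervalIntegrable (fun r => M.weightPDF x r * q (κ - r) t) volume 0 κ ∧
        HasDerivWithinAt (fun s => q κ s)
          (M.rate x * ((∫ r in (0 : ℝ)..κ, M.weightPDF x r * q (κ - r) t) +
            M.weightPDF x κ * Real.exp (-(M.rate x * t))) - M.rate x * q κ t) (Ici 0) t) ∧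
    -- the conditional visit distribution is asymptotically a truncated normal law
    (∀ x ∈ M.Ωx, 0 < M.rate x → M.FiniteSecondMoment x →
      TripMobility.AsympEqTV (N.condVisit x)
        (fun t => TripMobility.truncNormal
          (M.rate x * M.weightMoment 1 x * t) (M.rate x * M.weightMoment 2 x * t)) ∧
      Tendsto (fun t => TripMobility.truncFactor
          (M.rate x * M.weightMoment 1 x * t) (M.rate x * M.weightMoment 2 x * t))
        atTop (𝓝 1)) ∧
    -- the overall visit distribution is a mixture
    (∀ n : ℕ, 0 < n → ∀ t : ℝ, 0 ≤ t → ∀ B : Set ℝ, MeasurableSet B →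
      N.visitDistribution n t B = ∫⁻ x in M.Ωx, N.condVisit x t B * M.ρ x) ∧
    -- its asymptotic form
    (UniqueDiffOn ℝ M.Ωx → (∀ x ∈ M.Ωx, M.FiniteSecondMoment x) →
      (∀ κ t : ℝ, 0 < t → ContDiffOn ℝ 1 (M.z κ t) M.Ωx ∧
        ∀ x ∈ M.Ωx, derivWithin (M.z κ t) M.Ωx x ≠ 0) →
      ∀ n : ℕ, 0 < n → TripMobility.AsympEqTV (N.visitDistribution n)
        (fun t => volume.withDensity (fun κ => M.rootSum κ t))) := by
  obtain ⟨h_rate, h_master, h_density, h_normal, h_mixture, h_asymp⟩ := proposition1_general M P N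
  exact ⟨h_rate, h_master, h_density, h_normal, h_mixture, fun _ h2 hz n hn =>
    h_asymp h2 (fun κ t ht => (hz κ t ht).2) n hn⟩
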